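/- **Notation.** $p$ always denotes a prime and $k\ge 1$ an integer. For real $1\le D_1<D$ put $\mathcal F(D_1,D)=\{d : D_1<d<D,\ d \text{ a fundamental discriminant}\}$ and $\mathcal F(D)=\mathcal F(1,D)$. Let $\chi_d=\left(\frac{d}{\cdot}\right)$ be the Kronecker symbol and $L(s,\chi_d)$ its (analytically continued) $L$-function. Put $$A(\alpha;\gamma)=\prod_p\Bigl(1-\tfrac{1}{p^{1+\alpha+\gamma}}\Bigr)^{-1}\Bigl(1-\tfrac{1}{(p+1)p^{1+2\alpha}}-\tfrac{1}{(p+1)p^{\alpha+\gamma}}\Bigr),\qquad g_d(r)=\Bigl(\frac d\pi\Bigr)^{-r}\frac{\Gamma(\frac14-\frac r2)}{\Gamma(\frac14+\frac r2)}.$$ **Ratios conjecture (Conrey–Snaith).** For all $\varepsilon,c,C>0$ there is $K$ such that for all $D>1$ and all complex $\alpha\neq\gamma$ with $\frac{c}{\log D}\le\Re\alpha<\frac14$, $\frac{c}{\log D}\le\Re\gamma<\frac34$, $|\Im\alpha|,|\Im\gamma|\le C D^{1-\varepsilon}$, $$\Bigl|\sum_{d\in\mathcal F(D)}\frac{L(\frac12+\alpha,\chi_d)}{L(\frac12+\gamma,\chi_d)}-\sum_{d\in\mathcal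 F(D)}\Bigl[\frac{\zeta(1+2\alpha)}{\zeta(1+\alpha+\gamma)}A(\alpha;\gamma)+g_d(\alpha)\frac{\zeta(1-2\alpha)}{\zeta(1-\alpha+\gamma)}A(-\alpha;\gamma)\Bigr]\Bigr|\le K D^{\frac12+\varepsilon}.$$ **Remainder.** Define $\mathcal R(D,r)$ by $$\sum_{d\in\mathcal F(D)}\frac{L'(\frac12+r,\chi_d)}{L(\frac12+r,\chi_d)}=\sum_{d\in\mathcal F(D)}\Bigl[\frac{\zeta'(1+2r)}{\zeta(1+2r)}+\sum_p\frac{\log p}{(p+1)(p^{1+2r}-1)}-g_d(r)\,\zeta(1-2r)\,A(-r;r)\Bigr]+\mathcal R(D,r).$$ **Theorem.** Assume the ratios conjecture above. Let $0<\varepsilon<\frac14$ and $C>0$. 1. For every $\eta>0$ we have $\mathcal R(D,\varepsilon+it)\ll D^{\frac12+\eta}$ for all $D>1$ and real $|t|\le C D^{1-\varepsilon}$, the implied constant depending only on $\varepsilon, C,\eta$. 2. Let $\mathcal R:(1,\infty)\to\mathbb R$ be any nondecreasing function with $|\mathcal R(D,\varepsilon+it)|\le\mathcal R(D)$ for all $D>1$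 and real $|t|\le CD^{1-\varepsilon}$. Let $X\notin\mathbb Z$, $2<T<X$, $\frac1{\log X}<\varepsilon$, $1<D_1<D$, $T\le CX^{1-\varepsilon}$, $T\le CD_1^{1-\varepsilon}$, and suppose that $\mathcal F_\chi=\mathcal F(D_1,D)$ is nonempty. Then $$\frac{1}{\#\mathcal F_\chi}\sum_{d\in\mathcal F_\chi}\sum_{\substack{p^k<X\\k\text{ odd}}}\chi_d(p)\log p=\frac{X^{\frac12}}{2\pi i}\int_{\frac12+\varepsilon-iT}^{\frac12+\varepsilon+iT}\frac{\pi^2}{6}\frac{\Gamma(\frac{1-s}2)}{\Gamma(\frac s2)}\frac{\zeta(2-2s)}{\zeta(3-2s)}\frac1{\#\mathcal F_\chi}\sum_{d\in\mathcal F_\chi}\Bigl(\frac{\pi X}{d}\Bigr)^{s-\frac12}\frac{ds}{s}$$ $$+\sum_{\substack{p^k<X\\k\text{ even}}}\frac{\#\{d\in\mathcal F_\chi: p\mid d\}}{\#\mathcal F_\chi}\log p+O\Bigl(X^{\frac12+\varepsilon}T^{\varepsilon}\,\mathcal R(D)\,\#\mathcal F_\chi^{-1}+X^{1+\varepsilon}T^{-1+\varepsilon}D^{\varepsilon}\Bigr),$$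 where the implied constant depends only on $\varepsilon$ and $C$ (not on $\mathcal R$, $X$, $T$, $D_1$, $D$). -/

import Mathlib

open scoped BigOperators

noncomputable section

namespace Murmuration

/-- `d` is a fundamental discriminant: `d ≡ 1 (mod 4)` is squarefree, or `d = 4m` with `m`
squarefree and `m ≡ 2, 3 (mod 4)`.  (The value `1` is excluded from the families below.) -/
def IsFundamentalDiscriminant (d : ℕ) : Prop :=
  (d % 4 = 1 ∧ Squarefree d) ∨
    ∃ m : ℕ, d = 4 * m ∧ (m % 4 = 2 ∨ m % 4 = 3) ∧ Squarefree m

open Classical in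
/-- The finite set of fundamental discriminants `d` with `D₁ < d < D`. -/
def discFamily (D₁ D : ℝ) : Finset ℕ :=
  {d ∈ Finset.range ⌈D⌉₊ | D₁ < (d : ℝ) ∧ (d : ℝ) < D ∧ IsFundamentalDiscriminant d}

/-- The Kronecker symbol `(d / n)` for an integer `d` and a natural number `n`.  At `2` it is
`0` for even `d`, `1` for `d ≡ ±1 (mod 8)` and `-1` for `d ≡ ±3 (mod 8)`; at the odd part of `n`
it is the Jacobi symbol. -/
def kroneckerSym (d : ℤ) (n : ℕ) : ℤ :=
  if n = 0 then (if d.natAbs = 1 then 1 else 0)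
  else ZMod.χ₈ (d : ZMod 8) ^ n.factorization 2 * jacobiSym d (n / 2 ^ n.factorization 2)

/-- The (analytically continued) `L`-function `L(s, χ_d)` of the Kronecker symbol
`χ_d = (d / ·)`, which is periodic modulo `d` when `d` is a positive fundamental discriminant. -/
def quadraticL (d : ℕ) (s : ℂ) : ℂ :=
  if h : d = 0 then 0
  else
    haveI : NeZero d := ⟨h⟩
    ZMod.LFunction (fun a : ZMod d => (kroneckerSym d a.val : ℂ)) s

/-- The Euler product
`A(α; γ) = ∏_p (1 - p^{-1-α-γ})⁻¹ (1 - 1 / ((p+1) p^{1+2α}) - 1 / ((p+1) p^{α+γ}))`. -/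
def ratiosA (α γ : ℂ) : ℂ :=
  ∏' p : Nat.Primes,
    (1 - 1 / ((p : ℕ) : ℂ) ^ (1 + α + γ))⁻¹ *
      (1 - 1 / ((((p : ℕ) : ℂ) + 1) * ((p : ℕ) : ℂ) ^ (1 + 2 * α))
        - 1 / ((((p : ℕ) : ℂ) + 1) * ((p : ℕ) : ℂ) ^ (α + γ)))

/-- The factor `(d/π)^{-r} Γ(1/4 - r/2) / Γ(1/4 + r/2)` from the functional equation of
`L(1/2 + r, χ_d)`. -/
def dualFactor (d : ℕ) (r : ℂ) : ℂ :=
  (((d : ℝ) / Real.pi : ℝ) : ℂ) ^ (-r) * (Complex.Gamma (1 / 4 - r / 2) /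
    Complex.Gamma (1 / 4 + r / 2))

/-- The prediction of the ratios recipe for `L(1/2 + α, χ_d) / L(1/2 + γ, χ_d)`. -/
def ratiosPrediction (d : ℕ) (α γ : ℂ) : ℂ :=
  riemannZeta (1 + 2 * α) / riemannZeta (1 + α + γ) * ratiosA α γ +
    dualFactor d α * (riemannZeta (1 - 2 * α) / riemannZeta (1 - α + γ)) * ratiosA (-α) γ

/-- The ratios conjecture for one `L`-function over one `L`-function in the family of real even
primitive Dirichlet characters, with error term `O(D^{1/2 + ε})`, uniformly for
`1 / log D ≪ Re α < 1/4`, `1 / log D ≪ Re γ < 3/4` and `Im α, Im γ ≪ D^{1 - ε}`.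
At `α = γ`, where the second term of the prediction vanishes because of the pole of `ζ(1 - α + γ)`,
nothing is asserted. -/
def RatiosConjecture : Prop :=
  ∀ ε : ℝ, 0 < ε → ∀ c : ℝ, 0 < c → ∀ C : ℝ, 0 < C → ∃ K : ℝ, ∀ D : ℝ, 1 < D →
    ∀ α γ : ℂ,
      c / Real.log D ≤ α.re → α.re < 1 / 4 →
      c / Real.log D ≤ γ.re → γ.re < 3 / 4 →
      |α.im| ≤ C * D ^ (1 - ε) → |γ.im| ≤ C * D ^ (1 - ε) → α ≠ γ →
      ‖∑ d ∈ discFamily 1 D, quadraticL d (1 / 2 + α) / quadraticL d (1 / 2 + γ)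
          - ∑ d ∈ discFamily 1 D, ratiosPrediction d α γ‖ ≤ K * D ^ (1 / 2 + ε)

/-- The remainder `𝓡(D)`, at the point `r`, in the averaged logarithmic derivative:
`∑_{1 < d < D} L'/L(1/2 + r, χ_d)` minus
`∑_{1 < d < D} [ζ'/ζ(1 + 2r) + ∑_p log p / ((p+1)(p^{1+2r} - 1))
  - (d/π)^{-r} Γ(1/4 - r/2) / Γ(1/4 + r/2) ζ(1 - 2r) A(-r; r)]`. -/
def ratiosRemainder (D : ℝ) (r : ℂ) : ℂ :=
  ∑ d ∈ discFamily 1 D, deriv (quadraticL d) (1 / 2 + r) / quadraticL d (1 / 2 + r)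
    - ∑ d ∈ discFamily 1 D,
        (deriv riemannZeta (1 + 2 * r) / riemannZeta (1 + 2 * r)
          + ∑' p : Nat.Primes, (Real.log (p : ℕ) : ℂ) /
              ((((p : ℕ) : ℂ) + 1) * (((p : ℕ) : ℂ) ^ (1 + 2 * r) - 1))
          - dualFactor d r * riemannZeta (1 - 2 * r) * ratiosA (-r) r)

open Classical in
/-- The pairs `(p, k)` with `p` prime, `k ≥ 1` and `p ^ k < X`. -/
def primePowerPairs (X : ℝ) : Finset (ℕ × ℕ) :=
  {q ∈ Finset.range ⌈X⌉₊ ×ˢ Finset.range ⌈X⌉₊ |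
    q.1.Prime ∧ 1 ≤ q.2 ∧ (q.1 : ℝ) ^ q.2 < X}

/-- The average over `d ∈ discFamily D₁ D` of `∑_{p^k < X, k odd} χ_d(p) log p`. -/
def oddAverage (D₁ D X : ℝ) : ℝ :=
  1 / ((discFamily D₁ D).card : ℝ) * ∑ d ∈ discFamily D₁ D,
    ∑ q ∈ primePowerPairs X with Odd q.2, (kroneckerSym d q.1 : ℝ) * Real.log q.1

/-- `∑_{p^k < X, k even} (#{d : p ∣ d} / #family) log p`. -/
def evenTerm (D₁ D X : ℝ) : ℝ :=
  ∑ q ∈ primePowerPairs X with Even q.2,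
    (((discFamily D₁ D).filter (fun d => q.1 ∣ d)).card : ℝ) / ((discFamily D₁ D).card : ℝ)
      * Real.log q.1

/-- The integral of `f` along the vertical segment from `σ - iT` to `σ + iT`. -/
def verticalIntegral (f : ℂ → ℂ) (σ T : ℝ) : ℂ :=
  Complex.I * ∫ t in (-T)..T, f ((σ : ℂ) + (t : ℂ) * Complex.I)

/-- The integrand `(π²/6) Γ((1-s)/2)/Γ(s/2) ζ(2-2s)/ζ(3-2s) (1/#family) ∑_d (πX/d)^{s-1/2} / s`. -/
def murmurationIntegrand (D₁ D X : ℝ) (s : ℂ) : ℂ :=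
  (Real.pi : ℂ) ^ 2 / 6 * (Complex.Gamma ((1 - s) / 2) / Complex.Gamma (s / 2)) *
    (riemannZeta (2 - 2 * s) / riemannZeta (3 - 2 * s)) *
    (1 / ((discFamily D₁ D).card : ℂ) * ∑ d ∈ discFamily D₁ D,
      ((Real.pi * X / (d : ℝ) : ℝ) : ℂ) ^ (s - 1 / 2)) / s

/-- `X^{1/2} / (2πi)` times the integral of `murmurationIntegrand` from `1/2 + ε - iT` to
`1/2 + ε + iT`. -/
def murmurationTerm (D₁ D X ε T : ℝ) : ℂ :=
  ((X ^ (1 / 2 : ℝ) : ℝ) : ℂ) / (2 * (Real.pi : ℂ) * Complex.I) *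
    verticalIntegral (murmurationIntegrand D₁ D X) (1 / 2 + ε) T

end Murmuration

end

noncomputable section
namespace Murmuration
open scoped NumberTheorySymbols

/-! ### The Kronecker symbol as a Dirichlet character -/

/-! Part 1 is a Cauchy estimate. Fix `γ = r = ε + it` and view the averaged ratio minus its
prediction as a function of `α`. Once the removable singularity of `1/ζ(1 - α + γ)` at `α = γ` is
filled in, this function is holomorphic near `r`. Its derivative at `α = r` is exactly the remainder
(`hasDerivAt_ratiosDifference_self`). On a circle about `r` whose radius depends only on `ε` the
conjecture bounds it, and Cauchy's inequality bounds the derivative (`ratiosRemainder_bound`).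

Part 2 is an explicit formula. It needs zero-freeness, which the conjecture supplies discriminant by
discriminant: subtracting its instances at `D = d` and `D = d + 1` leaves the single ratio `L(1/2 +
x, χ_d)/L(1/2 + γ, χ_d)` up to bounded terms. This ratio would blow up as `γ` approached a zero
(`quadraticL_ne_zero`). Given zero-freeness, Borel–Carathéodory gives `L'/L ≪ log(d(|t| + 6))`
(`norm_logDeriv_LFunction_le`). Perron's formula for `∑ Λ(n) χ_d(n)` on `Re s = 1 + ε` can then be
moved to `Re s = 1/2 + ε` without residues (`norm_twistedPsi_sub_verticalIntegral_le`).

On the new line the average of `-L'/L` is replaced by the prediction, at the cost of two remainders,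
because the family `D₁ < d < D` is a difference of two initial families. The diagonal part of the
prediction is the Dirichlet series of `Λ(n)(1 - 1/(p+1))` over squares `n`. A second use of Perron
turns it back into the sum over even prime powers, up to `O(log³ X)`. In the dual part `A(-r; r) =
ζ(2)/ζ(2 - 2r)` (`ratiosA_neg_self`), which produces the integrand of the theorem. Finally
`χ_d(p)^k` is `χ_d(p)` for odd `k` and the indicator of `p ∤ d` for even `k`; the even powers
therefore cancel except for those with `p ∣ d` (`oddAverage_eq`). -/

lemma kroneckerSym_one_right (d : ℤ) : kroneckerSym d 1 = 1 := by
  simp [kroneckerSym]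

lemma kroneckerSym_zero_right {d : ℕ} (hd : 1 < d) : kroneckerSym d 0 = 0 := by
  have : d ≠ 1 := by omega
  simp [kroneckerSym, this]

lemma kroneckerSym_mul_right (d : ℤ) {m n : ℕ} (hm : m ≠ 0) (hn : n ≠ 0) :
    kroneckerSym d (m * n) = kroneckerSym d m * kroneckerSym d n := by
  have hm' : m / 2 ^ m.factorization 2 ≠ 0 := (Nat.ordCompl_pos 2 hm).ne'
  have hn' : n / 2 ^ n.factorization 2 ≠ 0 := (Nat.ordCompl_pos 2 hn).ne'
  rw [kroneckerSym, kroneckerSym, kroneckerSym, if_neg hm, if_neg hn, if_neg (mul_ne_zero hm hn),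
    Nat.ordCompl_mul, jacobiSym.mul_right' _ hm' hn', Nat.factorization_mul hm hn]
  simp only [Finsupp.coe_add, Pi.add_apply, pow_add]
  ring

lemma odd_ordCompl_two {n : ℕ} (hn : n ≠ 0) : Odd (n / 2 ^ n.factorization 2) := by
  rw [← Nat.not_even_iff_odd, even_iff_two_dvd]
  exact Nat.not_dvd_ordCompl Nat.prime_two hn

lemma kroneckerSym_of_odd_right (d : ℤ) {n : ℕ} (hn : Odd n) : kroneckerSym d n = J(d | n) := by
  have h0 : n ≠ 0 := by rintro rfl; simp at hn
  have h2 : n.factorization 2 = 0 :=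
    Nat.factorization_eq_zero_of_not_dvd (by rwa [← even_iff_two_dvd, Nat.not_even_iff_odd])
  simp [kroneckerSym, h0, h2]

/-- Reciprocity has no sign when `d ≡ 1 (mod 4)`, and the power of `2` matches because `(2/d) =
χ₈(d)`. With `n` on top, periodicity modulo `d` becomes visible. -/
lemma kroneckerSym_eq_jacobiSym {d : ℕ} (hd : d % 4 = 1) (h1 : 1 < d) (n : ℕ) :
    kroneckerSym d n = J(n | d) := by
  rcases eq_or_ne n 0 with rfl | hn
  · rw [kroneckerSym_zero_right h1]
    simpa using (jacobiSym.zero_left h1).symm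
  have hodd : Odd d := Nat.odd_iff.mpr (by omega)
  have hsplit : ((n : ℕ) : ℤ) = (2 : ℤ) ^ n.factorization 2 * ((n / 2 ^ n.factorization 2 : ℕ) : ℤ) := by
    exact_mod_cast (Nat.ordProj_mul_ordCompl_eq_self n 2).symm
  conv_rhs => rw [hsplit]
  rw [jacobiSym.mul_left, jacobiSym.pow_left, jacobiSym.at_two hodd, kroneckerSym, if_neg hn,
    jacobiSym.quadratic_reciprocity_one_mod_four hd (odd_ordCompl_two hn)]
  simp

/-- The square factor `4` only kills even `n`. Here `n` stays below, and periodicity modulo `4m` is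
that of the Jacobi symbol in its lower argument. -/
lemma kroneckerSym_four_mul {m : ℕ} (hm : m ≠ 0) (n : ℕ) :
    kroneckerSym ((4 * m : ℕ) : ℤ) n = if Odd n then J(m | n) else 0 := by
  split_ifs with h
  · rw [kroneckerSym_of_odd_right _ h]
    push_cast
    rw [jacobiSym.mul_left, jacobiSym.at_four h, one_mul]
  · rcases eq_or_ne n 0 with rfl | hn
    · exact kroneckerSym_zero_right (by omega)
    have h2 : n.factorization 2 ≠ 0 := by
      have := (Nat.Prime.dvd_iff_one_le_factorization Nat.prime_two hn).mp
        (even_iff_two_dvd.mp (Nat.not_odd_iff_even.mp h))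
      omega
    have h8 : ZMod.χ₈ (((4 * m : ℕ) : ℤ) : ZMod 8) = 0 := by
      have : (((4 * m : ℕ) : ℤ) : ZMod 8) = ((4 * (m % 2) : ℕ) : ZMod 8) := by
        rw [Int.cast_natCast, ZMod.natCast_eq_natCast_iff]
        unfold Nat.ModEq
        omega
      rw [this]
      rcases Nat.mod_two_eq_zero_or_one m with h | h <;> rw [h] <;> decide
    rw [kroneckerSym, if_neg hn, h8, zero_pow h2, zero_mul]

lemma kroneckerSym_mod {d : ℕ} (hd : IsFundamentalDiscriminant d) (h1 : 1 < d) (n : ℕ) :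
    kroneckerSym d (n % d) = kroneckerSym d n := by
  rcases hd with ⟨hd, -⟩ | ⟨m, rfl, -, -⟩
  · rw [kroneckerSym_eq_jacobiSym hd h1, kroneckerSym_eq_jacobiSym hd h1]
    exact jacobiSym.mod_left' (by push_cast; exact Int.emod_emod_of_dvd _ dvd_rfl)
  · have hm : m ≠ 0 := by omega
    rw [kroneckerSym_four_mul hm, kroneckerSym_four_mul hm]
    have hiff : Odd (n % (4 * m)) ↔ Odd n := by
      rw [Nat.odd_iff, Nat.odd_iff, Nat.mod_mod_of_dvd]
      exact ⟨2 * m, by ring⟩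
    simp only [hiff]
    split_ifs with h
    · exact (jacobiSym.mod_right' m h).symm
    · rfl

lemma kroneckerSym_eq_zero_of_not_coprime {d : ℕ} (hd : IsFundamentalDiscriminant d) (h1 : 1 < d)
    {n : ℕ} (hn : ¬ n.Coprime d) : kroneckerSym d n = 0 := by
  rcases hd with ⟨hd, -⟩ | ⟨m, rfl, -, -⟩
  · rw [kroneckerSym_eq_jacobiSym hd h1]
    exact jacobiSym.eq_zero_iff.mpr ⟨by omega, by simpa [Int.gcd_natCast_natCast] using hn⟩
  · have hm : m ≠ 0 := by omega
    rw [kroneckerSym_four_mul hm]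
    split_ifs with h
    · have h4 : n.Coprime 4 := by
        have : n.Coprime (2 ^ 2) := Nat.Coprime.pow_right 2 (Nat.coprime_two_right.mpr h)
        simpa using this
      have hnm : ¬ m.Coprime n := fun hc => hn (h4.mul_right hc.symm)
      refine jacobiSym.eq_zero_iff.mpr ⟨?_, by simpa [Int.gcd_natCast_natCast] using hnm⟩
      rintro rfl
      simp at h
    · rfl

/-- The Chinese remainder theorem places the sign at one prime and makes `n ≡ 1` at the rest. For
odd `d` it sits at a prime `p ∣ d`, coprime to its cofactor by squarefreeness. For `d = 4m` it sits
at `2`: `n ≡ 5 (mod 8)` if `m` is even, `n ≡ 3 (mod 4)` if `m ≡ 3 (mod 4)`. This makes `χ_d`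
nonprincipal and its `L`-function entire. -/
lemma exists_kroneckerSym_eq_neg_one {d : ℕ} (hd : IsFundamentalDiscriminant d) (h1 : 1 < d) :
    ∃ n : ℕ, kroneckerSym d n = -1 := by
  rcases hd with ⟨hd, hsq⟩ | ⟨m, rfl, hm4, -⟩
  · obtain ⟨p, hp, e, rfl⟩ := Nat.exists_prime_and_dvd h1.ne'
    have := Fact.mk hp
    have hp2 : p ≠ 2 := by rintro rfl; omega
    have hcop : p.Coprime e := (Nat.squarefree_mul_iff.mp hsq).1
    obtain ⟨a, ha⟩ := FiniteField.exists_nonsquare (F := ZMod p) (by rwa [ZMod.ringChar_zmod_n])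
    obtain ⟨n, hn1, hn2⟩ := Nat.chineseRemainder hcop a.val 1
    refine ⟨n, ?_⟩
    have he0 : e ≠ 0 := by rintro rfl; omega
    rw [kroneckerSym_eq_jacobiSym hd h1, jacobiSym.mul_right' _ hp.ne_zero he0,
      ← jacobiSym.legendreSym.to_jacobiSym]
    have hleg : legendreSym p n = -1 := by
      rw [legendreSym.eq_neg_one_iff]
      rw [← ZMod.natCast_eq_natCast_iff] at hn1
      simpa [hn1] using ha
    have hj : J(n | e) = 1 := by
      rw [← jacobiSym.one_left e]
      refine jacobiSym.mod_left' ?_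
      exact_mod_cast hn2
    rw [hleg, hj]
    norm_num
  · have hm : m ≠ 0 := by omega
    rcases hm4 with hm4 | hm4
    · obtain ⟨k, rfl⟩ : 2 ∣ m := by omega
      have hk : Odd k := Nat.odd_iff.mpr (by omega)
      have hcop : k.Coprime 8 := by
        have : k.Coprime (2 ^ 3) := Nat.Coprime.pow_right 3 (Nat.coprime_two_right.mpr hk)
        simpa using this
      obtain ⟨n, hn1, hn2⟩ := Nat.chineseRemainder hcop 1 5
      refine ⟨n, ?_⟩
      have hn8 : n % 8 = 5 := hn2
      have hnodd : Odd n := Nat.odd_iff.mpr (by omega)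
      rw [kroneckerSym_four_mul hm, if_pos hnodd]
      push_cast
      rw [jacobiSym.mul_left, jacobiSym.at_two hnodd,
        jacobiSym.quadratic_reciprocity_one_mod_four' hk (by omega)]
      have hj : J(n | k) = 1 := by
        rw [← jacobiSym.one_left k]
        refine jacobiSym.mod_left' ?_
        exact_mod_cast hn1
      have h8 : (n : ZMod 8) = ((5 : ℕ) : ZMod 8) := (ZMod.natCast_eq_natCast_iff _ _ _).mpr hn2
      rw [hj, h8]
      decide
    · have hodd : Odd m := Nat.odd_iff.mpr (by omega)
      have hcop : m.Coprime 4 := by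
        have : m.Coprime (2 ^ 2) := Nat.Coprime.pow_right 2 (Nat.coprime_two_right.mpr hodd)
        simpa using this
      obtain ⟨n, hn1, hn2⟩ := Nat.chineseRemainder hcop 1 3
      refine ⟨n, ?_⟩
      have hn4 : n % 4 = 3 := hn2
      have hnodd : Odd n := Nat.odd_iff.mpr (by omega)
      rw [kroneckerSym_four_mul hm, if_pos hnodd,
        jacobiSym.quadratic_reciprocity_three_mod_four hm4 hn4]
      have hj : J(n | m) = 1 := by
        rw [← jacobiSym.one_left m]
        refine jacobiSym.mod_left' ?_
        exact_mod_cast hn1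
      rw [hj]

/-- The Kronecker symbol of a fundamental discriminant `d > 1` is a nonprincipal Dirichlet
character modulo `d`. -/
theorem exists_dirichletCharacter_eq_kroneckerSym {d : ℕ} (hd : IsFundamentalDiscriminant d)
    (h1 : 1 < d) :
    ∃ χ : DirichletCharacter ℂ d, χ ≠ 1 ∧ ∀ n : ℕ, χ (n : ZMod d) = (kroneckerSym d n : ℂ) := by
  have : NeZero d := ⟨by omega⟩
  have : Fact (1 < d) := ⟨h1⟩
  let χ : DirichletCharacter ℂ d :=
    { toFun := fun a => (kroneckerSym d a.val : ℂ)
      map_one' := by simp [ZMod.val_one, kroneckerSym_one_right]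
      map_mul' := fun a b => by
        rcases eq_or_ne a 0 with rfl | ha
        · simp [kroneckerSym_zero_right h1]
        rcases eq_or_ne b 0 with rfl | hb
        · simp [kroneckerSym_zero_right h1]
        rw [ZMod.val_mul, kroneckerSym_mod hd h1, kroneckerSym_mul_right]
        · push_cast; rfl
        · rwa [Ne, ZMod.val_eq_zero]
        · rwa [Ne, ZMod.val_eq_zero]
      map_nonunit' := fun a ha => by
        have : ¬ a.val.Coprime d := by
          intro hc
          apply ha
          have := (ZMod.isUnit_iff_coprime a.val d).mpr hc
          rwa [ZMod.natCast_zmod_val] at this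
        simp [kroneckerSym_eq_zero_of_not_coprime hd h1 this] }
  have hχ : ∀ n : ℕ, χ (n : ZMod d) = (kroneckerSym d n : ℂ) := fun n => by
    change ((kroneckerSym d ((n : ZMod d)).val : ℤ) : ℂ) = _
    rw [ZMod.val_natCast, kroneckerSym_mod hd h1]
  refine ⟨χ, ?_, hχ⟩
  intro h
  obtain ⟨n, hn⟩ := exists_kroneckerSym_eq_neg_one hd h1
  have h2 := hχ n
  rw [h, hn] at h2
  by_cases hu : IsUnit (n : ZMod d)
  · rw [MulChar.one_apply hu] at h2
    norm_num at h2
  · rw [MulChar.map_nonunit _ hu] at h2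
    norm_num at h2

lemma quadraticL_eq_LFunction {d : ℕ} [NeZero d] {χ : DirichletCharacter ℂ d}
    (hχ : ∀ n : ℕ, χ (n : ZMod d) = (kroneckerSym d n : ℂ)) :
    quadraticL d = DirichletCharacter.LFunction χ := by
  ext s
  rw [quadraticL, dif_neg (NeZero.ne d), DirichletCharacter.LFunction]
  congr 1
  ext a
  rw [← hχ, ZMod.natCast_zmod_val]

lemma kroneckerSym_trichotomy (d : ℤ) (n : ℕ) :
    kroneckerSym d n = 0 ∨ kroneckerSym d n = 1 ∨ kroneckerSym d n = -1 := by
  have h8 : ∀ a : ZMod 8, ZMod.χ₈ a = 0 ∨ ZMod.χ₈ a = 1 ∨ ZMod.χ₈ a = -1 := by decide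
  rw [kroneckerSym]
  split_ifs
  · simp
  · simp
  · rcases h8 (d : ZMod 8) with h | h | h <;>
      rcases jacobiSym.trichotomy d (n / 2 ^ n.factorization 2) with h' | h' | h' <;>
      rw [h, h'] <;> rcases Nat.even_or_odd (n.factorization 2) with he | he <;>
      rcases eq_or_ne (n.factorization 2) 0 with hz | hz <;> simp [hz, he.neg_one_pow]

lemma kroneckerSym_eq_zero_iff {d : ℕ} (hd : IsFundamentalDiscriminant d) (h1 : 1 < d) {p : ℕ}
    (hp : p.Prime) : kroneckerSym d p = 0 ↔ p ∣ d := by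
  obtain ⟨χ, -, hχ⟩ := exists_dirichletCharacter_eq_kroneckerSym hd h1
  rw [hp.dvd_iff_not_coprime]
  refine ⟨fun h hc => ?_, kroneckerSym_eq_zero_of_not_coprime hd h1⟩
  have h2 := hχ p
  rw [h, Int.cast_zero] at h2
  exact (((ZMod.isUnit_iff_coprime p d).mpr hc).map χ).ne_zero h2

lemma mem_discFamily {D₁ D : ℝ} {d : ℕ} :
    d ∈ discFamily D₁ D ↔ D₁ < d ∧ (d : ℝ) < D ∧ IsFundamentalDiscriminant d := by
  simp only [discFamily, Finset.mem_filter, Finset.mem_range, and_iff_right_iff_imp]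
  exact fun h => Nat.lt_ceil.mpr h.2.1

lemma five_le_of_isFundamentalDiscriminant {d : ℕ} (hd : IsFundamentalDiscriminant d)
    (h1 : 1 < d) : 5 ≤ d := by
  rcases hd with ⟨hd, -⟩ | ⟨m, rfl, hm, -⟩ <;> omega

end Murmuration
end

noncomputable section
namespace Murmuration
open Complex MeasureTheory Filter Topology

/-! ### Perron's formula -/

lemma verticalIntegral_sub {f : ℂ → ℂ} {a b T : ℝ} (hab : a ≤ b) (hT : 0 ≤ T)
    (hf : DifferentiableOn ℂ f (Set.Icc a b ×ℂ Set.Icc (-T) T)) :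
    verticalIntegral f b T - verticalIntegral f a T =
      (∫ x in a..b, f (x + T * I)) - ∫ x in a..b, f (x + ((-T : ℝ) : ℂ) * I) := by
  have h := integral_boundary_rect_eq_zero_of_differentiableOn f ⟨a, -T⟩ ⟨b, T⟩
    (by simpa [Set.uIcc_of_le hab, Set.uIcc_of_le (by linarith : -T ≤ T)] using hf)
  simp only [smul_eq_mul] at h
  simp only [verticalIntegral]
  linear_combination h

lemma norm_exp_real_mul (l : ℝ) (s : ℂ) : ‖exp (l * s)‖ = Real.exp (l * s.re) := by
  rw [norm_exp]; simp

lemma abs_im_le_norm_add (x t : ℝ) : |t| ≤ ‖(x : ℂ) + t * I‖ := by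
  simpa using abs_im_le_norm ((x : ℂ) + t * I)

lemma integral_exp_mul_eq {l : ℝ} (hl : l ≠ 0) (a b : ℝ) :
    ∫ x in a..b, Real.exp (l * x) = (Real.exp (l * b) - Real.exp (l * a)) / l := by
  have : ∀ x ∈ Set.uIcc a b, HasDerivAt (fun x => Real.exp (l * x) / l) (Real.exp (l * x)) x := by
    intro x _
    have := ((hasDerivAt_id x).const_mul l).exp.div_const l
    simpa [hl, mul_div_assoc] using this
  rw [intervalIntegral.integral_eq_sub_of_hasDerivAt this]
  · ring
  · exact (by fun_prop : Continuous fun x => Real.exp (l * x)).intervalIntegrable _ _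

lemma norm_horizontal_kernel_le {l T : ℝ} (hl : l ≠ 0) (hT : T ≠ 0) {a b : ℝ} (hab : a ≤ b) :
    ‖∫ x in a..b, exp (l * ((x : ℂ) + T * I)) / ((x : ℂ) + T * I)‖ ≤
      (Real.exp (l * b) - Real.exp (l * a)) / l / |T| := by
  have hT' : 0 < |T| := abs_pos.mpr hT
  calc _ ≤ ∫ x in a..b, Real.exp (l * x) / |T| := by
        refine intervalIntegral.norm_integral_le_of_norm_le hab (ae_of_all _ fun x _ => ?_) ?_
        · rw [norm_div, norm_exp_real_mul]
          simp only [add_re, ofReal_re, mul_re, I_re, mul_zero, ofReal_im, I_im, mul_one, sub_self,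
            add_zero]
          gcongr
          exact abs_im_le_norm_add x T
        · exact (by fun_prop : Continuous fun x => Real.exp (l * x) / |T|).intervalIntegrable _ _
    _ = _ := by rw [intervalIntegral.integral_div, integral_exp_mul_eq hl]

lemma norm_verticalIntegral_le {f : ℂ → ℂ} {σ T B : ℝ} (hT : 0 ≤ T)
    (hf : ∀ t ∈ Set.Icc (-T) T, ‖f (σ + t * I)‖ ≤ B) : ‖verticalIntegral f σ T‖ ≤ 2 * T * B := by
  rw [verticalIntegral, norm_mul, norm_I, one_mul]
  have := intervalIntegral.norm_integral_le_of_norm_le_const (a := -T) (b := T) (C := B)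
    (f := fun t : ℝ => f (σ + t * I)) (fun t ht => hf t ?_)
  · rw [show |T - -T| = 2 * T by rw [abs_of_nonneg] <;> linarith] at this
    linarith
  · rw [Set.uIoc_of_le (by linarith)] at ht
    exact ⟨ht.1.le, ht.2⟩

/-- The kernel decays to the right when `l < 0`. The segment is pushed to abscissa `U` and `U → ∞`,
so only the two horizontal sides remain. -/
lemma norm_verticalIntegral_kernel_of_neg {l c T : ℝ} (hl : l < 0) (hc : 0 < c) (hT : 0 < T) :
    ‖verticalIntegral (fun s => exp (l * s) / s) c T‖ ≤ 2 * Real.exp (l * c) / (T * |l|) := by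
  have key : ∀ U : ℝ, c ≤ U → ‖verticalIntegral (fun s => exp (l * s) / s) c T‖ ≤
      2 * Real.exp (l * c) / (T * |l|) + 2 * T * (Real.exp (l * U) / c) := by
    intro U hU
    have hd : DifferentiableOn ℂ (fun s : ℂ => exp (l * s) / s)
        (Set.Icc c U ×ℂ Set.Icc (-T) T) := by
      intro s hs
      have hs0 : s ≠ 0 := by
        rintro rfl
        have := (mem_reProdIm.mp hs).1.1
        simp at this
        linarith
      exact (DifferentiableAt.div (by fun_prop) (by fun_prop) hs0).differentiableWithinAt
    have h := verticalIntegral_sub hU hT.le hd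
    have h1 := norm_horizontal_kernel_le hl.ne hT.ne' hU
    have h2 := norm_horizontal_kernel_le hl.ne (neg_ne_zero.mpr hT.ne') hU
    have h3 : ‖verticalIntegral (fun s => exp (l * s) / s) U T‖ ≤ 2 * T * (Real.exp (l * U) / c) := by
      refine norm_verticalIntegral_le hT.le fun t _ => ?_
      rw [norm_div, norm_exp_real_mul]
      have : U ≤ ‖(U : ℂ) + t * I‖ := by
        have := abs_re_le_norm ((U : ℂ) + t * I)
        simp at this
        exact (le_abs_self U).trans this
      simp only [add_re, ofReal_re, mul_re, I_re, mul_zero, ofReal_im, I_im, mul_one, sub_self,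
        add_zero]
      gcongr
      linarith
    have h4 : (Real.exp (l * U) - Real.exp (l * c)) / l / |T| ≤ Real.exp (l * c) / (T * |l|) := by
      rw [abs_of_pos hT, abs_of_neg hl, div_div, mul_comm l T,
        ← neg_div_neg_eq, ← mul_neg]
      have hh := Real.exp_pos (l * U)
      gcongr
      · nlinarith
      · linarith
    have h5 : verticalIntegral (fun s => exp (l * s) / s) c T =
      verticalIntegral (fun s => exp (l * s) / s) U T
        - (∫ x in c..U, exp (l * ((x : ℂ) + T * I)) / ((x : ℂ) + T * I))
        + ∫ x in c..U, exp (l * ((x : ℂ) + ((-T : ℝ) : ℂ) * I)) / ((x : ℂ) + ((-T : ℝ) : ℂ) * I) := by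
      linear_combination -h
    rw [h5]
    refine (norm_add_le _ _).trans ?_
    refine (add_le_add (norm_sub_le _ _) le_rfl).trans ?_
    rw [abs_neg] at h2
    have : 2 * Real.exp (l * c) / (T * |l|) = Real.exp (l * c) / (T * |l|) + Real.exp (l * c) / (T * |l|) := by
      ring
    linarith
  have hlim : Tendsto (fun U : ℝ => 2 * Real.exp (l * c) / (T * |l|) + 2 * T * (Real.exp (l * U) / c))
      atTop (𝓝 (2 * Real.exp (l * c) / (T * |l|) + 2 * T * (0 / c))) := by
    refine Tendsto.const_add _ (Tendsto.const_mul _ (Tendsto.div_const ?_ _))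
    exact Real.tendsto_exp_atBot.comp (tendsto_id.const_mul_atTop_of_neg hl)
  rw [zero_div, mul_zero, add_zero] at hlim
  exact ge_of_tendsto hlim ((eventually_ge_atTop c).mono key)

lemma integral_div_sq_add_sq {c : ℝ} (hc : 0 < c) (T : ℝ) :
    ∫ t in (-T)..T, c / (c ^ 2 + t ^ 2) = 2 * Real.arctan (T / c) := by
  have : ∀ t ∈ Set.uIcc (-T) T, HasDerivAt (fun t => Real.arctan (t / c)) (c / (c ^ 2 + t ^ 2)) t := by
    intro t _
    have := ((hasDerivAt_id t).div_const c).arctan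
    refine this.congr_deriv ?_
    simp only [id]
    field_simp
  rw [intervalIntegral.integral_eq_sub_of_hasDerivAt this]
  · rw [neg_div, Real.arctan_neg]; ring
  · refine (Continuous.div (by fun_prop) (by fun_prop) fun t => ?_).intervalIntegrable _ _
    positivity

lemma integral_kernel_even_part {c : ℝ} (hc : 0 < c) (T : ℝ) :
    ∫ t in (-T)..T, (c / (c ^ 2 + t ^ 2) : ℂ) = 2 * Real.arctan (T / c) := by
  have := integral_div_sq_add_sq hc T
  rw [← ofReal_ofNat, ← ofReal_mul, ← this, ← intervalIntegral.integral_ofReal]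
  push_cast
  rfl

/-- Together with `horizontal_inv_sub` this computes the residue of `1/s` at `0` by hand: the four
sides of the rectangle add up to `4i (arctan(T/c) + arctan(c/T)) = 2πi`. -/
lemma verticalIntegral_inv_sub {c T : ℝ} (hc : 0 < c) :
    verticalIntegral (fun s => 1 / s) c T - verticalIntegral (fun s => 1 / s) (-c) T =
      4 * I * Real.arctan (T / c) := by
  have hne : ∀ x t : ℝ, x ≠ 0 → (x : ℂ) + t * I ≠ 0 := by
    intro x t hx h
    apply hx
    simpa using congrArg re h
  simp only [verticalIntegral]
  rw [← mul_sub, ← intervalIntegral.integral_sub]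
  · have : ∀ t : ℝ, (1 / ((c : ℂ) + t * I) - 1 / (((-c : ℝ) : ℂ) + t * I)) =
        2 * ((c : ℂ) / ((c : ℂ) ^ 2 + (t : ℂ) ^ 2)) := by
      intro t
      have h1 := hne c t hc.ne'
      have h2 := hne (-c) t (by linarith)
      have h3 : ((c : ℂ) ^ 2 + (t : ℂ) ^ 2) ≠ 0 := by
        norm_cast
        positivity
      push_cast at h2 ⊢
      field_simp
      ring_nf
      simp only [I_sq]
      ring
    simp only [this]
    rw [intervalIntegral.integral_const_mul, integral_kernel_even_part hc]
    ring
  · exact (Continuous.div (by fun_prop) (by fun_prop) fun t => hne c t hc.ne').intervalIntegrable _ _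
  · exact (Continuous.div (by fun_prop) (by fun_prop)
      fun t => hne (-c) t (by linarith)).intervalIntegrable _ _

lemma horizontal_inv_sub {c T : ℝ} (hT : 0 < T) :
    (∫ x in (-c)..c, 1 / ((x : ℂ) + T * I)) - (∫ x in (-c)..c, 1 / ((x : ℂ) + ((-T : ℝ) : ℂ) * I)) =
      -(4 * I * Real.arctan (c / T)) := by
  have hne : ∀ x t : ℝ, t ≠ 0 → (x : ℂ) + t * I ≠ 0 := by
    intro x t hx h
    apply hx
    simpa using congrArg im h
  rw [← intervalIntegral.integral_sub]
  · have : ∀ x : ℝ, (1 / ((x : ℂ) + T * I) - 1 / ((x : ℂ) + ((-T : ℝ) : ℂ) * I)) =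
        (-2 * I) * ((T : ℂ) / ((T : ℂ) ^ 2 + (x : ℂ) ^ 2)) := by
      intro x
      have h1 := hne x T hT.ne'
      have h2 : (x : ℂ) - T * I ≠ 0 := by
        have := hne x (-T) (by linarith)
        push_cast at this
        rwa [neg_mul, ← sub_eq_add_neg] at this
      have h3 : ((T : ℂ) ^ 2 + (x : ℂ) ^ 2) = ((x : ℂ) + T * I) * ((x : ℂ) - T * I) := by
        linear_combination (T : ℂ) ^ 2 * I_sq
      push_cast
      rw [h3, neg_mul (T : ℂ), ← sub_eq_add_neg]
      field_simp
      ring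
    simp only [this]
    rw [intervalIntegral.integral_const_mul, integral_kernel_even_part hT]
    ring
  · exact (Continuous.div (by fun_prop) (by fun_prop) fun t => hne t T hT.ne').intervalIntegrable _ _
  · exact (Continuous.div (by fun_prop) (by fun_prop)
      fun t => hne t (-T) (by linarith)).intervalIntegrable _ _

/-- Write the kernel as `(e^{ls} - 1)/s + 1/s`. The first summand is entire (a `dslope`) and obeys
Cauchy's theorem; the second yields `2πi`. The left side of the rectangle, at `-c`, becomes under `s
↦ -s` the kernel with `-l < 0`, which is already bounded. -/
lemma norm_verticalIntegral_kernel_of_pos {l c T : ℝ} (hl : 0 < l) (hc : 0 < c) (hT : 0 < T) :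
    ‖verticalIntegral (fun s => exp (l * s) / s) c T - 2 * Real.pi * I‖ ≤
      4 * Real.exp (l * c) / (T * |l|) := by
  set g : ℂ → ℂ := dslope (fun s => exp (l * s)) 0 with hg
  have hgd : Differentiable ℂ g := by
    have : DifferentiableOn ℂ g Set.univ :=
      (differentiableOn_dslope univ_mem).mpr (by fun_prop)
    exact differentiableOn_univ.mp this
  have hgs : ∀ s : ℂ, s ≠ 0 → exp (l * s) / s = g s + 1 / s := by
    intro s hs
    rw [hg, dslope_of_ne _ hs, slope_def_field]
    simp only [mul_zero, exp_zero, sub_zero]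
    ring
  have hre : ∀ x t : ℝ, x ≠ 0 → (x : ℂ) + t * I ≠ 0 := by
    intro x t hx h
    exact hx (by simpa using congrArg re h)
  have him : ∀ x t : ℝ, t ≠ 0 → (x : ℂ) + t * I ≠ 0 := by
    intro x t hx h
    exact hx (by simpa using congrArg im h)
  have hgc := hgd.continuous
  have hV : ∀ b : ℝ, b ≠ 0 → verticalIntegral (fun s => exp (l * s) / s) b T =
      verticalIntegral g b T + verticalIntegral (fun s => 1 / s) b T := by
    intro b hb
    simp only [verticalIntegral]
    rw [← mul_add, ← intervalIntegral.integral_add]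
    · congr 1
      exact intervalIntegral.integral_congr fun t _ => hgs _ (hre b t hb)
    · exact (by fun_prop : Continuous fun t : ℝ => g (b + t * I)).intervalIntegrable _ _
    · exact (Continuous.div (by fun_prop) (by fun_prop) fun t => hre b t hb).intervalIntegrable _ _
  have hH : ∀ τ : ℝ, τ ≠ 0 → (∫ x in (-c)..c, exp (l * ((x : ℂ) + τ * I)) / ((x : ℂ) + τ * I)) =
      (∫ x in (-c)..c, g ((x : ℂ) + τ * I)) + ∫ x in (-c)..c, 1 / ((x : ℂ) + τ * I) := by
    intro τ hτ
    rw [← intervalIntegral.integral_add]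
    · exact intervalIntegral.integral_congr fun x _ => hgs _ (him x τ hτ)
    · exact (by fun_prop : Continuous fun x : ℝ => g (x + τ * I)).intervalIntegrable _ _
    · exact (Continuous.div (by fun_prop) (by fun_prop) fun x => him x τ hτ).intervalIntegrable _ _
  have hflip : verticalIntegral (fun s => exp (l * s) / s) (-c) T =
      -verticalIntegral (fun s => exp (((-l : ℝ) : ℂ) * s) / s) c T := by
    simp only [verticalIntegral]
    have := intervalIntegral.integral_comp_neg (a := -T) (b := T)
      (fun t : ℝ => exp (l * (((-c : ℝ) : ℂ) + t * I)) / (((-c : ℝ) : ℂ) + t * I))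
    rw [neg_neg] at this
    rw [← this, ← mul_neg, ← intervalIntegral.integral_neg]
    congr 1
    refine intervalIntegral.integral_congr fun t _ => ?_
    push_cast
    rw [show -(c : ℂ) + -(t : ℂ) * I = -(c + t * I) by ring, div_neg, mul_neg, neg_mul]
  have e1 := verticalIntegral_sub (a := -c) (b := c) (by linarith) hT.le hgd.differentiableOn
  have e2 := verticalIntegral_inv_sub (T := T) hc
  have e3 := horizontal_inv_sub (c := c) hT
  have e4 : Real.arctan (c / T) = Real.pi / 2 - Real.arctan (T / c) := by
    rw [← Real.arctan_inv_of_pos (div_pos hT hc), inv_div]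
  have e4' : (Real.arctan (c / T) : ℂ) = Real.pi / 2 - Real.arctan (T / c) := by
    rw [e4]; push_cast; rfl
  have hmain : verticalIntegral (fun s => exp (l * s) / s) c T - 2 * Real.pi * I =
      -verticalIntegral (fun s => exp (((-l : ℝ) : ℂ) * s) / s) c T
      + (∫ x in (-c)..c, exp (l * ((x : ℂ) + T * I)) / ((x : ℂ) + T * I))
      - ∫ x in (-c)..c, exp (l * ((x : ℂ) + ((-T : ℝ) : ℂ) * I)) / ((x : ℂ) + ((-T : ℝ) : ℂ) * I) := by
    rw [← hflip, hV c hc.ne', hV (-c) (by linarith), hH T hT.ne', hH (-T) (by linarith)]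
    rw [e4'] at e3
    linear_combination e1 + e2 - e3
  have b1 := norm_verticalIntegral_kernel_of_neg (neg_lt_zero.mpr hl) hc hT
  have b2 := norm_horizontal_kernel_le hl.ne' hT.ne' (by linarith : -c ≤ c)
  have b3 := norm_horizontal_kernel_le hl.ne' (neg_ne_zero.mpr hT.ne') (by linarith : -c ≤ c)
  rw [abs_neg] at b1 b3
  rw [abs_of_pos hT] at b2 b3
  have b4 : (Real.exp (l * c) - Real.exp (l * -c)) / l / T ≤ Real.exp (l * c) / (T * |l|) := by
    rw [abs_of_pos hl, div_div, mul_comm l T]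
    gcongr
    linarith [Real.exp_pos (l * -c)]
  have b5 : 2 * Real.exp (-l * c) / (T * |l|) ≤ 2 * Real.exp (l * c) / (T * |l|) := by
    gcongr
    linarith
  rw [hmain]
  refine (norm_sub_le _ _).trans ((add_le_add (norm_add_le _ _) le_rfl).trans ?_)
  rw [norm_neg]
  have : 4 * Real.exp (l * c) / (T * |l|) = 2 * Real.exp (l * c) / (T * |l|) +
    Real.exp (l * c) / (T * |l|) + Real.exp (l * c) / (T * |l|) := by ring
  linarith

lemma arsinh_le_log {T : ℝ} (hT : 0 ≤ T) : Real.arsinh T ≤ Real.log (1 + 2 * T) := by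
  rw [Real.arsinh]
  have h1 : √(1 + T ^ 2) ≤ 1 + T := by
    rw [Real.sqrt_le_left (by linarith)]
    nlinarith
  have h0 := Real.sqrt_nonneg (1 + T ^ 2)
  have h2 : 1 ≤ √(1 + T ^ 2) := by
    rw [Real.one_le_sqrt]
    nlinarith
  exact Real.log_le_log (by linarith) (by linarith)

/-- A vertical integral of a function bounded by `B / |s|` is at most `4 B log (1 + 2 T)`. -/
lemma norm_verticalIntegral_le_log {f : ℂ → ℂ} {σ T B : ℝ} (hσ : 1 / 2 ≤ σ) (hT : 0 ≤ T)
    (hB : 0 ≤ B) (hf : ∀ t ∈ Set.Icc (-T) T, ‖f (σ + t * I)‖ ≤ B / ‖(σ + t * I : ℂ)‖) :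
    ‖verticalIntegral f σ T‖ ≤ 4 * B * Real.log (1 + 2 * T) := by
  rw [verticalIntegral, norm_mul, norm_I, one_mul]
  have hderiv : ∀ t ∈ Set.uIcc (-T) T, HasDerivAt (fun t => 2 * B * Real.arsinh t)
      (2 * B * (√(1 + t ^ 2))⁻¹) t := fun t _ => (Real.hasDerivAt_arsinh t).const_mul _
  have hintegrable : IntervalIntegrable (fun t => 2 * B * (√(1 + t ^ 2))⁻¹) volume (-T) T := by
    refine Continuous.intervalIntegrable ?_ _ _
    refine continuous_const.mul (Continuous.inv₀ (by fun_prop) fun t => ?_)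
    positivity
  calc _ ≤ ∫ t in (-T)..T, 2 * B * (√(1 + t ^ 2))⁻¹ := by
        refine intervalIntegral.norm_integral_le_of_norm_le (by linarith)
          (ae_of_all _ fun t ht => (hf t ⟨ht.1.le, ht.2⟩).trans ?_) hintegrable
        have h1 : √(1 + t ^ 2) ≤ 2 * ‖(σ + t * I : ℂ)‖ := by
          rw [Real.sqrt_le_left (by positivity), mul_pow, Complex.sq_norm, Complex.normSq_add_mul_I]
          nlinarith
        have h2 : 0 < √(1 + t ^ 2) := by positivity
        rw [div_eq_mul_inv, mul_comm 2 B, mul_assoc]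
        gcongr
        rw [← div_eq_mul_inv, ← inv_div]
        gcongr
        linarith
    _ = 4 * B * Real.arsinh T := by
        rw [intervalIntegral.integral_eq_sub_of_hasDerivAt hderiv hintegrable, Real.arsinh_neg]
        ring
    _ ≤ _ := by
        gcongr
        exact arsinh_le_log hT

lemma norm_verticalIntegral_kernel_le_log (l : ℝ) {c T : ℝ} (hc : 1 / 2 ≤ c) (hT : 0 ≤ T) :
    ‖verticalIntegral (fun s => exp (l * s) / s) c T‖ ≤
      4 * Real.exp (l * c) * Real.log (1 + 2 * T) := by
  refine norm_verticalIntegral_le_log hc hT (Real.exp_pos _).le fun t _ => ?_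
  rw [norm_div, norm_exp_real_mul]
  simp

end Murmuration
end

/-! ### Truncated Perron formula for Dirichlet series -/

noncomputable section
namespace Murmuration
open Complex MeasureTheory Filter Topology
open scoped ArithmeticFunction.vonMangoldt

/-- The error in Perron's formula for the single term `n` of a Dirichlet series. -/
def perronError (X σ T : ℝ) (n : ℕ) : ℂ :=
  verticalIntegral (fun s => exp ((Real.log (X / n) : ℝ) * s) / s) σ T -
    if (n : ℝ) < X then 2 * Real.pi * I else 0

lemma term_mul_cpow_div {X : ℝ} (hX : 0 < X) (a : ℕ → ℂ) (ha : a 0 = 0) (s : ℂ) (n : ℕ) :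
    LSeries.term a s n * ((X : ℂ) ^ s / s) = a n * (exp ((Real.log (X / n) : ℝ) * s) / s) := by
  rcases eq_or_ne n 0 with rfl | hn
  · simp [ha]
  have hn' : (0 : ℝ) < n := by positivity
  rw [LSeries.term_of_ne_zero hn, Real.log_div hX.ne' hn'.ne', ofReal_sub, sub_mul, exp_sub,
    cpow_def_of_ne_zero (by exact_mod_cast hn), cpow_def_of_ne_zero (by exact_mod_cast hX.ne'),
    ofReal_log hX.le, ofReal_log hn'.le, ofReal_natCast]
  ring

lemma hasSum_verticalIntegral_LSeries {a : ℕ → ℂ} (ha : a 0 = 0) {σ T X : ℝ} (hσ : 0 < σ)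
    (hs : LSeriesSummable a σ) (hX : 0 < X) :
    HasSum (fun n => a n * verticalIntegral (fun s => exp ((Real.log (X / n) : ℝ) * s) / s) σ T)
      (verticalIntegral (fun s => LSeries a s * ((X : ℂ) ^ s / s)) σ T) := by
  have hne : ∀ t : ℝ, (σ : ℂ) + t * I ≠ 0 := fun t h => hσ.ne' (by simpa using congrArg re h)
  have hsum : Summable fun n => ‖LSeries.term a σ n‖ * (X ^ σ / σ) := hs.norm.mul_right _
  have key := intervalIntegral.hasSum_integral_of_dominated_convergence (μ := volume)
    (a := -T) (b := T)
    (F := fun n t => a n * (exp ((Real.log (X / n) : ℝ) * (σ + t * I)) / (σ + t * I)))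
    (f := fun t : ℝ => LSeries a (σ + t * I) * ((X : ℂ) ^ (σ + t * I : ℂ) / (σ + t * I)))
    (fun n _ => ‖LSeries.term a σ n‖ * (X ^ σ / σ)) (fun n => ?_) (fun n => ae_of_all _ fun t _ => ?_)
    (ae_of_all _ fun t _ => hsum) (intervalIntegrable_const) (ae_of_all _ fun t _ => ?_)
  · have := key.mul_left I
    simp only [verticalIntegral]
    refine this.congr_fun fun n => ?_
    rw [intervalIntegral.integral_const_mul]
    ring
  · refine Continuous.aestronglyMeasurable ?_
    exact continuous_const.mul (Continuous.div (by fun_prop) (by fun_prop) hne)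
  · rw [← term_mul_cpow_div hX a ha, norm_mul, norm_div, norm_cpow_eq_rpow_re_of_pos hX]
    have h1 : ‖LSeries.term a ((σ : ℂ) + t * I) n‖ = ‖LSeries.term a σ n‖ := by
      rw [LSeries.norm_term_eq, LSeries.norm_term_eq]
      simp
    have h2 : σ ≤ ‖(σ : ℂ) + t * I‖ := by
      have := abs_re_le_norm ((σ : ℂ) + t * I)
      simp at this
      exact (le_abs_self σ).trans this
    rw [h1]
    simp only [add_re, ofReal_re, mul_re, I_re, mul_zero, ofReal_im, I_im, mul_one, sub_self,
      add_zero]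
    gcongr
  · have h : LSeriesSummable a ((σ : ℂ) + t * I) := hs.of_re_le_re (by simp)
    simp_rw [← term_mul_cpow_div hX a ha]
    exact h.hasSum.mul_right _

lemma exp_log_div_mul {X : ℝ} (hX : 0 < X) {n : ℕ} (hn : n ≠ 0) (σ : ℝ) :
    Real.exp (Real.log (X / n) * σ) = X ^ σ / (n : ℝ) ^ σ := by
  have hn' : (0 : ℝ) < n := by positivity
  rw [← Real.rpow_def_of_pos (by positivity), Real.div_rpow hX.le hn'.le]

/-- By symmetry take `y ≤ x`; then this is `log u ≥ 1 - 1/u` at `u = x/y`. -/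
lemma abs_sub_div_max_le_abs_log {x y : ℝ} (hx : 0 < x) (hy : 0 < y) :
    |x - y| / max x y ≤ |Real.log (x / y)| := by
  wlog h : y ≤ x generalizing x y
  · have := this hy hx (by linarith)
    rw [abs_sub_comm, max_comm] at this
    rwa [← inv_div y x, Real.log_inv, abs_neg]
  have h1 : 0 ≤ Real.log (x / y) := Real.log_nonneg (by rwa [one_le_div hy])
  rw [abs_of_nonneg h1, max_eq_left h, abs_of_nonneg (by linarith), sub_div, div_self hx.ne']
  have := Real.one_sub_inv_le_log_of_pos (div_pos hx hy)
  rwa [inv_div] at this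

lemma norm_perronError_le {X σ T : ℝ} (hσ : 0 < σ) (hT : 0 < T) (hX : 0 < X)
    {n : ℕ} (hn : n ≠ 0) (hXn : X ≠ n) :
    ‖perronError X σ T n‖ ≤ 4 * (X ^ σ / (n : ℝ) ^ σ) / (T * |Real.log (X / n)|) := by
  have hn' : (0 : ℝ) < n := by positivity
  rw [perronError, ← exp_log_div_mul hX hn]
  split_ifs with h
  · exact norm_verticalIntegral_kernel_of_pos (Real.log_pos ((one_lt_div hn').mpr h)) hσ hT
  · rw [sub_zero]
    have hlt : X / n < 1 := (div_lt_one hn').mpr (lt_of_le_of_ne (not_lt.mp h) hXn)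
    refine (norm_verticalIntegral_kernel_of_neg (Real.log_neg (by positivity) hlt) hσ hT).trans ?_
    gcongr
    norm_num

lemma norm_perronError_le_log {X σ T : ℝ} (hσ : 1 / 2 ≤ σ) (hT : 0 < T) (hX : 0 < X)
    {n : ℕ} (hn : n ≠ 0) :
    ‖perronError X σ T n‖ ≤ 4 * (X ^ σ / (n : ℝ) ^ σ) * Real.log (1 + 2 * T) + 2 * Real.pi := by
  rw [perronError, ← exp_log_div_mul hX hn]
  refine (norm_sub_le _ _).trans (add_le_add (norm_verticalIntegral_kernel_le_log _ hσ hT.le) ?_)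
  split_ifs
  · simp [abs_of_pos Real.pi_pos]
  · simp [Real.pi_pos.le]

/-- The part of the bound for `perronError` coming from the `n` close to `X`. -/
def nearError (X T : ℝ) (n : ℕ) : ℝ :=
  32 * X / T * (((⌊X⌋₊ - n : ℕ) : ℝ)⁻¹ + ((n - ⌊X⌋₊ - 1 : ℕ) : ℝ)⁻¹) +
    if n = ⌊X⌋₊ ∨ n = ⌊X⌋₊ + 1 then 16 * Real.log (1 + 2 * T) + 2 * Real.pi else 0

lemma nearError_nonneg {X T : ℝ} (hX : 0 ≤ X) (hT : 0 < T) (n : ℕ) : 0 ≤ nearError X T n := by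
  have h1 : 0 ≤ Real.log (1 + 2 * T) := Real.log_nonneg (by linarith)
  rw [nearError]
  split_ifs <;> positivity

/-- The split is at `|log(X/n)| = log 2`. For closer `n` the logarithm is at least `|X - n|/(2X)`,
and `|X - n|` is at least the distance from `n` to `⌊X⌋` or to `⌊X⌋ + 1`, according to the side.
Truncated subtraction and `0⁻¹ = 0` make the reciprocal for the wrong side vanish in `nearError`. At
the two integers next to `X` this bound is useless and the logarithmic one takes over. -/
lemma norm_perronError_le_far_add_near {X σ T : ℝ} (hσ : 1 / 2 ≤ σ) (hσ2 : σ ≤ 2) (hT : 2 < T)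
    (hTX : T < X) (hXZ : ∀ n : ℤ, X ≠ n) {n : ℕ} (hn : n ≠ 0) :
    ‖perronError X σ T n‖ ≤ 8 * X ^ σ / T * (1 / (n : ℝ) ^ σ) +
      if n < 2 * ⌊X⌋₊ + 3 then nearError X T n else 0 := by
  have hX : 0 < X := by linarith
  have hT0 : 0 < T := by linarith
  have hn' : (0 : ℝ) < n := by positivity
  have hXn : X ≠ n := by exact_mod_cast hXZ n
  have hfl : (⌊X⌋₊ : ℝ) ≤ X := Nat.floor_le hX.le
  have hfl' : X < ⌊X⌋₊ + 1 := Nat.lt_floor_add_one X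
  have hN2 : (2 : ℝ) ≤ ⌊X⌋₊ := by
    have : 2 ≤ ⌊X⌋₊ := Nat.le_floor (by norm_num; linarith)
    exact_mod_cast this
  have hnear := nearError_nonneg hX.le hT0 n
  have hfar : 0 ≤ 8 * X ^ σ / T * (1 / (n : ℝ) ^ σ) := by positivity
  by_cases hlog : Real.log 2 ≤ |Real.log (X / n)|
  · refine (norm_perronError_le (by linarith) hT0 hX hn hXn).trans ?_
    have h2 : 1 / 2 ≤ Real.log 2 := by linarith [Real.log_two_gt_d9]
    calc _ ≤ 4 * (X ^ σ / (n : ℝ) ^ σ) / (T * (1 / 2)) := by gcongr; linarith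
      _ = 8 * X ^ σ / T * (1 / (n : ℝ) ^ σ) := by field_simp; ring
      _ ≤ _ := le_add_of_nonneg_right (by split_ifs <;> simp [hnear])
  · rw [not_le, abs_lt] at hlog
    have hr1 : X / n < 2 := (Real.log_lt_log_iff (by positivity) (by norm_num)).mp hlog.2
    have hr2 : 1 / 2 < X / n := by
      have h := hlog.1
      rw [← Real.log_inv] at h
      have := (Real.log_lt_log_iff (by norm_num) (by positivity)).mp h
      linarith
    rw [div_lt_iff₀ hn'] at hr1
    rw [lt_div_iff₀ hn'] at hr2
    have hpow : X ^ σ / (n : ℝ) ^ σ ≤ 4 := by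
      rw [← Real.div_rpow hX.le hn'.le]
      calc (X / n) ^ σ ≤ 2 ^ σ := by
            refine Real.rpow_le_rpow (by positivity) ?_ (by linarith)
            rw [div_le_iff₀ hn']; linarith
        _ ≤ 2 ^ (2 : ℝ) := Real.rpow_le_rpow_of_exponent_le (by norm_num) hσ2
        _ = 4 := by norm_num
    have hlt : n < 2 * ⌊X⌋₊ + 3 := by
      have : (n : ℝ) < 2 * ⌊X⌋₊ + 3 := by linarith
      exact_mod_cast this
    rw [if_pos hlt]
    refine le_trans ?_ (le_add_of_nonneg_left hfar)
    by_cases hcl : n = ⌊X⌋₊ ∨ n = ⌊X⌋₊ + 1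
    · rw [nearError, if_pos hcl]
      refine (norm_perronError_le_log hσ hT0 hX hn).trans ?_
      have hlg : 0 ≤ Real.log (1 + 2 * T) := Real.log_nonneg (by linarith)
      have : 0 ≤ 32 * X / T * (((⌊X⌋₊ - n : ℕ) : ℝ)⁻¹ + ((n - ⌊X⌋₊ - 1 : ℕ) : ℝ)⁻¹) := by
        positivity
      nlinarith
    · rw [nearError, if_neg hcl, add_zero]
      rw [not_or] at hcl
      refine (norm_perronError_le (by linarith) hT0 hX hn hXn).trans ?_
      have habs : 0 < |X - n| := abs_pos.mpr (sub_ne_zero.mpr hXn)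
      have h1 : |X - n| / (2 * X) ≤ |Real.log (X / n)| := by
        refine le_trans ?_ (abs_sub_div_max_le_abs_log hX hn')
        gcongr
        exact max_le (by linarith) (by linarith)
      have h2 : |X - n|⁻¹ ≤ ((⌊X⌋₊ - n : ℕ) : ℝ)⁻¹ + ((n - ⌊X⌋₊ - 1 : ℕ) : ℝ)⁻¹ := by
        rcases lt_or_gt_of_ne hcl.1 with h | h
        · have h3 : ((⌊X⌋₊ - n : ℕ) : ℝ) = ⌊X⌋₊ - n := Nat.cast_sub h.le
          have h4 : (n : ℝ) + 1 ≤ ⌊X⌋₊ := by exact_mod_cast h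
          refine le_trans ?_ (le_add_of_nonneg_right (by positivity))
          rw [h3]
          gcongr
          · linarith
          · rw [abs_of_nonneg] <;> linarith
        · have h' : ⌊X⌋₊ + 2 ≤ n := by omega
          have h3 : ((n - ⌊X⌋₊ - 1 : ℕ) : ℝ) = n - ⌊X⌋₊ - 1 := by
            rw [Nat.cast_sub (by omega), Nat.cast_sub (by omega)]; simp
          have h4 : (⌊X⌋₊ : ℝ) + 2 ≤ n := by exact_mod_cast h'
          refine le_trans ?_ (le_add_of_nonneg_left (by positivity))
          rw [h3]
          gcongr
          · linarith
          · rw [abs_of_nonpos] <;> linarith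
      calc _ ≤ 4 * 4 / (T * (|X - n| / (2 * X))) := by gcongr
        _ = 32 * X / T * |X - n|⁻¹ := by field_simp; ring
        _ ≤ _ := by gcongr

/-- Both families of reciprocals are harmonic sums, of size `O(log X)`. The two exceptional integers
contribute `O(log X)`, absorbed through `1 ≤ X/T`. -/
lemma sum_nearError_le {X T : ℝ} (hT : 2 < T) (hTX : T < X) :
    ∑ n ∈ Finset.range (2 * ⌊X⌋₊ + 3), nearError X T n ≤ 340 * Real.log X * (X / T) := by
  have hX : 0 < X := by linarith
  have hT0 : 0 < T := by linarith
  have hfl : (⌊X⌋₊ : ℝ) ≤ X := Nat.floor_le hX.le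
  have hl2 := Real.log_two_gt_d9
  have hlX : Real.log 2 ≤ Real.log X := Real.log_le_log (by norm_num) (by linarith)
  set N := ⌊X⌋₊ with hN
  have hharm : ∀ k : ℕ, ∑ j ∈ Finset.range (k + 1), ((j : ℕ) : ℝ)⁻¹ ≤ 1 + Real.log k := by
    intro k
    rw [Finset.sum_range_succ']
    have := harmonic_le_one_add_log k
    simp only [harmonic, Rat.cast_sum, Rat.cast_inv, Rat.cast_natCast] at this
    simpa using this
  have hN0 : 0 < N := Nat.floor_pos.mpr (by linarith)
  have hNr : (0 : ℝ) < N := by exact_mod_cast hN0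
  have h1 : ∑ n ∈ Finset.range (2 * N + 3), ((N - n : ℕ) : ℝ)⁻¹ ≤ 1 + Real.log N := by
    rw [show 2 * N + 3 = (N + 1) + (N + 2) by ring, Finset.sum_range_add]
    have e1 : ∑ n ∈ Finset.range (N + 1), ((N - n : ℕ) : ℝ)⁻¹ =
        ∑ j ∈ Finset.range (N + 1), ((j : ℕ) : ℝ)⁻¹ := by
      rw [← Finset.sum_range_reflect]
      refine Finset.sum_congr rfl fun j hj => ?_
      rw [Finset.mem_range] at hj
      congr 2
      omega
    have e2 : ∑ n ∈ Finset.range (N + 2), ((N - (N + 1 + n) : ℕ) : ℝ)⁻¹ = 0 := by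
      refine Finset.sum_eq_zero fun j _ => ?_
      rw [show N - (N + 1 + j) = 0 by omega]; simp
    rw [e1, e2, add_zero]
    exact hharm N
  have h2 : ∑ n ∈ Finset.range (2 * N + 3), ((n - N - 1 : ℕ) : ℝ)⁻¹ ≤ 1 + Real.log (N + 1 : ℕ) := by
    rw [show 2 * N + 3 = (N + 1) + (N + 2) by ring, Finset.sum_range_add]
    have e1 : ∑ n ∈ Finset.range (N + 1), ((n - N - 1 : ℕ) : ℝ)⁻¹ = 0 := by
      refine Finset.sum_eq_zero fun j hj => ?_
      rw [Finset.mem_range] at hj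
      rw [show j - N - 1 = 0 by omega]; simp
    have e2 : ∑ n ∈ Finset.range (N + 2), ((N + 1 + n - N - 1 : ℕ) : ℝ)⁻¹ =
        ∑ j ∈ Finset.range (N + 1 + 1), ((j : ℕ) : ℝ)⁻¹ := by
      refine Finset.sum_congr rfl fun j _ => ?_
      rw [show N + 1 + j - N - 1 = j by omega]
    rw [e1, e2, zero_add]
    exact hharm (N + 1)
  have h3 : ∑ n ∈ Finset.range (2 * N + 3),
      (if n = N ∨ n = N + 1 then 16 * Real.log (1 + 2 * T) + 2 * Real.pi else 0) =
      2 * (16 * Real.log (1 + 2 * T) + 2 * Real.pi) := by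
    rw [← Finset.sum_filter]
    have : (Finset.range (2 * N + 3)).filter (fun n => n = N ∨ n = N + 1) = {N, N + 1} := by
      ext n
      simp only [Finset.mem_filter, Finset.mem_range, Finset.mem_insert, Finset.mem_singleton]
      omega
    rw [this, Finset.sum_pair (by omega)]
    ring
  have hlogN : Real.log N ≤ Real.log X := Real.log_le_log hNr hfl
  have hlogN1 : Real.log (N + 1 : ℕ) ≤ Real.log 2 + Real.log X := by
    rw [← Real.log_mul (by norm_num) hX.ne']
    refine Real.log_le_log (by positivity) ?_
    push_cast
    linarith
  have hlogT : Real.log (1 + 2 * T) ≤ Real.log (4 : ℝ) + Real.log X := by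
    rw [← Real.log_mul (by norm_num) hX.ne']
    exact Real.log_le_log (by linarith) (by linarith)
  have hlog4 : Real.log (4 : ℝ) = 2 * Real.log 2 := by
    rw [show (4 : ℝ) = 2 ^ 2 by norm_num, Real.log_pow]; norm_num
  have hXT : 1 ≤ X / T := (one_le_div hT0).mpr hTX.le
  simp only [nearError, ← hN]
  rw [Finset.sum_add_distrib, ← Finset.mul_sum, Finset.sum_add_distrib, h3]
  have hpi := Real.pi_lt_d2
  have hsum : ∑ n ∈ Finset.range (2 * N + 3), ((N - n : ℕ) : ℝ)⁻¹ +
      ∑ n ∈ Finset.range (2 * N + 3), ((n - N - 1 : ℕ) : ℝ)⁻¹ ≤ 6 * Real.log X := by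
    linarith
  have hnear : 2 * (16 * Real.log (1 + 2 * T) + 2 * Real.pi) ≤ 132 * Real.log X := by
    linarith
  have hA : 32 * X / T * (∑ n ∈ Finset.range (2 * N + 3), ((N - n : ℕ) : ℝ)⁻¹ +
      ∑ n ∈ Finset.range (2 * N + 3), ((n - N - 1 : ℕ) : ℝ)⁻¹) ≤ 32 * X / T * (6 * Real.log X) := by
    gcongr
  have hB : 132 * Real.log X ≤ 132 * Real.log X * (X / T) :=
    le_mul_of_one_le_right (by linarith) hXT
  have hC : 32 * X / T * (6 * Real.log X) = 192 * Real.log X * (X / T) := by ring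
  have hD : 0 ≤ Real.log X * (X / T) := mul_nonneg (by linarith) (by linarith)
  linarith

/-- **Truncated Perron formula** for a Dirichlet series dominated by the von Mangoldt function. -/
theorem norm_perron_le {a : ℕ → ℂ} (ha : ∀ n, ‖a n‖ ≤ Λ n) {σ T X : ℝ} (hσ : 1 / 2 ≤ σ)
    (hσ2 : σ ≤ 2) (hs : LSeriesSummable a σ) (hT : 2 < T) (hTX : T < X) (hXZ : ∀ n : ℤ, X ≠ n) :
    ‖verticalIntegral (fun s => LSeries a s * ((X : ℂ) ^ s / s)) σ T -
        2 * Real.pi * I * ∑ n ∈ Finset.range ⌈X⌉₊, a n‖ ≤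
      8 * X ^ σ / T * ∑' n, ‖LSeries.term a σ n‖ + 1360 * Real.log X ^ 2 * (X / T) := by
  have hX : 0 < X := by linarith
  have hT0 : 0 < T := by linarith
  have ha0 : a 0 = 0 := by simpa using ha 0
  have hl2 := Real.log_two_gt_d9
  have hlX : Real.log 2 ≤ Real.log X := Real.log_le_log (by norm_num) (by linarith)
  have H1 := hasSum_verticalIntegral_LSeries ha0 (T := T) (by linarith : 0 < σ) hs hX
  have H2 : HasSum (fun n : ℕ => a n * if (n : ℝ) < X then 2 * Real.pi * I else 0)
      (2 * Real.pi * I * ∑ n ∈ Finset.range ⌈X⌉₊, a n) := by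
    have : 2 * Real.pi * I * ∑ n ∈ Finset.range ⌈X⌉₊, a n =
        ∑ n ∈ Finset.range ⌈X⌉₊, a n * (if (n : ℝ) < X then 2 * Real.pi * I else 0) := by
      rw [Finset.mul_sum]
      refine Finset.sum_congr rfl fun n hn => ?_
      rw [if_pos (Nat.lt_ceil.mp (Finset.mem_range.mp hn))]
      ring
    rw [this]
    refine hasSum_sum_of_ne_finset_zero fun n hn => ?_
    rw [if_neg, mul_zero]
    exact fun h => hn (Finset.mem_range.mpr (Nat.lt_ceil.mpr h))
  have H := H1.sub H2
  set M := 2 * ⌊X⌋₊ + 3 with hM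
  have hbound : ∀ n : ℕ, ‖a n * verticalIntegral
      (fun s => exp ((Real.log (X / n) : ℝ) * s) / s) σ T -
      a n * (if (n : ℝ) < X then 2 * Real.pi * I else 0)‖ ≤
      8 * X ^ σ / T * ‖LSeries.term a σ n‖ +
        if n ∈ Finset.range M then Λ n * nearError X T n else 0 := by
    intro n
    rcases eq_or_ne n 0 with rfl | hn
    · simp [ha0]
    rw [← mul_sub, ← perronError, norm_mul, LSeries.norm_term_eq, if_neg hn, ofReal_re]
    simp only [Finset.mem_range]
    have h := norm_perronError_le_far_add_near hσ hσ2 hT hTX hXZ hn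
    rw [← hM] at h
    have hnr := nearError_nonneg hX.le hT0 n
    calc _ ≤ ‖a n‖ * (8 * X ^ σ / T * (1 / (n : ℝ) ^ σ) + if n < M then nearError X T n else 0) := by
          gcongr
      _ = 8 * X ^ σ / T * (‖a n‖ / (n : ℝ) ^ σ) + ‖a n‖ * (if n < M then nearError X T n else 0) := by
          ring
      _ ≤ _ := by
          gcongr
          split_ifs
          · gcongr
            exact ha n
          · simp
  have hs1 : Summable fun n => 8 * X ^ σ / T * ‖LSeries.term a σ n‖ := hs.norm.mul_left _
  have hs2 : HasSum (fun n => if n ∈ Finset.range M then Λ n * nearError X T n else 0)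
      (∑ n ∈ Finset.range M, Λ n * nearError X T n) := by
    have : ∑ n ∈ Finset.range M, Λ n * nearError X T n =
        ∑ n ∈ Finset.range M, if n ∈ Finset.range M then Λ n * nearError X T n else 0 :=
      Finset.sum_congr rfl fun n hn => (if_pos hn).symm
    rw [this]
    exact hasSum_sum_of_ne_finset_zero fun n hn => if_neg hn
  rw [← H.tsum_eq]
  refine (tsum_of_norm_bounded (hs1.hasSum.add hs2) hbound).trans ?_
  rw [tsum_mul_left]
  gcongr
  -- Near terms have `n ≤ 4X`, and `log 4X = 2 log 2 + log X` is at most `3 log X`.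
  have hL : ∀ n ∈ Finset.range M, Λ n * nearError X T n ≤ 4 * Real.log X * nearError X T n := by
    intro n hn
    have hnr := nearError_nonneg hX.le hT0 n
    gcongr
    refine ArithmeticFunction.vonMangoldt_le_log.trans ?_
    rcases eq_or_ne n 0 with rfl | hn0
    · simp; linarith
    have hfl : (⌊X⌋₊ : ℝ) ≤ X := Nat.floor_le hX.le
    have hn1 : (n : ℝ) ≤ 4 * X := by
      have : n + 1 ≤ M := Finset.mem_range.mp hn
      have : (n : ℝ) + 1 ≤ 2 * ⌊X⌋₊ + 3 := by exact_mod_cast this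
      linarith
    have hlog4 : Real.log (4 : ℝ) = 2 * Real.log 2 := by
      rw [show (4 : ℝ) = 2 ^ 2 by norm_num, Real.log_pow]; norm_num
    have := Real.log_le_log (by positivity) hn1
    rw [Real.log_mul (by norm_num) hX.ne'] at this
    linarith
  refine (Finset.sum_le_sum hL).trans ?_
  rw [← Finset.mul_sum]
  have := sum_nearError_le hT hTX
  rw [← hM] at this
  calc _ ≤ 4 * Real.log X * (340 * Real.log X * (X / T)) := by
        gcongr
        linarith
    _ = _ := by ring

end Murmuration
end

noncomputable section
namespace Murmuration
open Complex MeasureTheory Filter Topology Asymptotics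

/-! ### Bounds for Dirichlet `L`-functions and their logarithmic derivatives -/

lemma sum_range_dirichletCharacter_eq_zero {d : ℕ} [NeZero d] {χ : DirichletCharacter ℂ d}
    (hχ : χ ≠ 1) : ∑ k ∈ Finset.range d, χ (k : ZMod d) = 0 := by
  rw [← MulChar.sum_eq_zero_of_ne_one hχ]
  refine Finset.sum_nbij' (fun k => (k : ZMod d)) (fun a => a.val) (by simp) ?_ ?_ (by simp) (by simp)
  · intro a _
    exact Finset.mem_range.mpr (ZMod.val_lt a)
  · intro k hk
    exact ZMod.val_cast_of_lt (Finset.mem_range.mp hk)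

/-- Complete periods sum to zero, so strong induction strips them and leaves fewer than `d` terms of
modulus at most one. -/
lemma norm_sum_range_dirichletCharacter_le {d : ℕ} [NeZero d] {χ : DirichletCharacter ℂ d}
    (hχ : χ ≠ 1) (n : ℕ) : ‖∑ k ∈ Finset.range n, χ (k : ZMod d)‖ ≤ d := by
  induction n using Nat.strong_induction_on with
  | _ n ih =>
    rcases lt_or_ge n d with h | h
    · calc _ ≤ ∑ k ∈ Finset.range n, ‖χ (k : ZMod d)‖ := norm_sum_le _ _
        _ ≤ ∑ k ∈ Finset.range n, 1 := Finset.sum_le_sum fun k _ => χ.norm_le_one _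
        _ ≤ d := by simpa using h.le
    · obtain ⟨m, rfl⟩ := Nat.exists_eq_add_of_le h
      rw [Finset.sum_range_add, sum_range_dirichletCharacter_eq_zero hχ, zero_add]
      simpa using ih m (Nat.lt_add_of_pos_left (NeZero.pos d))

lemma norm_sum_Icc_dirichletCharacter_le {d : ℕ} [NeZero d] {χ : DirichletCharacter ℂ d}
    (hχ : χ ≠ 1) (n : ℕ) : ‖∑ k ∈ Finset.Icc 1 n, χ (k : ZMod d)‖ ≤ 2 * d := by
  have h : ∑ k ∈ Finset.range (n + 1), χ (k : ZMod d) =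
      ∑ k ∈ Finset.Icc 1 n, χ (k : ZMod d) + χ 0 := by
    rw [Finset.range_eq_Ico, Finset.sum_eq_sum_Ico_succ_bot (by omega), add_comm]
    simp only [Nat.cast_zero, add_left_inj]
    rfl
  have h1 : ∑ k ∈ Finset.Icc 1 n, χ (k : ZMod d) =
      ∑ k ∈ Finset.range (n + 1), χ (k : ZMod d) - χ 0 := by rw [h]; ring
  rw [h1]
  refine (norm_sub_le _ _).trans ?_
  have hd : (1 : ℝ) ≤ d := by exact_mod_cast NeZero.pos d
  linarith [norm_sum_range_dirichletCharacter_le hχ (n + 1), χ.norm_le_one 0]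

/-- The integral `∫_1^∞ (∑_{k ≤ t} χ(k)) t^{-s-1} dt`. -/
def charSumIntegral {d : ℕ} (χ : DirichletCharacter ℂ d) (s : ℂ) : ℂ :=
  ∫ t in Set.Ioi (1 : ℝ), (∑ k ∈ Finset.Icc 1 ⌊t⌋₊, χ (k : ZMod d)) * (t : ℂ) ^ (-(s + 1))

lemma LFunction_eq_mul_charSumIntegral_of_one_lt_re {d : ℕ} [NeZero d] {χ : DirichletCharacter ℂ d}
    (hχ : χ ≠ 1) {s : ℂ} (hs : 1 < s.re) :
    DirichletCharacter.LFunction χ s = s * charSumIntegral χ s := by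
  rw [DirichletCharacter.LFunction_eq_LSeries χ hs, charSumIntegral]
  refine LSeries_eq_mul_integral (fun n => χ (n : ZMod d)) le_rfl (by linarith)
    (DirichletCharacter.LSeriesSummable_of_one_lt_re χ hs) ?_
  refine IsBigO.of_bound (2 * d) (Eventually.of_forall fun n => ?_)
  simpa using norm_sum_Icc_dirichletCharacter_le hχ n

/-- The integral is a Mellin transform, at `-s`, of a bounded function supported on `(1, ∞)`.
Boundedness at infinity requires `Re s > 0`. -/
lemma differentiableAt_charSumIntegral {d : ℕ} [NeZero d] {χ : DirichletCharacter ℂ d}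
    (hχ : χ ≠ 1) {s : ℂ} (hs : 0 < s.re) : DifferentiableAt ℂ (charSumIntegral χ) s := by
  set S : ℝ → ℂ := fun t => ∑ k ∈ Finset.Icc 1 ⌊t⌋₊, χ (k : ZMod d) with hS
  set F : ℝ → ℂ := Set.indicator (Set.Ioi 1) S with hF
  have hmeasS : Measurable S :=
    (measurable_from_nat (f := fun n => ∑ k ∈ Finset.Icc 1 n, χ (k : ZMod d))).comp Nat.measurable_floor
  have hmeas : Measurable F := hmeasS.indicator measurableSet_Ioi
  have hbound : ∀ t, ‖F t‖ ≤ 2 * d := by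
    intro t
    refine (norm_indicator_le_norm_self _ _).trans ?_
    exact norm_sum_Icc_dirichletCharacter_le hχ _
  have heq : charSumIntegral χ = fun s => mellin F (-s) := by
    ext s
    rw [charSumIntegral, mellin]
    have h1 : ∀ t : ℝ, (t : ℂ) ^ (-s - 1) • F t =
        Set.indicator (Set.Ioi 1) (fun t : ℝ => S t * (t : ℂ) ^ (-(s + 1))) t := by
      intro t
      by_cases ht : t ∈ Set.Ioi (1 : ℝ)
      · rw [hF, Set.indicator_of_mem ht, Set.indicator_of_mem ht, smul_eq_mul, mul_comm]
        congr 2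
        ring
      · rw [hF, Set.indicator_of_notMem ht, Set.indicator_of_notMem ht, smul_zero]
    simp_rw [h1]
    rw [setIntegral_indicator measurableSet_Ioi]
    congr 2
    ext t
    simp only [Set.mem_inter_iff, Set.mem_Ioi]
    exact ⟨fun h => ⟨by linarith, h⟩, fun h => h.2⟩
  have hdiff : DifferentiableAt ℂ (mellin F) (-s) := by
    -- Any exponent `b < Re(-s)` would do, since the function vanishes near `0`.
    refine mellin_differentiableAt_of_isBigO_rpow (a := 0) (b := (-s).re - 1) ?_ ?_ (by simpa using hs)
      ?_ (by linarith)
    · refine LocallyIntegrable.locallyIntegrableOn ?_ _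
      refine (locallyIntegrable_const (2 * (d : ℝ))).mono hmeas.aestronglyMeasurable
        (ae_of_all _ fun t => ?_)
      simpa using (hbound t)
    · refine IsBigO.of_bound (2 * d) (Eventually.of_forall fun t => ?_)
      simpa using hbound t
    · refine IsBigO.of_bound 0 ?_
      have : Set.Ioo (0 : ℝ) 1 ∈ 𝓝[>] (0 : ℝ) := Ioo_mem_nhdsGT one_pos
      filter_upwards [this] with t ht
      have : t ∉ Set.Ioi (1 : ℝ) := by simpa using ht.2.le
      simp [hF, Set.indicator_of_notMem this]
  rw [heq]
  exact hdiff.comp s differentiableAt_id.neg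

lemma LFunction_eq_mul_charSumIntegral {d : ℕ} [NeZero d] {χ : DirichletCharacter ℂ d}
    (hχ : χ ≠ 1) {s : ℂ} (hs : 0 < s.re) :
    DirichletCharacter.LFunction χ s = s * charSumIntegral χ s := by
  have hopen : IsOpen {z : ℂ | 0 < z.re} := isOpen_lt continuous_const continuous_re
  have h1 : AnalyticOnNhd ℂ (DirichletCharacter.LFunction χ) {z : ℂ | 0 < z.re} :=
    (DirichletCharacter.differentiable_LFunction hχ).differentiableOn.analyticOnNhd hopen
  have h2 : AnalyticOnNhd ℂ (fun s => s * charSumIntegral χ s) {z : ℂ | 0 < z.re} := by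
    refine DifferentiableOn.analyticOnNhd (fun z hz => ?_) hopen
    exact (differentiableAt_id.mul
      (differentiableAt_charSumIntegral hχ hz)).differentiableWithinAt
  have hconn : IsPreconnected {z : ℂ | 0 < z.re} := (convex_halfSpace_re_gt 0).isPreconnected
  refine h1.eqOn_of_preconnected_of_eventuallyEq h2 hconn (z₀ := 2) (by simp) ?_ hs
  have : {z : ℂ | 1 < z.re} ∈ 𝓝 (2 : ℂ) :=
    (isOpen_lt continuous_const continuous_re).mem_nhds (by simp)
  filter_upwards [this] with z hz
  exact LFunction_eq_mul_charSumIntegral_of_one_lt_re hχ hz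

/-- Partial summation against the bounded character sums. Crude polynomial growth in `d` and `|s|`
suffices, because only its logarithm enters the estimate for `L'/L`. -/
lemma norm_LFunction_le {d : ℕ} [NeZero d] {χ : DirichletCharacter ℂ d}
    (hχ : χ ≠ 1) {s : ℂ} (hs : 0 < s.re) :
    ‖DirichletCharacter.LFunction χ s‖ ≤ ‖s‖ * (2 * d / s.re) := by
  rw [LFunction_eq_mul_charSumIntegral hχ hs, norm_mul]
  gcongr
  have hintegrable : IntegrableOn (fun t : ℝ => 2 * (d : ℝ) * t ^ (-(s.re + 1))) (Set.Ioi 1) :=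
    (integrableOn_Ioi_rpow_of_lt (by linarith) zero_lt_one).const_mul _
  calc _ ≤ ∫ t in Set.Ioi (1 : ℝ), 2 * (d : ℝ) * t ^ (-(s.re + 1)) := by
        refine norm_integral_le_of_norm_le hintegrable ?_
        refine (ae_restrict_iff' measurableSet_Ioi).mpr (ae_of_all _ fun t ht => ?_)
        rw [norm_mul, norm_cpow_eq_rpow_re_of_pos (zero_lt_one.trans ht)]
        have : (-(s + 1)).re = -(s.re + 1) := by simp
        rw [this]
        have h0 : (0 : ℝ) < t := zero_lt_one.trans ht
        gcongr
        exact norm_sum_Icc_dirichletCharacter_le hχ _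
    _ = 2 * d / s.re := by
        rw [integral_const_mul, integral_Ioi_rpow_of_lt (by linarith) zero_lt_one, Real.one_rpow]
        have : -(s.re + 1) + 1 = -s.re := by ring
        rw [this, neg_div_neg_eq]
        ring

/-- Comparison with `ζ(2)` gives `|L - 1| ≤ π²/6 - 1 ≤ 3/4`. This is the lower bound at the centre
of the Borel–Carathéodory disc. -/
lemma one_div_four_le_norm_LFunction {d : ℕ} [NeZero d] (χ : DirichletCharacter ℂ d) {s : ℂ}
    (hs : s.re = 2) : 1 / 4 ≤ ‖DirichletCharacter.LFunction χ s‖ := by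
  have hs1 : 1 < s.re := by linarith
  rw [DirichletCharacter.LFunction_eq_LSeries χ hs1]
  set f : ℕ → ℂ := fun n => χ (n : ZMod d)
  have hsum : HasSum (LSeries.term f s) (LSeries f s) :=
    (DirichletCharacter.LSeriesSummable_of_one_lt_re χ hs1).hasSum
  have h1 : HasSum (fun n : ℕ => if n = 1 then (1 : ℂ) else 0) 1 := hasSum_ite_eq 1 1
  have h2 : HasSum (fun n : ℕ => if n = 1 then (1 : ℝ) else 0) 1 := hasSum_ite_eq 1 1
  have hle : ‖LSeries f s - 1‖ ≤ Real.pi ^ 2 / 6 - 1 := by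
    rw [← (hsum.sub h1).tsum_eq]
    refine tsum_of_norm_bounded (hasSum_zeta_two.sub h2) fun n => ?_
    rcases eq_or_ne n 0 with rfl | hn0
    · simp
    rcases eq_or_ne n 1 with rfl | hn1
    · simp [LSeries.term, f]
    · rw [if_neg hn1, if_neg hn1, sub_zero, sub_zero, LSeries.norm_term_eq, if_neg hn0, hs]
      have : ((n : ℝ)) ^ (2 : ℝ) = (n : ℝ) ^ 2 := by norm_cast
      rw [this]
      gcongr
      exact χ.norm_le_one _
  have hpi := Real.pi_lt_d2
  have hpi0 := Real.pi_pos
  have : Real.pi ^ 2 / 6 - 1 ≤ 3 / 4 := by nlinarith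
  have h3 : ‖(1 : ℂ)‖ - ‖LSeries f s‖ ≤ ‖LSeries f s - 1‖ := by
    rw [norm_sub_rev]; exact norm_sub_norm_le _ _
  rw [norm_one] at h3
  linarith

/-- A Borel–Carathéodory bound for the logarithmic derivative of a zero-free function. -/
theorem norm_logDeriv_le_of_ball {f : ℂ → ℂ} {c : ℂ} {R r M : ℝ} (hr : 0 ≤ r) (hrR : r < R)
    (hM : 0 < M) (hf : DifferentiableOn ℂ f (Metric.ball c R)) (h0 : ∀ z ∈ Metric.ball c R, f z ≠ 0)
    (hb : ∀ z ∈ Metric.ball c R, ‖f z‖ ≤ Real.exp M * ‖f c‖) {z : ℂ} (hz : ‖z - c‖ ≤ r) :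
    ‖deriv f z / f z‖ ≤ 8 * R * M / (R - r) ^ 2 := by
  have hR : 0 < R := by linarith
  have hcmem : c ∈ Metric.ball c R := Metric.mem_ball_self hR
  have hfderiv : DifferentiableOn ℂ (fun z => deriv f z / f z) (Metric.ball c R) :=
    (hf.deriv Metric.isOpen_ball).div hf h0
  -- A primitive of `f'/f` on the disc, normalised to vanish at `c`, is a holomorphic logarithm of
  -- `f/f(c)`.
  obtain ⟨g₀, hg₀⟩ := hfderiv.isExactOn_ball
  set g : ℂ → ℂ := fun z => g₀ z - g₀ c with hg
  have hgd : ∀ w ∈ Metric.ball c R, HasDerivAt g (deriv f w / f w) w :=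
    fun w hw => (hg₀ w hw).sub_const _
  have hfd : ∀ w ∈ Metric.ball c R, HasDerivAt f (deriv f w) w := fun w hw =>
    (hf.differentiableAt (Metric.isOpen_ball.mem_nhds hw)).hasDerivAt
  have hprod : ∀ w ∈ Metric.ball c R, HasDerivAt (fun w => f w * exp (-g w)) 0 w := by
    intro w hw
    refine ((hfd w hw).mul (hgd w hw).neg.cexp).congr_deriv ?_
    have := h0 w hw
    simp only [Pi.neg_apply]
    field_simp
    ring
  have hconst : ∀ w ∈ Metric.ball c R, f w = f c * exp (g w) := by
    intro w hw
    have := Metric.isOpen_ball.is_const_of_deriv_eq_zero (convex_ball c R).isPreconnected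
      (fun w hw => (hprod w hw).differentiableAt.differentiableWithinAt)
      (fun w hw => (hprod w hw).deriv) hw hcmem
    simp only [hg, sub_self, neg_zero, exp_zero, mul_one] at this
    rw [← this, hg, mul_assoc, ← exp_add]
    simp
  have hre : ∀ w ∈ Metric.ball c R, (g w).re ≤ M := by
    intro w hw
    have h1 := hb w hw
    rw [hconst w hw, norm_mul, norm_exp, mul_comm] at h1
    exact Real.exp_le_exp.mp (le_of_mul_le_mul_right h1 (norm_pos_iff.mpr (h0 c hcmem)))
  have hshift : ∀ w ∈ Metric.ball (0 : ℂ) R, w + c ∈ Metric.ball c R := by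
    intro w hw
    simpa [dist_eq_norm] using hw
  -- The gap between `r` and `R` is halved: Borel–Carathéodory holds up to the middle radius, and
  -- Cauchy's estimate for `g'` uses circles of radius `(R - r)/2`.
  have hgbound : ∀ w, ‖w - c‖ ≤ (R + r) / 2 → ‖g w‖ ≤ 4 * M * R / (R - r) := by
    intro w hw
    have hwR : ‖w - c‖ < R := by linarith
    have := borelCaratheodory_zero (f := fun u => g (u + c)) (z := w - c) (R := R) hM ?_ ?_ hR ?_ ?_
    · simp only [sub_add_cancel] at this
      refine this.trans ?_
      calc 2 * M * ‖w - c‖ / (R - ‖w - c‖) ≤ 2 * M * R / ((R - r) / 2) := by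
            gcongr
            linarith
        _ = _ := by field_simp; norm_num
    · intro u hu
      exact ((hgd (u + c) (hshift u hu)).comp_add_const u c).differentiableAt.differentiableWithinAt
    · intro u hu
      exact hre _ (hshift u hu)
    · simpa using hwR
    · simp [hg]
  have hz' : z ∈ Metric.ball c R := by
    rw [Metric.mem_ball, dist_eq_norm]; linarith
  rw [← (hgd z hz').deriv]
  have hsub : Metric.closedBall z ((R - r) / 2) ⊆ Metric.ball c R := by
    intro w hw
    rw [Metric.mem_closedBall, dist_eq_norm] at hw
    rw [Metric.mem_ball, dist_eq_norm]
    have : ‖w - c‖ ≤ ‖w - z‖ + ‖z - c‖ := by simpa using norm_add_le (w - z) (z - c)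
    linarith
  have hcl : DiffContOnCl ℂ g (Metric.ball z ((R - r) / 2)) := by
    refine DifferentiableOn.diffContOnCl ?_
    rw [closure_ball z (by linarith)]
    exact fun w hw => (hgd w (hsub hw)).differentiableAt.differentiableWithinAt
  have := norm_deriv_le_of_forall_mem_sphere_norm_le (by linarith : 0 < (R - r) / 2) hcl
    (C := 4 * M * R / (R - r)) fun w hw => hgbound w ?_
  · refine this.trans (le_of_eq ?_)
    have : R - r ≠ 0 := by linarith
    field_simp
    ring
  · rw [mem_sphere_iff_norm] at hw
    have : ‖w - c‖ ≤ ‖w - z‖ + ‖z - c‖ := by simpa using norm_add_le (w - z) (z - c)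
    linarith

/-- If `L(s, χ)` has no zeros close to the horizontal line through `s`, then
`L'/L(s, χ) ≪ log (d (|s| + 1))`. -/
theorem norm_logDeriv_LFunction_le {d : ℕ} [NeZero d] {χ : DirichletCharacter ℂ d} (hχ : χ ≠ 1)
    {ε : ℝ} (hε : 0 < ε) (hε' : ε < 1 / 4) {τ : ℝ}
    (hzero : ∀ z : ℂ, 1 / 2 + ε / 2 < z.re → |z.im| ≤ |τ| + 2 → DirichletCharacter.LFunction χ z ≠ 0)
    {σ : ℝ} (hσ : 1 / 2 + ε ≤ σ) (hσ2 : σ ≤ 2) :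
    ‖deriv (DirichletCharacter.LFunction χ) (σ + τ * I) / DirichletCharacter.LFunction χ (σ + τ * I)‖ ≤
      48 / ε ^ 2 * Real.log (16 * d * (|τ| + 6)) := by
  set L := DirichletCharacter.LFunction χ
  have hd : (1 : ℝ) ≤ d := by exact_mod_cast NeZero.pos d
  have hτ := abs_nonneg τ
  have hpos : 1 < 16 * d * (|τ| + 6) := by nlinarith
  have hM : 0 < Real.log (16 * d * (|τ| + 6)) := Real.log_pos hpos
  set c : ℂ := 2 + τ * I with hc
  have hball : ∀ z ∈ Metric.ball c (3 / 2 - ε / 2), 1 / 2 + ε / 2 < z.re ∧ |z.im| ≤ |τ| + 2 ∧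
      ‖z‖ ≤ |τ| + 6 := by
    intro z hz
    rw [Metric.mem_ball, dist_eq_norm] at hz
    have h1 := abs_re_le_norm (z - c)
    have h2 := abs_im_le_norm (z - c)
    have hcre : (z - c).re = z.re - 2 := by simp [hc]
    have hcim : (z - c).im = z.im - τ := by simp [hc]
    rw [hcre] at h1
    rw [hcim] at h2
    have h3 := (abs_le.mp (h1.trans hz.le)).1
    have h3' : |z.re - 2| < 3 / 2 - ε / 2 := h1.trans_lt hz
    have h4 : |z.im| ≤ |τ| + 2 := by
      have : |z.im| ≤ |z.im - τ| + |τ| := by simpa using abs_add_le (z.im - τ) τ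
      linarith
    refine ⟨by linarith [(abs_lt.mp h3').1], h4, ?_⟩
    have h5 := norm_le_abs_re_add_abs_im z
    have h6 : |z.re| ≤ 4 := by
      have h := abs_lt.mp h3'
      exact abs_le.mpr ⟨by linarith [h.1], by linarith [h.2]⟩
    linarith
  -- From the centre `2 + iτ` these radii reach exactly the abscissae `1/2 + ε/2`, the edge of the
  -- zero-free region, and `1/2 + ε`, the leftmost point wanted.
  have hbound := norm_logDeriv_le_of_ball (f := L) (c := c) (R := 3 / 2 - ε / 2) (r := 3 / 2 - ε)
    (M := Real.log (16 * d * (|τ| + 6))) (z := σ + τ * I) (by linarith) (by linarith) hM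
    (DirichletCharacter.differentiable_LFunction hχ).differentiableOn
    (fun z hz => hzero z (hball z hz).1 (hball z hz).2.1) ?_ ?_
  · refine hbound.trans ?_
    rw [show 3 / 2 - ε / 2 - (3 / 2 - ε) = ε / 2 by ring]
    calc 8 * (3 / 2 - ε / 2) * Real.log (16 * d * (|τ| + 6)) / (ε / 2) ^ 2
        ≤ 8 * (3 / 2) * Real.log (16 * d * (|τ| + 6)) / (ε / 2) ^ 2 := by
          gcongr; linarith
      _ = _ := by field_simp; ring
  · intro z hz
    rw [Real.exp_log (by linarith)]
    obtain ⟨h1, -, h3⟩ := hball z hz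
    have hlow : 1 / 4 ≤ ‖L c‖ := one_div_four_le_norm_LFunction χ (by simp [hc])
    refine (norm_LFunction_le hχ (by linarith)).trans ?_
    calc ‖z‖ * (2 * d / z.re) ≤ (|τ| + 6) * (2 * d / (1 / 2)) := by
          have : 0 < z.re := by linarith
          gcongr
          linarith
      _ = 16 * d * (|τ| + 6) * (1 / 4) := by ring
      _ ≤ _ := by gcongr
  · have : (σ : ℂ) + τ * I - c = ((σ - 2 : ℝ) : ℂ) := by rw [hc]; push_cast; ring
    rw [this, norm_real, Real.norm_eq_abs, abs_le]
    constructor <;> linarith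

end Murmuration
end

noncomputable section
namespace Murmuration
open Complex Filter Topology

/-! ### The Euler product `A(α; γ)` -/

/-- The local factor of `A(α; γ)` at `p`, minus one. -/
def ratiosLocal (p : ℕ) (α γ : ℂ) : ℂ :=
  (p : ℂ) ^ (-α) * ((p : ℂ) ^ (-γ) - (p : ℂ) ^ (-α)) /
    (p * (p + 1) * (1 - (p : ℂ) ^ (-α) * (p : ℂ) ^ (-γ) / p))

lemma norm_prime_cpow_neg_le {p : ℕ} (hp : p.Prime) {α : ℂ} {x : ℝ} (h : -x ≤ α.re) :
    ‖(p : ℂ) ^ (-α)‖ ≤ (p : ℝ) ^ x := by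
  rw [norm_natCast_cpow_of_pos hp.pos, neg_re]
  exact Real.rpow_le_rpow_of_exponent_le (by exact_mod_cast hp.one_le) (by linarith)

lemma two_div_five_le_norm_one_sub {p : ℕ} (hp : p.Prime) {α γ : ℂ} (hα : -(1 / 4) ≤ α.re)
    (hγ : 0 ≤ γ.re) : 2 / 5 ≤ ‖1 - (p : ℂ) ^ (-α) * (p : ℂ) ^ (-γ) / p‖ := by
  have hp0 : (0 : ℝ) < p := by exact_mod_cast hp.pos
  have hp2 : (2 : ℝ) ≤ p := by exact_mod_cast hp.two_le
  have hu := norm_prime_cpow_neg_le hp hα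
  have hv := norm_prime_cpow_neg_le (x := 0) hp (by simpa using hγ : -(0 : ℝ) ≤ γ.re)
  rw [Real.rpow_zero] at hv
  have h1 : ‖(p : ℂ) ^ (-α) * (p : ℂ) ^ (-γ) / p‖ ≤ 3 / 5 := by
    rw [norm_div, norm_mul, norm_natCast]
    calc _ ≤ (p : ℝ) ^ (1 / 4 : ℝ) * 1 / p := by gcongr
      _ = (p : ℝ) ^ (-(3 / 4) : ℝ) := by
          rw [mul_one, show (-(3 / 4) : ℝ) = 1 / 4 - 1 by norm_num, Real.rpow_sub hp0, Real.rpow_one]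
      _ ≤ 2 ^ (-(3 / 4) : ℝ) :=
          Real.rpow_le_rpow_of_nonpos (by norm_num) hp2 (by norm_num)
      _ ≤ 3 / 5 := by
          rw [Real.rpow_neg (by norm_num), inv_le_comm₀ (by positivity) (by norm_num)]
          -- The numerical fact is `(5/3)^4 ≤ 2^3`, after which fourth roots are taken.
          have h : ((3 / 5 : ℝ)⁻¹ ^ 4) ^ (1 / 4 : ℝ) ≤ (2 ^ 3) ^ (1 / 4 : ℝ) :=
            Real.rpow_le_rpow (by positivity) (by norm_num) (by norm_num)
          rw [← Real.rpow_natCast, ← Real.rpow_mul (by positivity), ← Real.rpow_natCast 2 3,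
            ← Real.rpow_mul (by norm_num)] at h
          norm_num at h ⊢
          exact h
  have h2 := norm_sub_norm_le (1 : ℂ) ((p : ℂ) ^ (-α) * (p : ℂ) ^ (-γ) / p)
  rw [norm_one] at h2
  linarith

lemma one_sub_ne_zero_of_prime {p : ℕ} (hp : p.Prime) {α γ : ℂ} (hα : -(1 / 4) ≤ α.re)
    (hγ : 0 ≤ γ.re) : 1 - (p : ℂ) ^ (-α) * (p : ℂ) ^ (-γ) / p ≠ 0 := by
  have := two_div_five_le_norm_one_sub hp hα hγ
  exact norm_pos_iff.mp (by linarith)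

/-- With `Re α ≥ -1/4` the numerator is at most `2 p^{1/2}` and the denominator at least `(2/5) p²`.
The resulting majorant is summable and independent of `α` and `γ`. -/
lemma norm_ratiosLocal_le {p : ℕ} (hp : p.Prime) {α γ : ℂ} (hα : -(1 / 4) ≤ α.re)
    (hγ : 0 ≤ γ.re) : ‖ratiosLocal p α γ‖ ≤ 5 * (p : ℝ) ^ (-(3 / 2) : ℝ) := by
  have hp0 : (0 : ℝ) < p := by exact_mod_cast hp.pos
  have hp1 : (1 : ℝ) ≤ p := by exact_mod_cast hp.one_le
  have hu := norm_prime_cpow_neg_le hp hα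
  have hv := norm_prime_cpow_neg_le (x := 0) hp (by simpa using hγ : -(0 : ℝ) ≤ γ.re)
  rw [Real.rpow_zero] at hv
  have h4 : (1 : ℝ) ≤ (p : ℝ) ^ (1 / 4 : ℝ) := Real.one_le_rpow hp1 (by norm_num)
  have hden := two_div_five_le_norm_one_sub hp hα hγ
  have hsub : ‖(p : ℂ) ^ (-γ) - (p : ℂ) ^ (-α)‖ ≤ 2 * (p : ℝ) ^ (1 / 4 : ℝ) := by
    refine (norm_sub_le _ _).trans ?_
    linarith
  have hnp : ‖(p : ℂ) + 1‖ = p + 1 := by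
    have : (p : ℂ) + 1 = ((p + 1 : ℝ) : ℂ) := by push_cast; rfl
    rw [this, norm_real, Real.norm_of_nonneg (by positivity)]
  rw [ratiosLocal, norm_div, norm_mul, norm_mul, norm_mul, norm_natCast, hnp]
  calc _ ≤ (p : ℝ) ^ (1 / 4 : ℝ) * (2 * (p : ℝ) ^ (1 / 4 : ℝ)) / (p * p * (2 / 5)) := by
        gcongr
        linarith
    _ = 5 * (((p : ℝ) ^ (1 / 4 : ℝ) * (p : ℝ) ^ (1 / 4 : ℝ)) / ((p : ℝ) ^ (2 : ℕ))) := by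
        field_simp
    _ = 5 * (p : ℝ) ^ (-(3 / 2) : ℝ) := by
        rw [← Real.rpow_add hp0, ← Real.rpow_natCast, ← Real.rpow_sub hp0]
        norm_num

lemma summable_ratiosBound : Summable fun p : Nat.Primes => 5 * ((p : ℕ) : ℝ) ^ (-(3 / 2) : ℝ) :=
  (Nat.Primes.summable_rpow.mpr (by norm_num)).mul_left 5

/-- Since `1/p - 1/(p+1) = 1/(p(p+1))`, the terms in `p^{-α-γ}` nearly cancel. What is left
converges beyond `Re α = 0` and vanishes at `α = γ`. -/
lemma ratios_factor_eq {p : ℕ} (hp : p.Prime) {α γ : ℂ} (hα : -(1 / 4) ≤ α.re) (hγ : 0 ≤ γ.re) :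
    (1 - 1 / (p : ℂ) ^ (1 + α + γ))⁻¹ *
      (1 - 1 / (((p : ℂ) + 1) * (p : ℂ) ^ (1 + 2 * α))
        - 1 / (((p : ℂ) + 1) * (p : ℂ) ^ (α + γ))) = 1 + ratiosLocal p α γ := by
  have hp0 : (p : ℂ) ≠ 0 := by exact_mod_cast hp.ne_zero
  have hp1 : (p : ℂ) + 1 ≠ 0 := by exact_mod_cast (Nat.succ_ne_zero p)
  have hden := one_sub_ne_zero_of_prime hp hα hγ
  have e1 : 1 / (p : ℂ) ^ (1 + α + γ) = (p : ℂ) ^ (-α) * (p : ℂ) ^ (-γ) / p := by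
    rw [cpow_add _ _ hp0, cpow_add _ _ hp0, cpow_one, cpow_neg, cpow_neg]
    have := (cpow_ne_zero_iff_of_exponent_ne_zero (x := (p : ℂ)) (y := 1) one_ne_zero).mpr hp0
    field_simp
  have e2 : 1 / (((p : ℂ) + 1) * (p : ℂ) ^ (1 + 2 * α)) =
      (p : ℂ) ^ (-α) * (p : ℂ) ^ (-α) / (p * (p + 1)) := by
    rw [cpow_add _ _ hp0, two_mul, cpow_add _ _ hp0, cpow_one, cpow_neg]
    field_simp
  have e3 : 1 / (((p : ℂ) + 1) * (p : ℂ) ^ (α + γ)) =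
      (p : ℂ) ^ (-α) * (p : ℂ) ^ (-γ) / (p + 1) := by
    rw [cpow_add _ _ hp0, cpow_neg, cpow_neg]
    field_simp
  rw [e1, e2, e3, ratiosLocal]
  set u := (p : ℂ) ^ (-α)
  set v := (p : ℂ) ^ (-γ)
  have hden' : (p : ℂ) - u * v ≠ 0 := by
    intro h
    apply hden
    field_simp
    linear_combination h
  field_simp
  ring

lemma ratiosA_eq_tprod {α γ : ℂ} (hα : -(1 / 4) ≤ α.re) (hγ : 0 ≤ γ.re) :
    ratiosA α γ = ∏' p : Nat.Primes, (1 + ratiosLocal p α γ) :=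
  tprod_congr fun p => ratios_factor_eq p.prop hα hγ

lemma summable_norm_ratiosLocal {α γ : ℂ} (hα : -(1 / 4) ≤ α.re) (hγ : 0 ≤ γ.re) :
    Summable fun p : Nat.Primes => ‖ratiosLocal p α γ‖ :=
  summable_ratiosBound.of_nonneg_of_le (fun _ => norm_nonneg _)
    fun p => norm_ratiosLocal_le p.prop hα hγ

lemma multipliable_ratiosLocal {α γ : ℂ} (hα : -(1 / 4) ≤ α.re) (hγ : 0 ≤ γ.re) :
    Multipliable fun p : Nat.Primes => 1 + ratiosLocal p α γ :=
  multipliable_one_add_of_summable (summable_norm_ratiosLocal hα hγ)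

/-- Finite products are at most `exp` of the common majorant's sum. Uniformity in `γ` replaces
continuity in `γ` when zeros are excluded. -/
lemma exists_norm_ratiosA_le : ∃ M : ℝ, 0 < M ∧ ∀ α γ : ℂ, -(1 / 4) ≤ α.re → 0 ≤ γ.re →
    ‖ratiosA α γ‖ ≤ M := by
  set S := ∑' p : Nat.Primes, 5 * ((p : ℕ) : ℝ) ^ (-(3 / 2) : ℝ) with hS
  refine ⟨Real.exp S, Real.exp_pos _, fun α γ hα hγ => ?_⟩
  rw [ratiosA_eq_tprod hα hγ]
  refine le_of_tendsto (multipliable_ratiosLocal hα hγ).hasProd.norm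
    (Eventually.of_forall fun s => ?_)
  have h1 := s.norm_prod_one_add_sub_one_le (fun p : Nat.Primes => ratiosLocal p α γ)
  have h2 : ∑ p ∈ s, ‖ratiosLocal p α γ‖ ≤ S :=
    (Finset.sum_le_sum fun p _ => norm_ratiosLocal_le p.prop hα hγ).trans
      (summable_ratiosBound.sum_le_tsum s fun _ _ => by positivity)
  have h3 := Real.exp_le_exp.mpr h2
  have h4 := norm_le_norm_sub_add (∏ p ∈ s, (1 + ratiosLocal p α γ)) 1
  rw [norm_one] at h4
  change ∏ p ∈ s, ‖1 + ratiosLocal p α γ‖ ≤ _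
  rw [← norm_prod]
  linarith

lemma differentiableAt_ratiosLocal {p : ℕ} (hp : p.Prime) {α γ : ℂ} (hα : -(1 / 4) ≤ α.re)
    (hγ : 0 ≤ γ.re) : DifferentiableAt ℂ (fun α => ratiosLocal p α γ) α := by
  have hp0 : (p : ℂ) ≠ 0 := by exact_mod_cast hp.ne_zero
  have hp1 : (p : ℂ) + 1 ≠ 0 := by exact_mod_cast (Nat.succ_ne_zero p)
  have hu : DifferentiableAt ℂ (fun α : ℂ => (p : ℂ) ^ (-α)) α :=
    differentiableAt_id.neg.const_cpow (Or.inl hp0)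
  unfold ratiosLocal
  refine DifferentiableAt.div (by fun_prop) (by fun_prop) ?_
  exact mul_ne_zero (mul_ne_zero hp0 hp1) (one_sub_ne_zero_of_prime hp hα hγ)

lemma isOpen_ratiosDomain : IsOpen {α : ℂ | -(1 / 4) < α.re} :=
  isOpen_lt continuous_const continuous_re

lemma multipliableLocallyUniformlyOn_ratiosLocal {γ : ℂ} (hγ : 0 ≤ γ.re) :
    MultipliableLocallyUniformlyOn (fun (p : Nat.Primes) α => 1 + ratiosLocal p α γ)
      {α : ℂ | -(1 / 4) < α.re} :=
  summable_ratiosBound.multipliableLocallyUniformlyOn_one_add isOpen_ratiosDomain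
    (Eventually.of_forall fun p _ hα => norm_ratiosLocal_le p.prop (le_of_lt hα) hγ)
    fun p _ hα => (differentiableAt_ratiosLocal p.prop (le_of_lt hα) hγ).continuousAt.continuousWithinAt

lemma differentiableAt_ratiosA {α γ : ℂ} (hα : -(1 / 4) < α.re) (hγ : 0 ≤ γ.re) :
    DifferentiableAt ℂ (fun α => ratiosA α γ) α := by
  have h := (multipliableLocallyUniformlyOn_ratiosLocal hγ).hasProdLocallyUniformlyOn
  rw [hasProdLocallyUniformlyOn_iff_tendstoLocallyUniformlyOn] at h
  have hd := h.differentiableOn (Eventually.of_forall fun s => ?_) isOpen_ratiosDomain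
  · refine (hd.differentiableAt (isOpen_ratiosDomain.mem_nhds hα)).congr_of_eventuallyEq ?_
    filter_upwards [isOpen_ratiosDomain.mem_nhds hα] with β hβ
    exact ratiosA_eq_tprod (le_of_lt hβ) hγ
  · refine DifferentiableOn.fun_finsetProd fun p _ β hβ => ?_
    exact ((differentiableAt_ratiosLocal p.prop (le_of_lt hβ) hγ).const_add 1).differentiableWithinAt

lemma ratiosA_self {r : ℂ} (hr : 0 ≤ r.re) : ratiosA r r = 1 := by
  rw [ratiosA_eq_tprod (by linarith) hr]
  simp [ratiosLocal]

lemma hasDerivAt_ratiosLocal_self {p : ℕ} (hp : p.Prime) {r : ℂ} (hr : 0 ≤ r.re) :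
    HasDerivAt (fun α => ratiosLocal p α r)
      ((Real.log p : ℂ) / (((p : ℂ) + 1) * ((p : ℂ) ^ (1 + 2 * r) - 1))) r := by
  have hp0 : (p : ℂ) ≠ 0 := by exact_mod_cast hp.ne_zero
  have hp1 : (p : ℂ) + 1 ≠ 0 := by exact_mod_cast (Nat.succ_ne_zero p)
  have hden := one_sub_ne_zero_of_prime hp (by linarith : -(1 / 4) ≤ r.re) hr
  have hu : HasDerivAt (fun α : ℂ => (p : ℂ) ^ (-α)) ((p : ℂ) ^ (-r) * log p * (-1)) r :=
    (hasDerivAt_neg r).const_cpow (Or.inl hp0)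
  have hnum := hu.mul (hu.const_sub ((p : ℂ) ^ (-r)))
  have hd := (((hu.mul_const ((p : ℂ) ^ (-r))).div_const (p : ℂ)).const_sub 1).const_mul
    ((p : ℂ) * (p + 1))
  have h := hnum.div hd (mul_ne_zero (mul_ne_zero hp0 hp1) hden)
  refine h.congr_deriv ?_
  have e : (p : ℂ) ^ (1 + 2 * r) = p / ((p : ℂ) ^ (-r) * (p : ℂ) ^ (-r)) := by
    rw [cpow_add _ _ hp0, two_mul, cpow_add _ _ hp0, cpow_one, cpow_neg]
    field_simp
  rw [e, ← natCast_log]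
  have hu0 : (p : ℂ) ^ (-r) ≠ 0 := by simp [cpow_eq_zero_iff, hp0]
  simp only [Pi.mul_apply]
  set u := (p : ℂ) ^ (-r)
  have hden' : (p : ℂ) - u ^ 2 ≠ 0 := by
    intro h
    apply hden
    field_simp
    linear_combination h
  field_simp
  ring

lemma summable_log_div_prime {r : ℂ} (hr : 0 ≤ r.re) :
    Summable fun p : Nat.Primes => (Real.log (p : ℕ) : ℂ) /
      ((((p : ℕ) : ℂ) + 1) * (((p : ℕ) : ℂ) ^ (1 + 2 * r) - 1)) := by
  refine Summable.of_norm_bounded (g := fun p : Nat.Primes => 4 * ((p : ℕ) : ℝ) ^ (-(3 / 2) : ℝ))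
    ((Nat.Primes.summable_rpow.mpr (by norm_num)).mul_left 4) fun ⟨p, hp⟩ => ?_
  have hp0 : (0 : ℝ) < p := by exact_mod_cast hp.pos
  have hp2 : (2 : ℝ) ≤ p := by exact_mod_cast hp.two_le
  have h1 : (p : ℝ) / 2 ≤ ‖(p : ℂ) ^ (1 + 2 * r) - 1‖ := by
    have h := norm_sub_norm_le ((p : ℂ) ^ (1 + 2 * r)) 1
    rw [norm_natCast_cpow_of_pos hp.pos, norm_one] at h
    have : (p : ℝ) ^ (1 : ℝ) ≤ (p : ℝ) ^ (1 + 2 * r).re :=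
      Real.rpow_le_rpow_of_exponent_le (by linarith) (by simp; linarith)
    rw [Real.rpow_one] at this
    linarith
  have hnp : ‖(p : ℂ) + 1‖ = p + 1 := by
    have : (p : ℂ) + 1 = ((p + 1 : ℝ) : ℂ) := by push_cast; rfl
    rw [this, norm_real, Real.norm_of_nonneg (by positivity)]
  have hlog : Real.log p ≤ (p : ℝ) ^ (1 / 2 : ℝ) / (1 / 2) :=
    Real.log_le_rpow_div hp0.le (by norm_num)
  rw [norm_div, norm_mul, hnp, norm_real, Real.norm_of_nonneg (Real.log_nonneg (by linarith))]
  calc _ ≤ ((p : ℝ) ^ (1 / 2 : ℝ) / (1 / 2)) / (p * (p / 2)) := by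
        gcongr
        linarith
    _ = 4 * ((p : ℝ) ^ (1 / 2 : ℝ) / (p : ℝ) ^ (2 : ℕ)) := by field_simp; norm_num
    _ = _ := by
        rw [← Real.rpow_natCast, ← Real.rpow_sub hp0]
        norm_num

/-- Every local factor equals `1` at `α = r`, so derivative and logarithmic derivative coincide
there, and the latter may be summed over primes. -/
lemma hasDerivAt_ratiosA_self {r : ℂ} (hr : 0 ≤ r.re) :
    HasDerivAt (fun α => ratiosA α r) (∑' p : Nat.Primes, (Real.log (p : ℕ) : ℂ) /
      ((((p : ℕ) : ℂ) + 1) * (((p : ℕ) : ℂ) ^ (1 + 2 * r) - 1))) r := by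
  have hmem : r ∈ {α : ℂ | -(1 / 4) < α.re} := by
    change -(1 / 4) < r.re
    linarith
  have hone : ∀ p : Nat.Primes, 1 + ratiosLocal p r r = 1 := fun p => by simp [ratiosLocal]
  have hlog : ∀ p : Nat.Primes, logDeriv (fun α => 1 + ratiosLocal p α r) r =
      (Real.log (p : ℕ) : ℂ) / ((((p : ℕ) : ℂ) + 1) * (((p : ℕ) : ℂ) ^ (1 + 2 * r) - 1)) := by
    intro p
    rw [logDeriv_apply, hone, div_one, ((hasDerivAt_ratiosLocal_self p.prop hr).const_add 1).deriv]
  have h := logDeriv_tprod_eq_tsum isOpen_ratiosDomain hmem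
    (f := fun (p : Nat.Primes) α => 1 + ratiosLocal p α r)
    (fun p => by rw [hone]; exact one_ne_zero)
    (fun p β hβ => ((differentiableAt_ratiosLocal p.prop
      (le_of_lt hβ) hr).const_add 1).differentiableWithinAt)
    (by simp_rw [hlog]; exact summable_log_div_prime hr)
    (multipliableLocallyUniformlyOn_ratiosLocal hr)
    (by simp [hone])
  simp_rw [hlog] at h
  rw [← h]
  have heq : (fun α => ∏' p : Nat.Primes, (1 + ratiosLocal p α r)) =ᶠ[𝓝 r]
      fun α => ratiosA α r := by
    filter_upwards [isOpen_ratiosDomain.mem_nhds hmem] with β hβ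
    exact (ratiosA_eq_tprod (le_of_lt hβ) hr).symm
  rw [logDeriv_apply, heq.deriv_eq]
  have : ∏' p : Nat.Primes, (1 + ratiosLocal p r r) = 1 := by simp [hone]
  rw [this, div_one]
  exact (differentiableAt_ratiosA hmem hr).hasDerivAt

/-- The local factor at `(-r; r)` collapses to `(1 - p^{-(2-2r)})/(1 - p^{-2})`. The Euler products
of `ζ(2)` and `ζ(2 - 2r)` are compared prime by prime. -/
lemma ratiosA_neg_self {r : ℂ} (hr : 0 ≤ r.re) (hr' : r.re ≤ 1 / 4) :
    ratiosA (-r) r = (Real.pi : ℂ) ^ 2 / 6 / riemannZeta (2 - 2 * r) := by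
  have hre : 1 < (2 - 2 * r).re := by simp; linarith
  have hα : -(1 / 4) ≤ (-r).re := by rw [neg_re]; linarith
  rw [eq_div_iff (riemannZeta_ne_zero_of_one_lt_re hre), ratiosA_eq_tprod hα hr,
    ← riemannZeta_two]
  have h1 := (multipliable_ratiosLocal hα hr).hasProd.mul (riemannZeta_eulerProduct_hasProd hre)
  refine h1.unique ?_
  have h2 := riemannZeta_eulerProduct_hasProd (s := 2) (by simp)
  refine h2.congr_fun fun p => ?_
  rw [← ratios_factor_eq p.prop hα hr]
  obtain ⟨p, hp⟩ := p
  have hp0 : (p : ℂ) ≠ 0 := by exact_mod_cast hp.ne_zero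
  have hp1 : (p : ℂ) + 1 ≠ 0 := by exact_mod_cast (Nat.succ_ne_zero p)
  have hpm : (p : ℂ) - 1 ≠ 0 := by
    rw [sub_ne_zero]; exact_mod_cast hp.one_lt.ne'
  have hw : 1 - (p : ℂ) ^ (-(2 - 2 * r)) ≠ 0 := by
    intro h
    have h3 : ‖(p : ℂ) ^ (-(2 - 2 * r))‖ < 1 := by
      rw [norm_natCast_cpow_of_pos hp.pos]
      exact Real.rpow_lt_one_of_one_lt_of_neg (by exact_mod_cast hp.one_lt) (by rw [neg_re]; linarith)
    rw [← sub_eq_zero.mp h, norm_one] at h3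
    exact lt_irrefl _ h3
  have e1 : (p : ℂ) ^ (1 + 2 * -r) = (p * (p : ℂ) ^ (-(2 - 2 * r)))⁻¹ := by
    have h := cpow_add (1 : ℂ) (-(2 - 2 * r)) hp0
    rw [cpow_one] at h
    rw [← h, ← cpow_neg]
    congr 1
    ring
  have e2 : (p : ℂ) ^ (1 + -r + r) = p := by simp
  have e3 : (p : ℂ) ^ (-r + r) = 1 := by simp
  have e4 : (p : ℂ) ^ (-2 : ℂ) = ((p : ℂ) ^ 2)⁻¹ := by
    rw [cpow_neg]; norm_cast
  simp only [e1, e2, e3, e4]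
  set w := (p : ℂ) ^ (-(2 - 2 * r))
  have hw0 : w ≠ 0 := by simp [w, cpow_eq_zero_iff, hp0]
  have h5 : (1 : ℂ) - 1 / p ≠ 0 := by
    intro h; apply hpm; field_simp at h; linear_combination h
  have h6 : (1 : ℂ) - ((p : ℂ) ^ 2)⁻¹ ≠ 0 := by
    intro h
    have : ((p : ℂ) - 1) * (p + 1) = 0 := by
      field_simp at h
      linear_combination h
    exact mul_ne_zero hpm hp1 this
  rw [← sub_eq_zero]
  have h7 : (p : ℂ) ^ 2 - 1 ≠ 0 := by
    have : (p : ℂ) ^ 2 - 1 = (p - 1) * (p + 1) := by ring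
    rw [this]; exact mul_ne_zero hpm hp1
  field_simp
  ring

end Murmuration
end

noncomputable section
namespace Murmuration
open Complex Filter Topology

/-! ### The averaged logarithmic derivative -/

lemma differentiable_quadraticL {d : ℕ} (hd : IsFundamentalDiscriminant d) (h1 : 1 < d) :
    Differentiable ℂ (quadraticL d) := by
  have : NeZero d := ⟨by omega⟩
  obtain ⟨χ, hχ1, hχ⟩ := exists_dirichletCharacter_eq_kroneckerSym hd h1
  rw [quadraticL_eq_LFunction hχ]
  exact DirichletCharacter.differentiable_LFunction hχ1

/-- The function `w ↦ 1 / ζ(1 + w)`, with its zero at `w = 0` filled in. -/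
def zetaOneInv (w : ℂ) : ℂ := if w = 0 then 0 else 1 / riemannZeta (1 + w)

lemma tendsto_mul_riemannZeta_one_add :
    Tendsto (fun w : ℂ => w * riemannZeta (1 + w)) (𝓝[≠] 0) (𝓝 1) := by
  have h := riemannZeta_residue_one
  have h2 : Tendsto (fun w : ℂ => 1 + w) (𝓝[≠] 0) (𝓝[≠] 1) := by
    refine tendsto_nhdsWithin_of_tendsto_nhds_of_eventually_within _ ?_ ?_
    · have : Tendsto (fun w : ℂ => 1 + w) (𝓝 0) (𝓝 (1 + 0)) := (by fun_prop : Continuous _).tendsto _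
      rw [add_zero] at this
      exact this.mono_left nhdsWithin_le_nhds
    · filter_upwards [self_mem_nhdsWithin] with w hw
      simpa using hw
  refine (h.comp h2).congr fun w => ?_
  simp

/-- The pole of `ζ` at `1` is simple with residue `1`. The slope `1` is the coefficient with which
the dual term enters the logarithmic derivative. -/
lemma hasDerivAt_zetaOneInv_zero : HasDerivAt zetaOneInv 1 0 := by
  rw [hasDerivAt_iff_tendsto_slope]
  have h := tendsto_mul_riemannZeta_one_add.inv₀ one_ne_zero
  rw [inv_one] at h
  refine h.congr' ?_
  filter_upwards [self_mem_nhdsWithin] with w hw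
  have hw' : w ≠ 0 := hw
  rw [slope_def_field, zetaOneInv, zetaOneInv, if_neg hw', if_pos rfl, sub_zero, sub_zero, mul_inv,
    div_div, one_div, mul_inv]
  ring

lemma exists_riemannZeta_one_add_ne_zero :
    ∃ ρ : ℝ, 0 < ρ ∧ ∀ w : ℂ, ‖w‖ < ρ → w ≠ 0 → riemannZeta (1 + w) ≠ 0 := by
  have h := tendsto_mul_riemannZeta_one_add.eventually_ne one_ne_zero
  rw [eventually_nhdsWithin_iff, Metric.eventually_nhds_iff] at h
  obtain ⟨ρ, hρ, h⟩ := h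
  refine ⟨ρ, hρ, fun w hw hw0 hz => ?_⟩
  exact h (by simpa using hw) hw0 (by rw [hz, mul_zero])

lemma differentiableAt_zetaOneInv {w : ℂ} (h : w ≠ 0 → riemannZeta (1 + w) ≠ 0) :
    DifferentiableAt ℂ zetaOneInv w := by
  rcases eq_or_ne w 0 with rfl | hw
  · exact hasDerivAt_zetaOneInv_zero.differentiableAt
  have hz : DifferentiableAt ℂ (fun w => riemannZeta (1 + w)) w :=
    (differentiableAt_riemannZeta (s := 1 + w) (by simpa using hw)).comp w (by fun_prop)
  refine ((differentiableAt_const 1).div hz (h hw)).congr_of_eventuallyEq ?_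
  filter_upwards [isOpen_ne.mem_nhds hw] with v hv
  simp [zetaOneInv, if_neg hv]

lemma differentiableAt_dualFactor {d : ℕ} (hd : d ≠ 0) {α : ℂ} (h0 : 0 < α.re)
    (h1 : α.re < 1 / 2) : DifferentiableAt ℂ (dualFactor d) α := by
  have hd' : (((d : ℝ) / Real.pi : ℝ) : ℂ) ≠ 0 := by
    have : (d : ℝ) / Real.pi ≠ 0 := by positivity
    exact_mod_cast this
  have hG : ∀ z : ℂ, 0 < z.re → ∀ m : ℕ, z ≠ -m := by
    intro z hz m h
    rw [h] at hz
    simp at hz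
    linarith [(Nat.cast_nonneg m : (0 : ℝ) ≤ m)]
  have hre1 : 0 < (1 / 4 - α / 2 : ℂ).re := by
    have : (1 / 4 - α / 2 : ℂ).re = 1 / 4 - α.re / 2 := by simp
    rw [this]; linarith
  have hre2 : 0 < (1 / 4 + α / 2 : ℂ).re := by
    have : (1 / 4 + α / 2 : ℂ).re = 1 / 4 + α.re / 2 := by simp
    rw [this]; linarith
  have d1 : DifferentiableAt ℂ (fun α : ℂ => Gamma (1 / 4 - α / 2)) α :=
    (differentiableAt_Gamma _ (hG _ hre1)).comp α (by fun_prop)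
  have d2 : DifferentiableAt ℂ (fun α : ℂ => Gamma (1 / 4 + α / 2)) α :=
    (differentiableAt_Gamma _ (hG _ hre2)).comp α (by fun_prop)
  have d3 : DifferentiableAt ℂ (fun α : ℂ => (((d : ℝ) / Real.pi : ℝ) : ℂ) ^ (-α)) α :=
    differentiableAt_id.neg.const_cpow (Or.inl hd')
  exact d3.mul (d1.div d2 (Gamma_ne_zero_of_re_pos hre2))

lemma differentiableAt_zeta_one_sub_two_mul {α : ℂ} (h : α ≠ 0) :
    DifferentiableAt ℂ (fun α => riemannZeta (1 - 2 * α)) α :=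
  (differentiableAt_riemannZeta (s := 1 - 2 * α) (by simpa [sub_eq_self] using h)).comp α
    (by fun_prop)

lemma differentiableAt_zeta_one_add_two_mul {α : ℂ} (h : α ≠ 0) :
    DifferentiableAt ℂ (fun α => riemannZeta (1 + 2 * α)) α :=
  (differentiableAt_riemannZeta (s := 1 + 2 * α) (by simpa using h)).comp α (by fun_prop)

/-- The diagonal term of the ratios prediction. -/
def diagonalTerm (α γ : ℂ) : ℂ :=
  riemannZeta (1 + 2 * α) / riemannZeta (1 + α + γ) * ratiosA α γ

/-- The dual term of the ratios prediction, without the factor `1 / ζ(1 - α + γ)`. -/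
def dualTerm (d : ℕ) (α γ : ℂ) : ℂ :=
  dualFactor d α * riemannZeta (1 - 2 * α) * ratiosA (-α) γ

lemma ratiosPrediction_eq {d : ℕ} {α γ : ℂ} (h : α ≠ γ) :
    ratiosPrediction d α γ = diagonalTerm α γ + dualTerm d α γ * zetaOneInv (γ - α) := by
  have : γ - α ≠ 0 := sub_ne_zero.mpr h.symm
  rw [ratiosPrediction, diagonalTerm, dualTerm, zetaOneInv, if_neg this,
    show 1 + (γ - α) = 1 - α + γ by ring]
  ring

lemma ne_zero_of_re_pos {α : ℂ} (h : 0 < α.re) : α ≠ 0 := by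
  rintro rfl
  simp at h

lemma differentiableAt_diagonalTerm {α γ : ℂ} (hα : 0 < α.re) (hγ : 0 < γ.re) :
    DifferentiableAt ℂ (fun α => diagonalTerm α γ) α := by
  have hre : 1 < (1 + α + γ).re := by simp; linarith
  have h2 : DifferentiableAt ℂ (fun α => riemannZeta (1 + α + γ)) α := by
    refine (differentiableAt_riemannZeta (s := 1 + α + γ) ?_).comp α (by fun_prop)
    intro h
    rw [h] at hre
    simp at hre
  exact ((differentiableAt_zeta_one_add_two_mul (ne_zero_of_re_pos hα)).div h2
    (riemannZeta_ne_zero_of_one_lt_re hre)).mul (differentiableAt_ratiosA (by linarith) hγ.le)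

lemma differentiableAt_dualTerm {d : ℕ} (hd : d ≠ 0) {α γ : ℂ} (hα : 0 < α.re)
    (hα' : α.re < 1 / 4) (hγ : 0 < γ.re) : DifferentiableAt ℂ (fun α => dualTerm d α γ) α := by
  have hA : DifferentiableAt ℂ (fun α => ratiosA (-α) γ) α :=
    (differentiableAt_ratiosA (α := -α) (by rw [neg_re]; linarith) hγ.le).comp α
      differentiableAt_id.neg
  exact ((differentiableAt_dualFactor hd hα (by linarith)).mul
    (differentiableAt_zeta_one_sub_two_mul (ne_zero_of_re_pos hα))).mul hA

/-- At `α = r` both the zeta quotient and `A` equal `1`, so the derivatives add. The quotient gives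
`2 ζ'/ζ - ζ'/ζ`. -/
lemma hasDerivAt_diagonalTerm_self {r : ℂ} (hr : 0 < r.re) :
    HasDerivAt (fun α => diagonalTerm α r)
      (deriv riemannZeta (1 + 2 * r) / riemannZeta (1 + 2 * r) +
        ∑' p : Nat.Primes, (Real.log (p : ℕ) : ℂ) /
          ((((p : ℕ) : ℂ) + 1) * (((p : ℕ) : ℂ) ^ (1 + 2 * r) - 1))) r := by
  have hre : 1 < (1 + 2 * r).re := by simp; linarith
  have hz : riemannZeta (1 + 2 * r) ≠ 0 := riemannZeta_ne_zero_of_one_lt_re hre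
  have hne : 1 + 2 * r ≠ 1 := by simpa using ne_zero_of_re_pos hr
  have hζ := (differentiableAt_riemannZeta hne).hasDerivAt
  have h1 : HasDerivAt (fun α : ℂ => 1 + 2 * α) 2 r := by
    simpa using ((hasDerivAt_id r).const_mul (2 : ℂ)).const_add 1
  have h2 : HasDerivAt (fun α : ℂ => 1 + α + r) 1 r := by
    simpa using ((hasDerivAt_id r).const_add 1).add_const r
  have e : 1 + r + r = 1 + 2 * r := by ring
  have h3 := hζ.comp r h1
  have hζ' : HasDerivAt riemannZeta (deriv riemannZeta (1 + 2 * r)) (1 + r + r) := by rwa [e]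
  have h4 := HasDerivAt.comp (h := fun α : ℂ => 1 + α + r) r hζ' h2
  have h5 := (h3.div h4 (by simp only [Function.comp]; rwa [e])).mul (hasDerivAt_ratiosA_self hr.le)
  refine h5.congr_deriv ?_
  simp only [Function.comp, Pi.div_apply, e, ratiosA_self hr.le]
  field_simp
  ring

/-- The difference between the averaged ratio and its prediction, as a function of `α`. -/
def ratiosDifference (D : ℝ) (γ α : ℂ) : ℂ :=
  ∑ d ∈ discFamily 1 D, quadraticL d (1 / 2 + α) / quadraticL d (1 / 2 + γ) -
    ∑ d ∈ discFamily 1 D, (diagonalTerm α γ + dualTerm d α γ * zetaOneInv (γ - α))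

lemma one_lt_of_mem_discFamily {D₁ D : ℝ} (hD : 1 ≤ D₁) {d : ℕ} (hd : d ∈ discFamily D₁ D) :
    1 < d := by
  have := (mem_discFamily.mp hd).1
  have : (1 : ℝ) < d := by linarith
  exact_mod_cast this

lemma differentiableAt_ratiosDifference {D : ℝ} {γ α : ℂ} (hα : 0 < α.re)
    (hα' : α.re < 1 / 4) (hγ : 0 < γ.re)
    (hz : γ - α ≠ 0 → riemannZeta (1 + (γ - α)) ≠ 0) :
    DifferentiableAt ℂ (ratiosDifference D γ) α := by
  refine DifferentiableAt.sub (DifferentiableAt.fun_sum fun d hd => ?_)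
    (DifferentiableAt.fun_sum fun d hd => ?_)
  · have hd1 := one_lt_of_mem_discFamily le_rfl hd
    have := (differentiable_quadraticL (mem_discFamily.mp hd).2.2 hd1) (1 / 2 + α)
    exact (this.comp α (by fun_prop)).div_const _
  · have hd1 := one_lt_of_mem_discFamily le_rfl hd
    refine (differentiableAt_diagonalTerm hα hγ).add
      ((differentiableAt_dualTerm (by omega) hα hα' hγ).mul ?_)
    exact (differentiableAt_zetaOneInv hz).comp α (by fun_prop)

/-- The dual term carries the factor `zetaOneInv (r - α)`, which vanishes at `α = r` with slope
`-1`. Its derivative is therefore minus the dual term itself, as in the definition of the remainder.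
-/
lemma hasDerivAt_ratiosDifference_self {D : ℝ} {r : ℂ} (hr : 0 < r.re) (hr' : r.re < 1 / 4) :
    HasDerivAt (ratiosDifference D r) (ratiosRemainder D r) r := by
  refine HasDerivAt.sub (HasDerivAt.fun_sum fun d hd => ?_) (HasDerivAt.fun_sum fun d hd => ?_)
  · have hd1 := one_lt_of_mem_discFamily le_rfl hd
    have := (differentiable_quadraticL (mem_discFamily.mp hd).2.2 hd1 (1 / 2 + r)).hasDerivAt
    exact (this.comp_const_add (1 / 2) r).div_const _
  · have hd1 := one_lt_of_mem_discFamily le_rfl hd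
    have h1 := (differentiableAt_dualTerm (d := d) (by omega) hr hr' hr).hasDerivAt
    have h0 : HasDerivAt zetaOneInv 1 (r - r) := by
      rw [sub_self]; exact hasDerivAt_zetaOneInv_zero
    have h2 : HasDerivAt (fun α => zetaOneInv (r - α)) (1 * -1) r :=
      h0.comp r ((hasDerivAt_id r).const_sub r)
    refine ((hasDerivAt_diagonalTerm_self hr).add (h1.mul h2)).congr_deriv ?_
    simp [zetaOneInv, dualTerm]
    ring

lemma discFamily_eq_empty {D : ℝ} (hD : D ≤ 5) : discFamily 1 D = ∅ := by
  rw [Finset.eq_empty_iff_forall_notMem]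
  intro d hd
  have h5 := five_le_of_isFundamentalDiscriminant (mem_discFamily.mp hd).2.2
    (one_lt_of_mem_discFamily le_rfl hd)
  have : (5 : ℝ) ≤ d := by exact_mod_cast h5
  linarith [(mem_discFamily.mp hd).2.1]

lemma one_lt_log_of_five_le {D : ℝ} (hD : 5 ≤ D) : 1 < Real.log D := by
  rw [Real.lt_log_iff_exp_lt (by linarith)]
  linarith [Real.exp_one_lt_d9]

/-- Cauchy's estimate on a circle of radius `ρ` about `r`. The radius keeps the disc inside `ε/2 ≤
Re α < 1/4` and avoids zeros of `ζ(1 + γ - α)`, so it depends neither on `D` nor on `t`. On the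
circle `α ≠ γ`, as the conjecture requires. -/
theorem ratiosRemainder_bound (hratios : RatiosConjecture) {ε : ℝ} (hε : 0 < ε) (hε' : ε < 1 / 4)
    {C : ℝ} (hC : 0 < C) {η : ℝ} (hη : 0 < η) :
    ∃ K : ℝ, ∀ D t : ℝ, 1 < D → |t| ≤ C * D ^ (1 - ε) →
      ‖ratiosRemainder D ((ε : ℂ) + (t : ℂ) * I)‖ ≤ K * D ^ (1 / 2 + η) := by
  obtain ⟨ρ₀, hρ₀, hζ⟩ := exists_riemannZeta_one_add_ne_zero
  -- The exponent `min η ε` serves both the error `D^{1/2+η}` and the height `D^{1-ε}`; `C + 1`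
  -- leaves room for the circle around `r`.
  obtain ⟨K, hK⟩ := hratios (min η ε) (lt_min hη hε) (ε / 2) (by linarith) (C + 1) (by linarith)
  set ρ := min (ρ₀ / 2) (min (ε / 2) ((1 / 4 - ε) / 2)) with hρ
  have hρ1 : ρ ≤ ρ₀ / 2 := min_le_left _ _
  have hρ2 : ρ ≤ ε / 2 := (min_le_right _ _).trans (min_le_left _ _)
  have hρ3 : ρ ≤ (1 / 4 - ε) / 2 := (min_le_right _ _).trans (min_le_right _ _)
  have hρpos : 0 < ρ := lt_min (by linarith) (lt_min (by linarith) (by linarith))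
  refine ⟨max K 0 / ρ, fun D t hD ht => ?_⟩
  -- The least fundamental discriminant above `1` is `5`, so the family is empty up to here. Beyond
  -- it `log D > 1`, and `c / log D ≤ c`.
  rcases le_or_gt D 5 with hD5 | hD5
  · have : ratiosRemainder D ((ε : ℂ) + (t : ℂ) * I) = 0 := by
      simp [ratiosRemainder, discFamily_eq_empty hD5]
    rw [this, norm_zero]
    positivity
  set r : ℂ := (ε : ℂ) + (t : ℂ) * I with hr
  have hrre : r.re = ε := by simp [hr]
  have hrim : r.im = t := by simp [hr]
  have hlog := one_lt_log_of_five_le hD5.le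
  have hclose : ∀ α : ℂ, ‖α - r‖ ≤ ρ → ε / 2 ≤ α.re ∧ α.re < 1 / 4 ∧ |α.im - t| ≤ 1 / 4 := by
    intro α hα
    have h1 := (abs_re_le_norm (α - r)).trans hα
    have h2 := (abs_im_le_norm (α - r)).trans hα
    rw [sub_re, hrre, abs_le] at h1
    rw [sub_im, hrim] at h2
    exact ⟨by linarith [h1.1], by linarith [h1.2], by linarith⟩
  have hd : ∀ α : ℂ, ‖α - r‖ ≤ ρ → DifferentiableAt ℂ (ratiosDifference D r) α := by
    intro α hα
    obtain ⟨h1, h2, -⟩ := hclose α hα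
    refine differentiableAt_ratiosDifference (by linarith) h2 (by rw [hrre]; exact hε) fun h => ?_
    refine hζ _ ?_ h
    rw [norm_sub_rev]
    linarith
  have hcl : DiffContOnCl ℂ (ratiosDifference D r) (Metric.ball r ρ) := by
    refine DifferentiableOn.diffContOnCl ?_
    rw [closure_ball r hρpos.ne']
    intro α hα
    rw [Metric.mem_closedBall, dist_eq_norm] at hα
    exact (hd α hα).differentiableWithinAt
  have hDpow : D ^ (1 - ε) ≤ D ^ (1 - min η ε) :=
    Real.rpow_le_rpow_of_exponent_le hD.le (by linarith [min_le_right η ε])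
  have hDone : 1 ≤ D ^ (1 - ε) := Real.one_le_rpow hD.le (by linarith)
  have hcdiv : ε / 2 / Real.log D ≤ ε / 2 := div_le_self (by linarith) hlog.le
  have hsph : ∀ α ∈ Metric.sphere r ρ, ‖ratiosDifference D r α‖ ≤ max K 0 * D ^ (1 / 2 + η) := by
    intro α hα
    rw [mem_sphere_iff_norm] at hα
    obtain ⟨h1, h2, h3⟩ := hclose α hα.le
    have hne : α ≠ r := by
      rintro rfl
      simp at hα
      linarith
    have him : |α.im| ≤ (C + 1) * D ^ (1 - min η ε) := by
      have : |α.im| ≤ |α.im - t| + |t| := by simpa using abs_add_le (α.im - t) t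
      nlinarith
    have key := hK D hD α r (by linarith) h2 (by rw [hrre]; linarith) (by rw [hrre]; linarith) him
      (by rw [hrim]; nlinarith) hne
    have e : ratiosDifference D r α = ∑ d ∈ discFamily 1 D,
        quadraticL d (1 / 2 + α) / quadraticL d (1 / 2 + r) -
        ∑ d ∈ discFamily 1 D, ratiosPrediction d α r := by
      simp only [ratiosDifference, ratiosPrediction_eq hne]
    rw [e]
    refine key.trans ?_
    gcongr
    · exact le_max_left _ _
    · exact hD.le
    · exact min_le_left _ _
  have := norm_deriv_le_of_forall_mem_sphere_norm_le hρpos hcl hsph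
  rw [(hasDerivAt_ratiosDifference_self (by rw [hrre]; exact hε) (by rw [hrre]; exact hε')).deriv] at this
  refine this.trans (le_of_eq ?_)
  ring

end Murmuration
end

noncomputable section
namespace Murmuration
open Complex Filter Topology

/-! ### A zero-free region from the ratios conjecture -/

lemma quadraticL_ne_zero_of_one_le_re {d : ℕ} (hd : IsFundamentalDiscriminant d) (h1 : 1 < d)
    {s : ℂ} (hs : 1 ≤ s.re) : quadraticL d s ≠ 0 := by
  have : NeZero d := ⟨by omega⟩
  obtain ⟨χ, hχ1, hχ⟩ := exists_dirichletCharacter_eq_kroneckerSym hd h1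
  rw [quadraticL_eq_LFunction hχ]
  exact DirichletCharacter.LFunction_ne_zero_of_one_le_re χ (Or.inl hχ1) hs

lemma eventually_quadraticL_ne_zero {d : ℕ} (hd : IsFundamentalDiscriminant d) (h1 : 1 < d)
    (s : ℂ) : ∀ᶠ z in 𝓝[≠] s, quadraticL d z ≠ 0 := by
  have han : AnalyticOnNhd ℂ (quadraticL d) Set.univ :=
    (differentiable_quadraticL hd h1).differentiableOn.analyticOnNhd isOpen_univ
  by_contra h
  rw [not_eventually] at h
  have hz := han.eqOn_zero_of_preconnected_of_frequently_eq_zero isPreconnected_univ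
    (Set.mem_univ s) (h.mono fun z hz => not_not.mp hz)
  exact quadraticL_ne_zero_of_one_le_re hd h1 (s := 2) (by simp) (hz (Set.mem_univ 2))

lemma exists_real_quadraticL_ne_zero {d : ℕ} (hd : IsFundamentalDiscriminant d) (h1 : 1 < d)
    {a b : ℝ} (hab : a < b) : ∃ x ∈ Set.Ioo a b, quadraticL d (1 / 2 + (x : ℂ)) ≠ 0 := by
  set m := (a + b) / 2 with hm
  have ht : Tendsto (fun x : ℝ => (1 / 2 + x : ℂ)) (𝓝[≠] m) (𝓝[≠] (1 / 2 + m : ℂ)) := by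
    refine tendsto_nhdsWithin_of_tendsto_nhds_of_eventually_within _ ?_ ?_
    · exact ((by fun_prop : Continuous fun x : ℝ => (1 / 2 + x : ℂ)).tendsto m).mono_left
        nhdsWithin_le_nhds
    · filter_upwards [self_mem_nhdsWithin] with x hx
      simpa using hx
  have hmem : Set.Ioo a b ∈ 𝓝[≠] m :=
    mem_nhdsWithin_of_mem_nhds (Ioo_mem_nhds (by linarith) (by linarith))
  obtain ⟨x, hx1, hx2⟩ := ((ht.eventually (eventually_quadraticL_ne_zero hd h1 _)).and hmem).exists
  exact ⟨x, hx2, hx1⟩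

lemma discFamily_succ {d : ℕ} (hd : IsFundamentalDiscriminant d) (h1 : 1 < d) :
    discFamily 1 ((d : ℝ) + 1) = insert d (discFamily 1 d) := by
  ext e
  rw [Finset.mem_insert, mem_discFamily, mem_discFamily]
  constructor
  · rintro ⟨h2, h3, h4⟩
    have h3' : e < d + 1 := by exact_mod_cast h3
    rcases Nat.lt_succ_iff_lt_or_eq.mp h3' with h | h
    · exact Or.inr ⟨h2, by exact_mod_cast h, h4⟩
    · exact Or.inl h
  · rintro (rfl | ⟨h2, h3, h4⟩)
    · exact ⟨by exact_mod_cast h1, by linarith, hd⟩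
    · exact ⟨h2, by linarith, h4⟩

lemma eventually_norm_inv_riemannZeta_le {β γ₀ : ℂ} (h : 1 < (1 + β + γ₀).re) :
    ∃ B : ℝ, ∀ᶠ γ in 𝓝 γ₀, ‖(riemannZeta (1 + β + γ))⁻¹‖ ≤ B := by
  have hne : 1 + β + γ₀ ≠ 1 := by
    intro h'
    rw [h'] at h
    simp at h
  have hc : ContinuousAt (fun γ => (riemannZeta (1 + β + γ))⁻¹) γ₀ := by
    refine ContinuousAt.inv₀ ?_ (riemannZeta_ne_zero_of_one_lt_re h)
    exact ContinuousAt.comp (f := fun γ => 1 + β + γ) (g := riemannZeta)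
      (differentiableAt_riemannZeta hne).continuousAt (by fun_prop)
  refine ⟨‖(riemannZeta (1 + β + γ₀))⁻¹‖ + 1, ?_⟩
  filter_upwards [hc.norm.eventually (Iio_mem_nhds (lt_add_one _))] with γ hγ
  exact le_of_lt hγ

/-- With `Re α < Re γ₀` both `1 + α + γ` and `1 - α + γ` stay in the half-plane where `1/ζ` is
continuous; `A` is bounded outright. -/
lemma eventually_norm_ratiosPrediction_le (d : ℕ) {α γ₀ : ℂ} (hα : 0 < α.re) (hα' : α.re < 1 / 4)
    (hγ : α.re < γ₀.re) : ∃ B : ℝ, ∀ᶠ γ in 𝓝 γ₀, ‖ratiosPrediction d α γ‖ ≤ B := by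
  obtain ⟨M, hM, hA⟩ := exists_norm_ratiosA_le
  obtain ⟨B₁, hB₁⟩ := eventually_norm_inv_riemannZeta_le (β := α) (γ₀ := γ₀) (by simp; linarith)
  obtain ⟨B₂, hB₂⟩ := eventually_norm_inv_riemannZeta_le (β := -α) (γ₀ := γ₀) (by simp; linarith)
  refine ⟨‖riemannZeta (1 + 2 * α)‖ * B₁ * M +
    ‖dualFactor d α‖ * (‖riemannZeta (1 - 2 * α)‖ * B₂) * M, ?_⟩
  have hre : ∀ᶠ γ in 𝓝 γ₀, 0 < γ.re :=
    (isOpen_lt continuous_const continuous_re).mem_nhds (hα.trans hγ)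
  filter_upwards [hB₁, hB₂, hre] with γ h1 h2 h3
  have hA1 := hA α γ (by linarith) h3.le
  have hA2 := hA (-α) γ (by rw [neg_re]; linarith) h3.le
  rw [ratiosPrediction, div_eq_mul_inv, div_eq_mul_inv,
    show (1 : ℂ) - α + γ = 1 + -α + γ by ring]
  refine (norm_add_le _ _).trans ?_
  rw [norm_mul, norm_mul, norm_mul, norm_mul, norm_mul]
  have hB₁0 : 0 ≤ B₁ := (norm_nonneg _).trans h1
  have hB₂0 : 0 ≤ B₂ := (norm_nonneg _).trans h2
  gcongr

/-- Differencing the ratios conjecture in `D` isolates a single discriminant, and the resulting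
bound for `L(1/2 + α, χ_d) / L(1/2 + γ, χ_d)` excludes zeros of `L(1/2 + γ, χ_d)`. -/
theorem quadraticL_ne_zero (hratios : RatiosConjecture) {ε δ C : ℝ} (hε : 0 < ε) (hε1 : ε < 1)
    (hδ : 0 < δ) (hδ' : δ < 1 / 4) (hC : 0 < C) {d : ℕ} (hd : IsFundamentalDiscriminant d)
    (h1 : 1 < d) {s : ℂ} (hs : 1 / 2 + δ < s.re) (him : |s.im| ≤ C * (d : ℝ) ^ (1 - ε)) :
    quadraticL d s ≠ 0 := by
  rcases le_or_gt 1 s.re with hs1 | hs1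
  · exact quadraticL_ne_zero_of_one_le_re hd h1 hs1
  intro hzero
  obtain ⟨K, hK⟩ := hratios ε hε (δ / 4) (by linarith) (C + 1) (by linarith)
  -- The numerator must not vanish. Having `x` above `δ/4` meets the conjecture's lower bound, and
  -- having it below `δ/2` keeps it left of `γ`.
  obtain ⟨x, ⟨hx1, hx2⟩, hx⟩ := exists_real_quadraticL_ne_zero hd h1
    (by linarith : δ / 4 < δ / 2)
  have hd5 : (5 : ℝ) ≤ d := by exact_mod_cast five_le_of_isFundamentalDiscriminant hd h1
  set γ₀ : ℂ := s - 1 / 2 with hγ₀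
  have hγre : γ₀.re = s.re - 1 / 2 := by simp [hγ₀]
  have hγim : γ₀.im = s.im := by simp [hγ₀]
  have hdpow : 1 ≤ (d : ℝ) ^ (1 - ε) := Real.one_le_rpow (by linarith) (by linarith)
  obtain ⟨B, hB⟩ := eventually_norm_ratiosPrediction_le d (α := x) (γ₀ := γ₀) (by simp; linarith)
    (by simp; linarith) (by rw [hγre, ofReal_re]; linarith)
  have hbd : ∀ D : ℝ, (d : ℝ) ≤ D → ∀ γ : ℂ, δ / 2 < γ.re → γ.re < 3 / 4 → |γ.im - s.im| < 1 →
      ‖∑ d ∈ discFamily 1 D, quadraticL d (1 / 2 + x) / quadraticL d (1 / 2 + γ)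
          - ∑ d ∈ discFamily 1 D, ratiosPrediction d x γ‖ ≤ K * D ^ (1 / 2 + ε) := by
    intro D hD γ h2 h3 h4
    have hlog := one_lt_log_of_five_le (hd5.trans hD)
    have hc : δ / 4 / Real.log D ≤ δ / 4 := div_le_self (by linarith) hlog.le
    have hDpow : (d : ℝ) ^ (1 - ε) ≤ D ^ (1 - ε) :=
      Real.rpow_le_rpow (by linarith) hD (by linarith)
    refine hK D (by linarith) x γ ?_ ?_ (by linarith) h3 ?_ ?_ ?_
    · rw [ofReal_re]; linarith
    · rw [ofReal_re]; linarith
    · rw [ofReal_im, abs_zero]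
      nlinarith
    · have : |γ.im| ≤ |γ.im - s.im| + |s.im| := by simpa using abs_add_le (γ.im - s.im) s.im
      nlinarith
    · intro h
      have := congrArg re h
      rw [ofReal_re] at this
      linarith
  set E := K * ((d : ℝ) + 1) ^ (1 / 2 + ε) + K * (d : ℝ) ^ (1 / 2 + ε) with hE
  have hnear : ∀ᶠ γ in 𝓝 γ₀, δ / 2 < γ.re ∧ γ.re < 3 / 4 ∧ |γ.im - s.im| < 1 := by
    have a1 : ∀ᶠ γ : ℂ in 𝓝 γ₀, δ / 2 < γ.re :=
      (isOpen_lt continuous_const continuous_re).mem_nhds (by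
        change δ / 2 < γ₀.re
        rw [hγre]; linarith)
    have a2 : ∀ᶠ γ : ℂ in 𝓝 γ₀, γ.re < 3 / 4 :=
      (isOpen_lt continuous_re continuous_const).mem_nhds (by
        change γ₀.re < 3 / 4
        rw [hγre]; linarith)
    have a3 : ∀ᶠ γ : ℂ in 𝓝 γ₀, |γ.im - s.im| < 1 :=
      (isOpen_lt (by fun_prop) continuous_const).mem_nhds (by
        change |γ₀.im - s.im| < 1
        rw [hγim]; simp)
    exact a1.and (a2.and a3)
  have hle : ∀ᶠ γ in 𝓝[≠] γ₀,
      ‖quadraticL d (1 / 2 + x)‖ ≤ (E + B) * ‖quadraticL d (1 / 2 + γ)‖ := by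
    have ht : Tendsto (fun γ : ℂ => 1 / 2 + γ) (𝓝[≠] γ₀) (𝓝[≠] (1 / 2 + γ₀)) := by
      refine tendsto_nhdsWithin_of_tendsto_nhds_of_eventually_within _ ?_ ?_
      · exact ((by fun_prop : Continuous fun γ : ℂ => 1 / 2 + γ).tendsto γ₀).mono_left
          nhdsWithin_le_nhds
      · filter_upwards [self_mem_nhdsWithin] with γ hγ
        simpa using hγ
    filter_upwards [ht.eventually (eventually_quadraticL_ne_zero hd h1 _),
      nhdsWithin_le_nhds hnear, nhdsWithin_le_nhds hB] with γ hL hγ hP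
    have b1 := hbd d le_rfl γ hγ.1 hγ.2.1 hγ.2.2
    have b2 := hbd (d + 1) (by linarith) γ hγ.1 hγ.2.1 hγ.2.2
    have hnot : d ∉ discFamily 1 (d : ℝ) := fun h => lt_irrefl _ (mem_discFamily.mp h).2.1
    rw [discFamily_succ hd h1, Finset.sum_insert hnot, Finset.sum_insert hnot] at b2
    -- The families below `d` and below `d + 1` differ by `d` alone, because the inequality `d < D`
    -- is strict. The bound `E` may depend on `d`, which is fixed.
    have b3 := norm_sub_le_of_le b2 b1
    have e : ∀ a b u v : ℂ, a + u - (b + v) - (u - v) = a - b := fun a b u v => by ring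
    rw [e, ← hE] at b3
    have b4 : ‖quadraticL d (1 / 2 + x) / quadraticL d (1 / 2 + γ)‖ ≤ E + B := by
      have := norm_le_norm_sub_add (quadraticL d (1 / 2 + x) / quadraticL d (1 / 2 + γ))
        (ratiosPrediction d x γ)
      linarith
    rwa [norm_div, div_le_iff₀ (norm_pos_iff.mpr hL)] at b4
  have hlim : Tendsto (fun γ => (E + B) * ‖quadraticL d (1 / 2 + γ)‖) (𝓝[≠] γ₀) (𝓝 0) := by
    have hc : Continuous fun γ => (E + B) * ‖quadraticL d (1 / 2 + γ)‖ := by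
      have := (differentiable_quadraticL hd h1).continuous
      fun_prop
    have h := hc.tendsto γ₀
    have e : 1 / 2 + γ₀ = s := by rw [hγ₀]; ring
    rw [e, hzero, norm_zero, mul_zero] at h
    exact h.mono_left nhdsWithin_le_nhds
  exact hx (norm_le_zero_iff.mp (ge_of_tendsto hlim hle))

end Murmuration
end

noncomputable section
namespace Murmuration
open Complex Filter Topology
open scoped ArithmeticFunction.vonMangoldt

/-! ### Sums over prime powers -/

lemma mem_primePowerPairs {X : ℝ} {q : ℕ × ℕ} :
    q ∈ primePowerPairs X ↔ q.1.Prime ∧ 1 ≤ q.2 ∧ (q.1 : ℝ) ^ q.2 < X := by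
  simp only [primePowerPairs, Finset.mem_filter, Finset.mem_product, Finset.mem_range,
    and_iff_right_iff_imp]
  rintro ⟨hp, hk, hX⟩
  have hX' : q.1 ^ q.2 < ⌈X⌉₊ := Nat.lt_ceil.mpr (by exact_mod_cast hX)
  exact ⟨(Nat.le_self_pow (by omega) q.1).trans_lt hX',
    (Nat.lt_pow_self hp.one_lt).trans hX'⟩

/-- The map `(p, k) ↦ p^k` is injective, as `minFac` recovers `p`, and `Λ` vanishes off its image.
-/
lemma sum_primePowerPairs (X : ℝ) (f : ℕ → ℝ) :
    ∑ q ∈ primePowerPairs X, f (q.1 ^ q.2) * Real.log q.1 =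
      ∑ n ∈ Finset.range ⌈X⌉₊, Λ n * f n := by
  refine Finset.sum_of_injOn (fun q => q.1 ^ q.2) ?_ ?_ ?_ ?_
  · rintro ⟨p, k⟩ h1 ⟨q, l⟩ h2 h
    obtain ⟨hp, hk, -⟩ := mem_primePowerPairs.mp h1
    obtain ⟨hq, hl, -⟩ := mem_primePowerPairs.mp h2
    simp only at h hp hk hq hl
    have hpq : p = q := by
      have := congrArg Nat.minFac h
      rwa [hp.pow_minFac (by omega), hq.pow_minFac (by omega)] at this
    subst hpq
    rw [Nat.pow_right_injective hp.two_le h]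
  · rintro ⟨p, k⟩ h
    obtain ⟨-, -, hX⟩ := mem_primePowerPairs.mp h
    simp only [Finset.coe_range, Set.mem_Iio]
    exact Nat.lt_ceil.mpr (by exact_mod_cast hX)
  · intro n hn hni
    have : ¬ IsPrimePow n := by
      intro hpp
      obtain ⟨p, k, hp, hk, rfl⟩ := (isPrimePow_nat_iff n).mp hpp
      refine hni ⟨(p, k), mem_primePowerPairs.mpr ⟨hp, hk, ?_⟩, rfl⟩
      exact_mod_cast Nat.lt_ceil.mp (Finset.mem_range.mp hn)
    rw [ArithmeticFunction.vonMangoldt_eq_zero_iff.mpr this, zero_mul]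
  · rintro ⟨p, k⟩ h
    obtain ⟨hp, hk, -⟩ := mem_primePowerPairs.mp h
    simp only at hp hk ⊢
    rw [ArithmeticFunction.vonMangoldt_apply_pow (by omega),
      ArithmeticFunction.vonMangoldt_apply_prime hp, mul_comm]

lemma kroneckerSym_pow_right (d : ℤ) {n : ℕ} (hn : n ≠ 0) (k : ℕ) :
    kroneckerSym d (n ^ k) = kroneckerSym d n ^ k := by
  induction k with
  | zero => simp [kroneckerSym_one_right]
  | succ k ih => rw [pow_succ, kroneckerSym_mul_right d (pow_ne_zero _ hn) hn, ih, pow_succ]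

/-- The sum `∑_{n < X} Λ(n) χ_d(n)`. -/
def twistedPsi (d : ℕ) (X : ℝ) : ℝ :=
  ∑ n ∈ Finset.range ⌈X⌉₊, Λ n * (kroneckerSym d n : ℝ)

/-- The sum `∑ log p` over `p ^ k < X` with `k` even. -/
def evenLogSum (X : ℝ) : ℝ :=
  ∑ q ∈ primePowerPairs X with Even q.2, Real.log q.1

/-- As `χ_d(p) ∈ {0, 1, -1}`, odd powers reproduce `χ_d(p)`, while even powers give `1` unless `p ∣
d`. -/
lemma twistedPsi_eq {d : ℕ} (hd : IsFundamentalDiscriminant d) (h1 : 1 < d) (X : ℝ) :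
    twistedPsi d X =
      ∑ q ∈ primePowerPairs X with Odd q.2, (kroneckerSym d q.1 : ℝ) * Real.log q.1 +
        (evenLogSum X - ∑ q ∈ primePowerPairs X with Even q.2,
          (if q.1 ∣ d then 1 else 0) * Real.log q.1) := by
  rw [twistedPsi, ← sum_primePowerPairs X fun n => (kroneckerSym d n : ℝ),
    ← Finset.sum_filter_add_sum_filter_not (primePowerPairs X) (fun q => Odd q.2), evenLogSum,
    ← Finset.sum_sub_distrib]
  congr 1
  · refine Finset.sum_congr rfl fun q hq => ?_
    obtain ⟨hq1, hodd⟩ := Finset.mem_filter.mp hq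
    obtain ⟨hp, -, -⟩ := mem_primePowerPairs.mp hq1
    rw [kroneckerSym_pow_right _ hp.ne_zero]
    rcases kroneckerSym_trichotomy d q.1 with h | h | h <;> rw [h]
    · rw [zero_pow hodd.pos.ne']
    · simp
    · simp [hodd.neg_one_pow]
  · refine Finset.sum_congr (by simp) fun q hq => ?_
    obtain ⟨hq1, heven⟩ := Finset.mem_filter.mp hq
    obtain ⟨hp, hk, -⟩ := mem_primePowerPairs.mp hq1
    have heven' : Even q.2 := by simpa using heven
    rw [kroneckerSym_pow_right _ hp.ne_zero]
    split_ifs with hdvd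
    · rw [(kroneckerSym_eq_zero_iff hd h1 hp).mpr hdvd, zero_pow (by omega)]
      simp
    · have hne := (kroneckerSym_eq_zero_iff hd h1 hp).not.mpr hdvd
      rcases kroneckerSym_trichotomy d q.1 with h | h | h
      · exact absurd h hne
      · simp [h]
      · simp [h, heven'.neg_one_pow]

lemma oddAverage_eq {D₁ D : ℝ} (hD : 1 ≤ D₁) (hne : (discFamily D₁ D).Nonempty) (X : ℝ) :
    oddAverage D₁ D X = 1 / ((discFamily D₁ D).card : ℝ) * ∑ d ∈ discFamily D₁ D, twistedPsi d X -
      evenLogSum X + evenTerm D₁ D X := by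
  have hc : ((discFamily D₁ D).card : ℝ) ≠ 0 := by exact_mod_cast hne.card_pos.ne'
  have h1 : ∑ d ∈ discFamily D₁ D, twistedPsi d X =
      ∑ d ∈ discFamily D₁ D, ∑ q ∈ primePowerPairs X with Odd q.2,
        (kroneckerSym d q.1 : ℝ) * Real.log q.1 +
      ((discFamily D₁ D).card * evenLogSum X -
        ∑ d ∈ discFamily D₁ D, ∑ q ∈ primePowerPairs X with Even q.2,
          (if q.1 ∣ d then 1 else 0) * Real.log q.1) := by
    rw [Finset.sum_congr rfl fun d hd => twistedPsi_eq (mem_discFamily.mp hd).2.2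
      (one_lt_of_mem_discFamily hD hd) X]
    rw [Finset.sum_add_distrib, Finset.sum_sub_distrib, Finset.sum_const, nsmul_eq_mul]
  have h2 : evenTerm D₁ D X = 1 / ((discFamily D₁ D).card : ℝ) *
      ∑ d ∈ discFamily D₁ D, ∑ q ∈ primePowerPairs X with Even q.2,
          (if q.1 ∣ d then 1 else 0) * Real.log q.1 := by
    rw [Finset.sum_comm, Finset.mul_sum, evenTerm]
    refine Finset.sum_congr rfl fun q _ => ?_
    rw [← Finset.sum_mul, Finset.sum_boole]
    ring
  rw [h1, h2, oddAverage]
  field_simp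
  ring

/-- The coefficients of the Dirichlet series `∑_p (1 - 1 / (p + 1)) log p ∑_k p^{-2ks}`. -/
def evenCoeff (n : ℕ) : ℝ :=
  Λ n * if IsSquare n then 1 - 1 / ((n.minFac : ℝ) + 1) else 0

lemma isSquare_prime_pow_iff {p : ℕ} (hp : p.Prime) {k : ℕ} : IsSquare (p ^ k) ↔ Even k := by
  refine ⟨fun ⟨m, hm⟩ => ?_, fun h => h.isSquare_pow p⟩
  have h := congrArg (fun n => n.factorization p) hm
  have hm0 : m ≠ 0 := by
    rintro rfl
    simp [hp.ne_zero] at hm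
  simp only [hp.factorization_pow, Finsupp.single_eq_same, Nat.factorization_mul hm0 hm0,
    Finsupp.coe_add, Pi.add_apply] at h
  exact ⟨_, h⟩

lemma sum_evenCoeff (X : ℝ) : ∑ n ∈ Finset.range ⌈X⌉₊, evenCoeff n =
    evenLogSum X - ∑ q ∈ primePowerPairs X with Even q.2, Real.log q.1 / ((q.1 : ℝ) + 1) := by
  simp only [evenCoeff]
  rw [← sum_primePowerPairs X fun n => if IsSquare n then 1 - 1 / ((n.minFac : ℝ) + 1) else 0,
    evenLogSum, ← Finset.sum_sub_distrib, Finset.sum_filter]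
  refine Finset.sum_congr rfl fun q hq => ?_
  obtain ⟨hp, hk, -⟩ := mem_primePowerPairs.mp hq
  simp only [isSquare_prime_pow_iff hp, hp.pow_minFac (by omega : q.2 ≠ 0)]
  split_ifs
  · ring
  · ring

lemma abs_evenCoeff_le (n : ℕ) : |evenCoeff n| ≤ Λ n := by
  have h := ArithmeticFunction.vonMangoldt_nonneg (n := n)
  have h1 : 0 ≤ 1 / ((n.minFac : ℝ) + 1) := by positivity
  have h2 : 1 / ((n.minFac : ℝ) + 1) ≤ 1 := by
    rw [div_le_one (by positivity)]
    linarith [(Nat.cast_nonneg n.minFac : (0 : ℝ) ≤ n.minFac)]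
  rw [evenCoeff, abs_mul, abs_of_nonneg h]
  refine mul_le_of_le_one_right h ?_
  split_ifs
  · rw [abs_le]; constructor <;> linarith
  · simp

/-- There are `O(log X)` exponents `k`, and for each the sum over `p` is at most `log X` times a
harmonic sum. This is the cost of the weight `1 - 1/(p+1)` in `evenCoeff`; a cube of a logarithm
disappears into `X^ε`. -/
lemma sum_even_log_div_le {X : ℝ} (hX : 2 < X) :
    ∑ q ∈ primePowerPairs X with Even q.2, Real.log q.1 / ((q.1 : ℝ) + 1) ≤
      13 * Real.log X ^ 3 := by
  have hl2 := Real.log_two_gt_d9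
  have hlX : Real.log 2 ≤ Real.log X := Real.log_le_log (by norm_num) hX.le
  have hL0 : 0 ≤ Real.log X := by linarith
  have hsub : (primePowerPairs X).filter (fun q => Even q.2) ⊆
      Finset.range ⌈X⌉₊ ×ˢ Finset.range (⌊2 * Real.log X⌋₊ + 1) := by
    intro q hq
    obtain ⟨hp, hk, hqX⟩ := mem_primePowerPairs.mp (Finset.mem_filter.mp hq).1
    have hp2 : (2 : ℝ) ≤ q.1 := by exact_mod_cast hp.two_le
    rw [Finset.mem_product, Finset.mem_range, Finset.mem_range]
    constructor
    · have : q.1 ^ q.2 < ⌈X⌉₊ := Nat.lt_ceil.mpr (by exact_mod_cast hqX)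
      exact (Nat.le_self_pow (by omega) q.1).trans_lt this
    · refine Nat.lt_succ_of_le (Nat.le_floor ?_)
      have h1 : (q.2 : ℝ) * Real.log q.1 ≤ Real.log X := by
        rw [← Real.log_pow]
        exact Real.log_le_log (by positivity) hqX.le
      have h2 : Real.log 2 ≤ Real.log q.1 := Real.log_le_log (by norm_num) hp2
      have h3 : (0 : ℝ) ≤ q.2 := Nat.cast_nonneg _
      nlinarith
  have hterm : ∀ q ∈ (primePowerPairs X).filter (fun q => Even q.2),
      Real.log q.1 / ((q.1 : ℝ) + 1) ≤ Real.log X * ((q.1 : ℝ) + 1)⁻¹ := by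
    intro q hq
    obtain ⟨hp, hk, hqX⟩ := mem_primePowerPairs.mp (Finset.mem_filter.mp hq).1
    have hp0 : (0 : ℝ) < q.1 := by exact_mod_cast hp.pos
    rw [div_eq_mul_inv]
    gcongr
    have : (q.1 : ℝ) ≤ (q.1 : ℝ) ^ q.2 := by
      exact_mod_cast Nat.le_self_pow (by omega) q.1
    linarith
  refine (Finset.sum_le_sum hterm).trans ?_
  refine (Finset.sum_le_sum_of_subset_of_nonneg hsub fun q _ _ => by positivity).trans ?_
  rw [Finset.sum_product]
  simp only [Finset.sum_const, Finset.card_range, nsmul_eq_mul]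
  rw [← Finset.mul_sum, ← Finset.mul_sum]
  have hharm : ∑ i ∈ Finset.range ⌈X⌉₊, ((i : ℝ) + 1)⁻¹ ≤ 1 + Real.log ⌈X⌉₊ := by
    have := harmonic_le_one_add_log ⌈X⌉₊
    simpa [harmonic] using this
  have hceil : Real.log ⌈X⌉₊ ≤ Real.log 2 + Real.log X := by
    rw [← Real.log_mul (by norm_num) (by linarith)]
    refine Real.log_le_log ?_ ?_
    · exact_mod_cast Nat.ceil_pos.mpr (by linarith)
    · linarith [Nat.ceil_lt_add_one (by linarith : 0 ≤ X)]
  have hk : ((⌊2 * Real.log X⌋₊ + 1 : ℕ) : ℝ) ≤ 7 / 2 * Real.log X := by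
    push_cast
    linarith [Nat.floor_le (by linarith : 0 ≤ 2 * Real.log X)]
  have hS : ∑ i ∈ Finset.range ⌈X⌉₊, ((i : ℝ) + 1)⁻¹ ≤ 7 / 2 * Real.log X := by linarith
  calc _ ≤ 7 / 2 * Real.log X * (Real.log X * (7 / 2 * Real.log X)) := by
        gcongr
    _ = 49 / 4 * Real.log X ^ 3 := by ring
    _ ≤ _ := by
        have : 0 ≤ Real.log X ^ 3 := pow_nonneg (by linarith) 3
        linarith

/-- The coefficients `Λ(n) / (p + 1)`, where `n` is a power of `p`. -/
def reducedCoeff (n : ℕ) : ℂ := ((Λ n / ((n.minFac : ℝ) + 1) : ℝ) : ℂ)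

lemma LSeriesSummable_reducedCoeff {w : ℂ} (hw : 1 < w.re) : LSeriesSummable reducedCoeff w := by
  refine (ArithmeticFunction.LSeriesSummable_vonMangoldt hw).norm.of_norm_bounded fun n => ?_
  refine LSeries.norm_term_le w ?_
  have h := ArithmeticFunction.vonMangoldt_nonneg (n := n)
  rw [reducedCoeff, norm_real, norm_real, Real.norm_of_nonneg (by positivity), Real.norm_of_nonneg h]
  refine div_le_self h ?_
  linarith [(Nat.cast_nonneg n.minFac : (0 : ℝ) ≤ n.minFac)]

/-- Prime powers are indexed by `(p, k)` through `p^{k+1}`, and each prime contributes a geometric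
series in `p^{-w}`. -/
lemma LSeries_reducedCoeff {w : ℂ} (hw : 1 < w.re) : LSeries reducedCoeff w =
    ∑' p : Nat.Primes, (Real.log (p : ℕ) : ℂ) /
      ((((p : ℕ) : ℂ) + 1) * (((p : ℕ) : ℂ) ^ w - 1)) := by
  have hsupp : Function.support (LSeries.term reducedCoeff w) ⊆ {n : ℕ | IsPrimePow n} := by
    intro n hn
    by_contra h
    apply hn
    rcases eq_or_ne n 0 with rfl | hn0
    · simp
    · rw [LSeries.term_of_ne_zero hn0, reducedCoeff,
        ArithmeticFunction.vonMangoldt_eq_zero_iff.mpr h]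
      simp
  have hsum := LSeriesSummable_reducedCoeff hw
  have hsum' : Summable fun q : Nat.Primes × ℕ =>
      LSeries.term reducedCoeff w (Nat.Primes.prodNatEquiv q : ℕ) :=
    hsum.comp_injective (Subtype.val_injective.comp Nat.Primes.prodNatEquiv.injective)
  have hpp : LSeries reducedCoeff w =
      ∑' x : {n : ℕ // IsPrimePow n}, LSeries.term reducedCoeff w x :=
    (tsum_subtype_eq_of_support_subset hsupp).symm
  have hequiv := Nat.Primes.prodNatEquiv.tsum_eq
    fun x : {n : ℕ // IsPrimePow n} => LSeries.term reducedCoeff w x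
  rw [hpp, ← hequiv, hsum'.tsum_prod]
  refine tsum_congr fun P => ?_
  have hval : ∀ k : ℕ, ((Nat.Primes.prodNatEquiv (P, k) : {n : ℕ // IsPrimePow n}) : ℕ) =
      (P : ℕ) ^ (k + 1) := fun k => by rw [Nat.Primes.prodNatEquiv_apply]
  simp_rw [hval]
  have hp : (P : ℕ).Prime := P.prop
  generalize (P : ℕ) = p at hp
  have hp0 : (p : ℂ) ≠ 0 := by exact_mod_cast hp.ne_zero
  have hp1 : (p : ℂ) + 1 ≠ 0 := by exact_mod_cast Nat.succ_ne_zero p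
  have hnorm : ‖(p : ℂ) ^ (-w)‖ < 1 := by
    rw [norm_natCast_cpow_of_pos hp.pos]
    exact Real.rpow_lt_one_of_one_lt_of_neg (by exact_mod_cast hp.one_lt) (by rw [neg_re]; linarith)
  have hterm : ∀ k : ℕ, LSeries.term reducedCoeff w (p ^ (k + 1)) =
      (Real.log p : ℂ) / ((p : ℂ) + 1) * (p : ℂ) ^ (-w) * ((p : ℂ) ^ (-w)) ^ k := by
    intro k
    rw [LSeries.term_of_ne_zero (pow_ne_zero _ hp.ne_zero), reducedCoeff,
      ArithmeticFunction.vonMangoldt_apply_pow (by omega),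
      ArithmeticFunction.vonMangoldt_apply_prime hp, hp.pow_minFac (by omega)]
    have e : (((p ^ (k + 1) : ℕ)) : ℂ) ^ w = ((p : ℂ) ^ w) ^ (k + 1) := by
      rw [Nat.cast_pow, ← natCast_cpow_natCast_mul, mul_comm, cpow_mul_nat]
    rw [e, cpow_neg, mul_assoc, ← pow_succ', inv_pow]
    push_cast
    rw [div_eq_mul_inv _ (((p : ℂ) ^ w) ^ (k + 1))]
  simp_rw [hterm]
  rw [tsum_mul_left, tsum_geometric_of_norm_lt_one hnorm, cpow_neg]
  have hw0 : (p : ℂ) ^ w ≠ 0 := by simp [cpow_eq_zero_iff, hp0]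
  have hden : (p : ℂ) ^ w - 1 ≠ 0 := by
    intro h
    rw [cpow_neg, sub_eq_zero.mp h] at hnorm
    simp at hnorm
  have hden' : 1 - ((p : ℂ) ^ w)⁻¹ ≠ 0 := by
    intro h
    apply hden
    field_simp at h
    linear_combination h
  field_simp

lemma term_evenCoeff_sq (s : ℂ) (n : ℕ) :
    LSeries.term (fun n => (evenCoeff n : ℂ)) s (n ^ 2) =
      LSeries.term (fun n => (Λ n : ℂ)) (2 * s) n - LSeries.term reducedCoeff (2 * s) n := by
  rcases eq_or_ne n 0 with rfl | hn
  · simp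
  have e : (((n ^ 2 : ℕ)) : ℂ) ^ s = (n : ℂ) ^ (2 * s) := by
    rw [Nat.cast_pow, ← natCast_cpow_natCast_mul]
    norm_num
  rw [LSeries.term_of_ne_zero (pow_ne_zero 2 hn), LSeries.term_of_ne_zero hn,
    LSeries.term_of_ne_zero hn, e, evenCoeff, reducedCoeff,
    ArithmeticFunction.vonMangoldt_apply_pow (by norm_num), if_pos (by exact ⟨n, sq n⟩),
    Nat.pow_minFac (by norm_num)]
  push_cast
  ring

/-- The coefficients live on squares, and the term at `n²` and `s` is the difference of two von
Mangoldt-type terms at `n` and `2s`. Hence convergence already holds for `Re s > 1/2`. The sum is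
minus the diagonal prediction at `r = s - 1/2`. -/
lemma hasSum_term_evenCoeff {s : ℂ} (hs : 1 / 2 < s.re) :
    HasSum (LSeries.term (fun n => (evenCoeff n : ℂ)) s)
      (-(deriv riemannZeta (2 * s) / riemannZeta (2 * s) +
        ∑' p : Nat.Primes, (Real.log (p : ℕ) : ℂ) /
          ((((p : ℕ) : ℂ) + 1) * (((p : ℕ) : ℂ) ^ (2 * s) - 1)))) := by
  have hw : 1 < (2 * s).re := by simp; linarith
  have h1 : HasSum (LSeries.term (fun n => (Λ n : ℂ)) (2 * s))
      (-deriv riemannZeta (2 * s) / riemannZeta (2 * s)) := by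
    rw [← ArithmeticFunction.LSeries_vonMangoldt_eq_deriv_riemannZeta_div hw]
    exact (ArithmeticFunction.LSeriesSummable_vonMangoldt hw).hasSum
  have h2 := (LSeriesSummable_reducedCoeff hw).hasSum
  rw [← LSeries, LSeries_reducedCoeff hw] at h2
  have h3 := h1.sub h2
  simp_rw [← term_evenCoeff_sq] at h3
  have hinj : Function.Injective fun n : ℕ => n ^ 2 := Nat.pow_left_injective (by norm_num)
  have h4 := (hinj.hasSum_iff (f := LSeries.term (fun n => (evenCoeff n : ℂ)) s) ?_).mp h3
  · convert h4 using 1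
    ring
  · intro m hm
    rcases eq_or_ne m 0 with rfl | hm0
    · simp
    rw [LSeries.term_of_ne_zero hm0, evenCoeff, if_neg]
    · simp
    · rintro ⟨n, hn⟩
      exact hm ⟨n, by simp [hn, sq]⟩

end Murmuration
end

noncomputable section
namespace Murmuration
open Complex MeasureTheory Filter Topology
open scoped ArithmeticFunction.vonMangoldt

/-! ### The explicit formula -/

lemma verticalIntegral_congr {f g : ℂ → ℂ} {σ T : ℝ} (hT : 0 ≤ T)
    (h : ∀ t ∈ Set.Icc (-T) T, f (σ + t * I) = g (σ + t * I)) :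
    verticalIntegral f σ T = verticalIntegral g σ T := by
  simp only [verticalIntegral]
  congr 1
  refine intervalIntegral.integral_congr fun t ht => ?_
  rw [Set.uIcc_of_le (by linarith)] at ht
  exact h t ht

/-- The constant `∑ Λ(n) n^{-σ}`. -/
def mangoldtSum (σ : ℝ) : ℝ := ∑' n, ‖LSeries.term (fun n => (Λ n : ℂ)) (σ : ℂ) n‖

lemma norm_cpow_div_le {X : ℝ} (hX : 1 ≤ X) {c τ : ℝ} (hτ : τ ≠ 0) {x : ℝ} (hx : x ≤ c) :
    ‖(X : ℂ) ^ ((x : ℂ) + τ * I) / ((x : ℂ) + τ * I)‖ ≤ X ^ c / |τ| := by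
  have hτ' : 0 < |τ| := abs_pos.mpr hτ
  rw [norm_div, norm_cpow_eq_rpow_re_of_pos (by linarith)]
  gcongr
  · simpa using hx
  · exact abs_im_le_norm_add x τ

lemma mem_rect_iff {a b T : ℝ} {s : ℂ} :
    s ∈ Set.Icc a b ×ℂ Set.Icc (-T) T ↔ (a ≤ s.re ∧ s.re ≤ b) ∧ |s.im| ≤ T := by
  rw [mem_reProdIm, Set.mem_Icc, Set.mem_Icc, abs_le]

/-- Perron's formula on `Re s = 1 + ε`, followed by a shift to `1/2 + ε` that meets no pole by
`hzero`. The last summand of the bound comes from the horizontal sides, where the zeros must stay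
away up to height `T + 2` for the estimate of `L'/L`. -/
lemma norm_twistedPsi_sub_verticalIntegral_le {ε : ℝ} (hε : 0 < ε) (hε' : ε < 1 / 4) {d : ℕ}
    (hd : IsFundamentalDiscriminant d) (h1 : 1 < d) {T X : ℝ} (hT : 2 < T) (hTX : T < X)
    (hXZ : ∀ n : ℤ, X ≠ n)
    (hzero : ∀ z : ℂ, 1 / 2 + ε / 2 < z.re → |z.im| ≤ T + 2 → quadraticL d z ≠ 0) :
    ‖2 * Real.pi * I * (twistedPsi d X : ℂ) - verticalIntegral
        (fun s => -(deriv (quadraticL d) s / quadraticL d s) * ((X : ℂ) ^ s / s)) (1 / 2 + ε) T‖ ≤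
      8 * X ^ (1 + ε) / T * mangoldtSum (1 + ε) + 1360 * Real.log X ^ 2 * (X / T) +
        X ^ (1 + ε) / T * (48 / ε ^ 2 * Real.log (16 * d * (T + 6))) := by
  have hX : 0 < X := by linarith
  have hT0 : 0 < T := by linarith
  have : NeZero d := ⟨by omega⟩
  obtain ⟨χ, hχ1, hχ⟩ := exists_dirichletCharacter_eq_kroneckerSym hd h1
  have hL := quadraticL_eq_LFunction hχ
  have hdiff := differentiable_quadraticL hd h1
  set f : ℂ → ℂ := fun s => -(deriv (quadraticL d) s / quadraticL d s) * ((X : ℂ) ^ s / s) with hf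
  set a : ℕ → ℂ := (fun n : ℕ => χ (n : ZMod d)) * (fun n : ℕ => (Λ n : ℂ)) with ha
  have hane : ∀ n, ‖a n‖ ≤ Λ n := by
    intro n
    rw [ha, Pi.mul_apply, norm_mul, norm_real,
      Real.norm_of_nonneg ArithmeticFunction.vonMangoldt_nonneg]
    exact mul_le_of_le_one_left ArithmeticFunction.vonMangoldt_nonneg (χ.norm_le_one _)
  have hc1 : 1 < (((1 + ε : ℝ) : ℂ)).re := by rw [ofReal_re]; linarith
  have hsumm : LSeriesSummable a ((1 + ε : ℝ) : ℂ) :=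
    DirichletCharacter.LSeriesSummable_twist_vonMangoldt χ hc1
  have hperron := norm_perron_le hane (σ := 1 + ε) (by linarith) (by linarith) hsumm hT hTX hXZ
  have hsumle : ∑' n, ‖LSeries.term a ((1 + ε : ℝ) : ℂ) n‖ ≤ mangoldtSum (1 + ε) := by
    refine hsumm.norm.tsum_le_tsum (fun n => LSeries.norm_term_le _ ?_)
      (ArithmeticFunction.LSeriesSummable_vonMangoldt hc1).norm
    rw [norm_real, Real.norm_of_nonneg ArithmeticFunction.vonMangoldt_nonneg]
    exact hane n
  have hpsi : ∑ n ∈ Finset.range ⌈X⌉₊, a n = (twistedPsi d X : ℂ) := by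
    rw [twistedPsi]
    push_cast
    refine Finset.sum_congr rfl fun n _ => ?_
    rw [ha, Pi.mul_apply, hχ, mul_comm]
  have hline : verticalIntegral (fun s => LSeries a s * ((X : ℂ) ^ s / s)) (1 + ε) T =
      verticalIntegral f (1 + ε) T := by
    refine verticalIntegral_congr hT0.le fun t _ => ?_
    have hre : 1 < (((1 + ε : ℝ) : ℂ) + t * I).re := by simp; linarith
    simp only [hf]
    rw [ha, DirichletCharacter.LSeries_twist_vonMangoldt_eq χ hre, hL,
      DirichletCharacter.deriv_LFunction_eq_deriv_LSeries χ hre,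
      DirichletCharacter.LFunction_eq_LSeries χ hre, neg_div]
  have hshift := verticalIntegral_sub (f := f) (a := 1 / 2 + ε) (b := 1 + ε) (T := T)
    (by linarith) hT0.le ?_
  · have hhor : ∀ τ : ℝ, |τ| = T → ‖∫ x in (1 / 2 + ε)..(1 + ε), f ((x : ℂ) + τ * I)‖ ≤
        48 / ε ^ 2 * Real.log (16 * d * (T + 6)) * (X ^ (1 + ε) / T) * (1 / 2) := by
      intro τ hτ
      have hτ0 : τ ≠ 0 := by
        rintro rfl
        rw [abs_zero] at hτ
        linarith
      have := intervalIntegral.norm_integral_le_of_norm_le_const (a := 1 / 2 + ε) (b := 1 + ε)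
        (f := fun x : ℝ => f ((x : ℂ) + τ * I))
        (C := 48 / ε ^ 2 * Real.log (16 * d * (T + 6)) * (X ^ (1 + ε) / T)) fun x hx => ?_
      · rwa [show |1 + ε - (1 / 2 + ε)| = 1 / 2 by
          rw [show 1 + ε - (1 / 2 + ε) = 1 / 2 by ring]; norm_num] at this
      · rw [Set.uIoc_of_le (by linarith)] at hx
        have hld := norm_logDeriv_LFunction_le hχ1 hε hε' (τ := τ)
          (fun z hz1 hz2 => by rw [← hL]; exact hzero z hz1 (by rwa [hτ] at hz2))
          (σ := x) hx.1.le (by linarith [hx.2])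
        rw [← hL, hτ] at hld
        have hcp := norm_cpow_div_le (by linarith : 1 ≤ X) hτ0 hx.2
        rw [hτ] at hcp
        simp only [hf]
        rw [norm_mul, norm_neg]
        gcongr
        exact (norm_nonneg _).trans hld
    have hh1 := hhor T (abs_of_pos hT0)
    have hh2 := hhor (-T) (by rw [abs_neg, abs_of_pos hT0])
    rw [hline, hpsi] at hperron
    have hdecomp : 2 * Real.pi * I * (twistedPsi d X : ℂ) - verticalIntegral f (1 / 2 + ε) T =
        -(verticalIntegral f (1 + ε) T - 2 * Real.pi * I * (twistedPsi d X : ℂ)) +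
        ((∫ x in (1 / 2 + ε)..(1 + ε), f ((x : ℂ) + T * I)) -
          ∫ x in (1 / 2 + ε)..(1 + ε), f ((x : ℂ) + ((-T : ℝ) : ℂ) * I)) := by
      linear_combination hshift
    rw [hdecomp]
    refine (norm_add_le _ _).trans ?_
    rw [norm_neg]
    have hP : 8 * X ^ (1 + ε) / T * ∑' n, ‖LSeries.term a ((1 + ε : ℝ) : ℂ) n‖ ≤
        8 * X ^ (1 + ε) / T * mangoldtSum (1 + ε) := by gcongr
    have hsub := norm_sub_le (∫ x in (1 / 2 + ε)..(1 + ε), f ((x : ℂ) + T * I))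
      (∫ x in (1 / 2 + ε)..(1 + ε), f ((x : ℂ) + ((-T : ℝ) : ℂ) * I))
    linarith
  · intro s hs
    rw [mem_rect_iff] at hs
    have hs0 : s ≠ 0 := ne_zero_of_re_pos (by linarith [hs.1.1])
    have hLs : quadraticL d s ≠ 0 := hzero s (by linarith [hs.1.1]) (by linarith [hs.2])
    have hX0 : (X : ℂ) ≠ 0 := by exact_mod_cast hX.ne'
    have hd1 : DifferentiableAt ℂ (deriv (quadraticL d)) s :=
      hdiff.analyticAt s |>.deriv.differentiableAt
    have hd2 : DifferentiableAt ℂ (fun s : ℂ => (X : ℂ) ^ s) s :=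
      differentiableAt_id.const_cpow (Or.inl hX0)
    exact ((hd1.div (hdiff s) hLs).neg.mul (hd2.div differentiableAt_id hs0)).differentiableWithinAt

lemma LSeriesSummable_evenCoeff {s : ℂ} (hs : 1 / 2 < s.re) :
    LSeriesSummable (fun n => (evenCoeff n : ℂ)) s := (hasSum_term_evenCoeff hs).summable

/-- This series converges absolutely on `Re s = 1/2 + ε`, so Perron applies there directly, without
a shift. -/
lemma norm_sum_evenCoeff_sub_verticalIntegral_le {ε : ℝ} (hε : 0 < ε) (hε' : ε < 1 / 4) {T X : ℝ}
    (hT : 2 < T) (hTX : T < X) (hXZ : ∀ n : ℤ, X ≠ n) :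
    ‖verticalIntegral (fun s => LSeries (fun n => (evenCoeff n : ℂ)) s * ((X : ℂ) ^ s / s))
        (1 / 2 + ε) T - 2 * Real.pi * I * ∑ n ∈ Finset.range ⌈X⌉₊, (evenCoeff n : ℂ)‖ ≤
      8 * X ^ (1 / 2 + ε) / T *
        ∑' n, ‖LSeries.term (fun n => (evenCoeff n : ℂ)) ((1 / 2 + ε : ℝ) : ℂ) n‖ +
        1360 * Real.log X ^ 2 * (X / T) := by
  refine norm_perron_le (fun n => ?_) (by linarith) (by linarith)
    (LSeriesSummable_evenCoeff (by rw [ofReal_re]; linarith)) hT hTX hXZ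
  rw [norm_real]
  exact abs_evenCoeff_le n

/-! ### The prediction on the critical segment -/

/-- Both ends of a family are strict, so the members to remove satisfy `d ≤ D₁`, that is `d < ⌊D₁⌋ +
1`. Nonemptiness ensures that these all lie below `D`. -/
lemma sum_discFamily_eq_sub {D₁ D : ℝ} (hD₁ : 1 < D₁) (hne : (discFamily D₁ D).Nonempty)
    (g : ℕ → ℂ) : ∑ d ∈ discFamily D₁ D, g d =
      ∑ d ∈ discFamily 1 D, g d - ∑ d ∈ discFamily 1 ((⌊D₁⌋₊ : ℝ) + 1), g d := by
  have hsub : discFamily 1 ((⌊D₁⌋₊ : ℝ) + 1) ⊆ discFamily 1 D := by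
    obtain ⟨e, he⟩ := hne
    obtain ⟨he1, he2, -⟩ := mem_discFamily.mp he
    intro d hd
    obtain ⟨hd1, hd2, hd3⟩ := mem_discFamily.mp hd
    refine mem_discFamily.mpr ⟨hd1, ?_, hd3⟩
    have h2 : d < ⌊D₁⌋₊ + 1 := by exact_mod_cast hd2
    have h3 : (d : ℝ) ≤ D₁ := (Nat.le_floor_iff (by linarith)).mp (Nat.lt_succ_iff.mp h2)
    linarith
  rw [← Finset.sum_sdiff hsub, add_sub_cancel_right]
  refine Finset.sum_congr ?_ fun _ _ => rfl
  ext d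
  simp only [Finset.mem_sdiff, mem_discFamily, not_and]
  have hiff : (d : ℝ) < (⌊D₁⌋₊ : ℝ) + 1 ↔ (d : ℝ) ≤ D₁ := by
    rw [← Nat.le_floor_iff (by linarith), ← Nat.lt_succ_iff]
    exact_mod_cast Iff.rfl
  rw [hiff]
  constructor
  · rintro ⟨h1, h2, h3⟩
    exact ⟨⟨by linarith, h2, h3⟩, fun _ h => absurd h (by linarith)⟩
  · rintro ⟨⟨h1, h2, h3⟩, h4⟩
    refine ⟨?_, h2, h3⟩
    by_contra h
    exact h4 h1 (not_lt.mp h) h3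

lemma sum_logDeriv_eq {D : ℝ} {r : ℂ} (hr : 0 < r.re) :
    ∑ d ∈ discFamily 1 D, deriv (quadraticL d) (1 / 2 + r) / quadraticL d (1 / 2 + r) =
      ratiosRemainder D r + ∑ d ∈ discFamily 1 D,
        (-LSeries (fun n => (evenCoeff n : ℂ)) (1 / 2 + r) - dualTerm d r r) := by
  have h := hasSum_term_evenCoeff (s := 1 / 2 + r) (by simpa using hr)
  have e : 2 * (1 / 2 + r) = 1 + 2 * r := by ring
  rw [e] at h
  rw [LSeries, h.tsum_eq, neg_neg, ratiosRemainder]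
  simp only [dualTerm]
  ring

lemma sum_logDeriv_discFamily_eq {D₁ D : ℝ} (hD₁ : 1 < D₁) (hne : (discFamily D₁ D).Nonempty)
    {r : ℂ} (hr : 0 < r.re) :
    ∑ d ∈ discFamily D₁ D, deriv (quadraticL d) (1 / 2 + r) / quadraticL d (1 / 2 + r) =
      ratiosRemainder D r - ratiosRemainder ((⌊D₁⌋₊ : ℝ) + 1) r -
        ((discFamily D₁ D).card * LSeries (fun n => (evenCoeff n : ℂ)) (1 / 2 + r) +
          ∑ d ∈ discFamily D₁ D, dualTerm d r r) := by
  have h1 := sum_discFamily_eq_sub hD₁ hne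
    fun d => deriv (quadraticL d) (1 / 2 + r) / quadraticL d (1 / 2 + r)
  have h2 := sum_discFamily_eq_sub hD₁ hne
    fun d => -LSeries (fun n => (evenCoeff n : ℂ)) (1 / 2 + r) - dualTerm d r r
  rw [h1, sum_logDeriv_eq hr, sum_logDeriv_eq hr]
  have h3 : ∑ d ∈ discFamily D₁ D,
      (-LSeries (fun n => (evenCoeff n : ℂ)) (1 / 2 + r) - dualTerm d r r) =
      -((discFamily D₁ D).card * LSeries (fun n => (evenCoeff n : ℂ)) (1 / 2 + r) +
          ∑ d ∈ discFamily D₁ D, dualTerm d r r) := by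
    rw [Finset.sum_sub_distrib, Finset.sum_const, nsmul_eq_mul]
    ring
  linear_combination h3 - h2

lemma cpow_half_mul_cpow_eq {X : ℝ} (hX : 0 < X) {d : ℕ} (hd : d ≠ 0) (r : ℂ) :
    (((d : ℝ) / Real.pi : ℝ) : ℂ) ^ (-r) * (X : ℂ) ^ (1 / 2 + r) =
      ((X ^ (1 / 2 : ℝ) : ℝ) : ℂ) * ((Real.pi * X / (d : ℝ) : ℝ) : ℂ) ^ r := by
  have hd' : (0 : ℝ) < d := by positivity
  have hpi := Real.pi_pos
  have hX0 : (X : ℂ) ≠ 0 := by exact_mod_cast hX.ne'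
  rw [cpow_add _ _ hX0, show Real.pi * X / (d : ℝ) = ((d : ℝ) / Real.pi)⁻¹ * X by
    rw [inv_div]; ring, ofReal_mul, mul_cpow_ofReal_nonneg (by positivity) hX.le,
    ofReal_cpow hX.le, cpow_neg, ofReal_inv, inv_cpow]
  · push_cast
    ring
  · rw [arg_ofReal_of_nonneg (by positivity)]
    exact hpi.ne

/-- Substitute `s = 1/2 + r`, use `A(-r; r) = ζ(2)/ζ(2 - 2r)`, and combine `(d/π)^{-r}` with
`X^{1/2+r}`. -/
lemma average_dualTerm_eq {D₁ D X : ℝ} (hD₁ : 1 ≤ D₁) (hX : 0 < X) {r : ℂ} (hr : 0 < r.re)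
    (hr' : r.re < 1 / 4) :
    1 / ((discFamily D₁ D).card : ℂ) * (∑ d ∈ discFamily D₁ D, dualTerm d r r) *
        ((X : ℂ) ^ (1 / 2 + r) / (1 / 2 + r)) =
      ((X ^ (1 / 2 : ℝ) : ℝ) : ℂ) * murmurationIntegrand D₁ D X (1 / 2 + r) := by
  rw [murmurationIntegrand, show (1 - (1 / 2 + r)) / 2 = 1 / 4 - r / 2 by ring,
    show (1 / 2 + r) / 2 = 1 / 4 + r / 2 by ring, show 2 - 2 * (1 / 2 + r) = 1 - 2 * r by ring,
    show 3 - 2 * (1 / 2 + r) = 2 - 2 * r by ring, show 1 / 2 + r - 1 / 2 = r by ring]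
  have h : (∑ d ∈ discFamily D₁ D, dualTerm d r r) * (X : ℂ) ^ (1 / 2 + r) =
      Gamma (1 / 4 - r / 2) / Gamma (1 / 4 + r / 2) * riemannZeta (1 - 2 * r) *
        ((Real.pi : ℂ) ^ 2 / 6 / riemannZeta (2 - 2 * r)) * (((X ^ (1 / 2 : ℝ) : ℝ) : ℂ) *
        ∑ d ∈ discFamily D₁ D, ((Real.pi * X / (d : ℝ) : ℝ) : ℂ) ^ r) := by
    rw [Finset.sum_mul, Finset.mul_sum, Finset.mul_sum]
    refine Finset.sum_congr rfl fun d hd => ?_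
    have hd1 := one_lt_of_mem_discFamily hD₁ hd
    rw [← cpow_half_mul_cpow_eq hX (by omega : d ≠ 0), dualTerm, dualFactor,
      ratiosA_neg_self hr.le hr'.le]
    ring
  rw [mul_div_assoc', mul_assoc, h]
  ring

/-! ### Integrability on the segment -/

lemma continuousOn_segment {f : ℂ → ℂ} {σ T : ℝ}
    (h : ∀ t ∈ Set.Icc (-T) T, ContinuousAt f (σ + t * I)) (hT : 0 ≤ T) :
    IntervalIntegrable (fun t : ℝ => f (σ + t * I)) volume (-T) T := by
  refine ContinuousOn.intervalIntegrable fun t ht => ?_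
  rw [Set.uIcc_of_le (by linarith)] at ht
  exact (ContinuousAt.comp (f := fun t : ℝ => (σ + t * I : ℂ)) (h t ht)
    (by fun_prop)).continuousWithinAt

lemma continuousAt_cpow_div {X : ℝ} (hX : 0 < X) {s : ℂ} (hs : 0 < s.re) :
    ContinuousAt (fun s : ℂ => (X : ℂ) ^ s / s) s := by
  have hX0 : (X : ℂ) ≠ 0 := by exact_mod_cast hX.ne'
  have hd : DifferentiableAt ℂ (fun s : ℂ => (X : ℂ) ^ s) s :=
    differentiableAt_id.const_cpow (Or.inl hX0)
  exact hd.continuousAt.div continuousAt_id (ne_zero_of_re_pos hs)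

lemma continuousAt_LSeries_evenCoeff {s : ℂ} (hs : 1 / 2 < s.re) :
    ContinuousAt (LSeries fun n => (evenCoeff n : ℂ)) s := by
  have h : LSeries.abscissaOfAbsConv (fun n => (evenCoeff n : ℂ)) < s.re := by
    have h1 := (LSeriesSummable_evenCoeff (s := (((1 / 2 + s.re) / 2 : ℝ) : ℂ))
      (by rw [ofReal_re]; linarith)).abscissaOfAbsConv_le
    refine h1.trans_lt ?_
    rw [ofReal_re]
    exact_mod_cast (by linarith : (1 / 2 + s.re) / 2 < s.re)
  exact (LSeries_hasDerivAt h).continuousAt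

lemma continuousAt_murmurationIntegrand {D₁ D X : ℝ} (hD₁ : 1 ≤ D₁) (hX : 0 < X) {s : ℂ}
    (hs : 1 / 2 < s.re) (hs' : s.re < 3 / 4) :
    ContinuousAt (murmurationIntegrand D₁ D X) s := by
  have hG : ∀ z : ℂ, 0 < z.re → ∀ m : ℕ, z ≠ -m := by
    intro z hz m h
    rw [h] at hz
    simp at hz
    linarith [(Nat.cast_nonneg m : (0 : ℝ) ≤ m)]
  have hre1 : 0 < ((1 - s) / 2).re := by simp; linarith
  have hre2 : 0 < (s / 2).re := by simp; linarith
  have hre3 : 1 < (3 - 2 * s).re := by simp; linarith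
  have c1 : ContinuousAt (fun s : ℂ => Gamma ((1 - s) / 2)) s :=
    ContinuousAt.comp (f := fun s : ℂ => (1 - s) / 2) (g := Gamma)
      (differentiableAt_Gamma _ (hG _ hre1)).continuousAt (by fun_prop)
  have c2 : ContinuousAt (fun s : ℂ => Gamma (s / 2)) s :=
    ContinuousAt.comp (f := fun s : ℂ => s / 2) (g := Gamma)
      (differentiableAt_Gamma _ (hG _ hre2)).continuousAt (by fun_prop)
  have c3 : ContinuousAt (fun s : ℂ => riemannZeta (2 - 2 * s)) s := by
    refine ContinuousAt.comp (f := fun s : ℂ => 2 - 2 * s) (g := riemannZeta)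
      (differentiableAt_riemannZeta ?_).continuousAt (by fun_prop)
    intro h
    have := congrArg re h
    simp at this
    linarith
  have c4 : ContinuousAt (fun s : ℂ => riemannZeta (3 - 2 * s)) s := by
    refine ContinuousAt.comp (f := fun s : ℂ => 3 - 2 * s) (g := riemannZeta)
      (differentiableAt_riemannZeta ?_).continuousAt (by fun_prop)
    intro h
    rw [h] at hre3
    simp at hre3
  have c5 : ContinuousAt (fun s : ℂ => ∑ d ∈ discFamily D₁ D,
      ((Real.pi * X / (d : ℝ) : ℝ) : ℂ) ^ (s - 1 / 2)) s := by
    refine tendsto_finsetSum _ fun d hd => ?_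
    have hd0 : (0 : ℝ) < d := by
      have := one_lt_of_mem_discFamily hD₁ hd
      positivity
    have hbase : ((Real.pi * X / (d : ℝ) : ℝ) : ℂ) ≠ 0 := by
      have : Real.pi * X / (d : ℝ) ≠ 0 := by
        have := Real.pi_pos
        positivity
      exact_mod_cast this
    have : DifferentiableAt ℂ (fun s : ℂ => ((Real.pi * X / (d : ℝ) : ℝ) : ℂ) ^ (s - 1 / 2)) s :=
      (differentiableAt_id.sub_const _).const_cpow (Or.inl hbase)
    exact this.continuousAt
  unfold murmurationIntegrand
  exact (((continuousAt_const.mul (c1.div c2 (Gamma_ne_zero_of_re_pos hre2))).mul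
    (c3.div c4 (riemannZeta_ne_zero_of_one_lt_re hre3))).mul (continuousAt_const.mul c5)).div
    continuousAt_id (ne_zero_of_re_pos (by linarith))

lemma continuousAt_logDeriv_quadraticL {d : ℕ} (hd : IsFundamentalDiscriminant d) (h1 : 1 < d)
    {s : ℂ} (hs : quadraticL d s ≠ 0) :
    ContinuousAt (fun s => deriv (quadraticL d) s / quadraticL d s) s :=
  ((differentiable_quadraticL hd h1).analyticAt s).deriv.continuousAt.div
    ((differentiable_quadraticL hd h1) s).continuousAt hs

end Murmuration
end

noncomputable section
namespace Murmuration
open Complex MeasureTheory Filter Topology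
open scoped ArithmeticFunction.vonMangoldt

/-! ### The averaged explicit formula -/

lemma verticalIntegral_average {ι : Type*} (F : Finset ι) (c k : ℂ) {f : ι → ℂ → ℂ} {g m : ℂ → ℂ}
    {σ T : ℝ} (hT : 0 ≤ T) (hf : ∀ i ∈ F, ∀ t ∈ Set.Icc (-T) T, ContinuousAt (f i) (σ + t * I))
    (hg : ∀ t ∈ Set.Icc (-T) T, ContinuousAt g (σ + t * I))
    (hm : ∀ t ∈ Set.Icc (-T) T, ContinuousAt m (σ + t * I)) :
    verticalIntegral (fun s => c * ∑ i ∈ F, f i s - g s - k * m s) σ T =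
      c * ∑ i ∈ F, verticalIntegral (f i) σ T - verticalIntegral g σ T -
        k * verticalIntegral m σ T := by
  have hfi := fun i hi => continuousOn_segment (hf i hi) hT
  have hgi := continuousOn_segment hg hT
  have hmi := continuousOn_segment hm hT
  have hsum : IntervalIntegrable (fun t : ℝ => c * ∑ i ∈ F, f i (σ + t * I)) volume (-T) T := by
    refine IntervalIntegrable.const_mul ?_ c
    have := IntervalIntegrable.sum F (f := fun i (t : ℝ) => f i (σ + t * I)) hfi
    simpa only [Finset.sum_fn] using this
  simp only [verticalIntegral]
  rw [intervalIntegral.integral_sub (hsum.sub hgi) (hmi.const_mul k),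
    intervalIntegral.integral_sub hsum hgi, intervalIntegral.integral_const_mul,
    intervalIntegral.integral_const_mul, intervalIntegral.integral_finsetSum hfi, ← Finset.mul_sum]
  ring

/-- The four lines of the bound have separate sources: Perron and the shift for each `χ_d`, the two
remainders integrated against `X^s/s`, Perron for the even coefficients, and the sum of `log
p/(p+1)` over even powers. -/
theorem norm_oddAverage_sub_le {ε : ℝ} (hε : 0 < ε) (hε' : ε < 1 / 4) {X T D₁ D B : ℝ}
    (hT : 2 < T) (hTX : T < X) (hXZ : ∀ n : ℤ, X ≠ n) (hD₁ : 1 < D₁)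
    (hne : (discFamily D₁ D).Nonempty)
    (hzero : ∀ d ∈ discFamily D₁ D, ∀ z : ℂ, 1 / 2 + ε / 2 < z.re → |z.im| ≤ T + 2 →
      quadraticL d z ≠ 0)
    (hB : ∀ t ∈ Set.Icc (-T) T, ‖ratiosRemainder D (ε + t * I)‖ ≤ B ∧
      ‖ratiosRemainder ((⌊D₁⌋₊ : ℝ) + 1) (ε + t * I)‖ ≤ B) :
    2 * Real.pi * ‖(oddAverage D₁ D X : ℂ) -
        (murmurationTerm D₁ D X ε T + (evenTerm D₁ D X : ℂ))‖ ≤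
      (8 * X ^ (1 + ε) / T * mangoldtSum (1 + ε) + 1360 * Real.log X ^ 2 * (X / T) +
        X ^ (1 + ε) / T * (48 / ε ^ 2 * Real.log (16 * D * (T + 6)))) +
      4 * (((discFamily D₁ D).card : ℝ)⁻¹ * (2 * B) * X ^ (1 / 2 + ε)) * Real.log (1 + 2 * T) +
      (8 * X ^ (1 / 2 + ε) / T *
        (∑' n, ‖LSeries.term (fun n => (evenCoeff n : ℂ)) ((1 / 2 + ε : ℝ) : ℂ) n‖) +
        1360 * Real.log X ^ 2 * (X / T)) +
      2 * Real.pi * (13 * Real.log X ^ 3) := by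
  have hX : 0 < X := by linarith
  have hT0 : 0 < T := by linarith
  have hpi := Real.pi_pos
  set F := discFamily D₁ D with hF
  have hN : (0 : ℝ) < F.card := by exact_mod_cast hne.card_pos
  have hNc : (F.card : ℂ) ≠ 0 := by exact_mod_cast hne.card_pos.ne'
  set f : ℕ → ℂ → ℂ := fun d s =>
    -(deriv (quadraticL d) s / quadraticL d s) * ((X : ℂ) ^ s / s) with hf
  set g : ℂ → ℂ := fun s => LSeries (fun n => (evenCoeff n : ℂ)) s * ((X : ℂ) ^ s / s) with hg
  set c : ℂ := 1 / (F.card : ℂ) with hc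
  set k : ℂ := ((X ^ (1 / 2 : ℝ) : ℝ) : ℂ) with hk
  set E₁ := 8 * X ^ (1 + ε) / T * mangoldtSum (1 + ε) + 1360 * Real.log X ^ 2 * (X / T) +
        X ^ (1 + ε) / T * (48 / ε ^ 2 * Real.log (16 * D * (T + 6))) with hE₁
  have hB0 : 0 ≤ B := (norm_nonneg _).trans (hB 0 ⟨by linarith, by linarith⟩).1
  have hcn : ‖c‖ = (F.card : ℝ)⁻¹ := by rw [hc, norm_div, norm_one, norm_natCast, one_div]
  have hsegre : ∀ t : ℝ, (((1 / 2 + ε : ℝ) : ℂ) + t * I).re = 1 / 2 + ε := fun t => by simp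
  have hsegim : ∀ t : ℝ, (((1 / 2 + ε : ℝ) : ℂ) + t * I).im = t := fun t => by simp
  -- the contribution of the characters
  have H1 : ‖2 * Real.pi * I * (c * ∑ d ∈ F, (twistedPsi d X : ℂ)) -
      c * ∑ d ∈ F, verticalIntegral (f d) (1 / 2 + ε) T‖ ≤ E₁ := by
    have e : 2 * Real.pi * I * (c * ∑ d ∈ F, (twistedPsi d X : ℂ)) -
        c * ∑ d ∈ F, verticalIntegral (f d) (1 / 2 + ε) T =
        c * ∑ d ∈ F, (2 * Real.pi * I * (twistedPsi d X : ℂ) -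
          verticalIntegral (f d) (1 / 2 + ε) T) := by
      rw [Finset.sum_sub_distrib, ← Finset.mul_sum]
      ring
    rw [e, norm_mul, hcn]
    have hle : ∀ d ∈ F, ‖2 * Real.pi * I * (twistedPsi d X : ℂ) -
        verticalIntegral (f d) (1 / 2 + ε) T‖ ≤ E₁ := by
      intro d hd
      have hd1 := one_lt_of_mem_discFamily hD₁.le hd
      obtain ⟨-, hdD, hdf⟩ := mem_discFamily.mp hd
      refine (norm_twistedPsi_sub_verticalIntegral_le hε hε' hdf hd1 hT hTX hXZ
        (hzero d hd)).trans ?_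
      rw [hE₁]
      have hd0 : (0 : ℝ) < d := by exact_mod_cast (by omega : 0 < d)
      gcongr
    calc _ ≤ (F.card : ℝ)⁻¹ * (F.card * E₁) := by
          gcongr
          exact (norm_sum_le_of_le _ hle).trans_eq (by rw [Finset.sum_const, nsmul_eq_mul])
      _ = E₁ := by field_simp
  -- the contribution of the remainder
  have H2 : ‖c * ∑ d ∈ F, verticalIntegral (f d) (1 / 2 + ε) T -
      verticalIntegral g (1 / 2 + ε) T -
      k * verticalIntegral (murmurationIntegrand D₁ D X) (1 / 2 + ε) T‖ ≤
      4 * ((F.card : ℝ)⁻¹ * (2 * B) * X ^ (1 / 2 + ε)) * Real.log (1 + 2 * T) := by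
    rw [← verticalIntegral_average F c k hT0.le]
    · refine norm_verticalIntegral_le_log (by linarith) hT0.le (by positivity) fun t ht => ?_
      set r : ℂ := (ε : ℂ) + t * I with hr
      have hrre : r.re = ε := by simp [hr]
      have hs : ((1 / 2 + ε : ℝ) : ℂ) + t * I = 1 / 2 + r := by rw [hr]; push_cast; ring
      have hm := average_dualTerm_eq (D := D) hD₁.le hX (r := r) (by rw [hrre]; exact hε)
        (by rw [hrre]; exact hε')
      have hsum := sum_logDeriv_discFamily_eq hD₁ hne (r := r) (by rw [hrre]; exact hε)
      rw [← hF] at hm hsum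
      have hre := hsegre t
      rw [hs] at hre ⊢
      -- Pointwise, the average of `-L'/L` minus the diagonal and dual predictions is exactly minus
      -- the averaged difference of the remainders at `D` and `⌊D₁⌋ + 1`.
      have e : c * ∑ d ∈ F, f d (1 / 2 + r) - g (1 / 2 + r) -
          k * murmurationIntegrand D₁ D X (1 / 2 + r) =
          -(c * (ratiosRemainder D r - ratiosRemainder ((⌊D₁⌋₊ : ℝ) + 1) r) *
            ((X : ℂ) ^ (1 / 2 + r) / (1 / 2 + r))) := by
        rw [← hm]
        simp only [hf, hg]
        rw [← Finset.sum_mul, Finset.sum_neg_distrib, hsum, hc]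
        field_simp
        ring
      rw [e, norm_neg, norm_mul, norm_mul, hcn, norm_div, norm_cpow_eq_rpow_re_of_pos hX, hre,
        mul_div_assoc']
      gcongr
      have := norm_sub_le_of_le (hB t ht).1 (hB t ht).2
      linarith
    · intro d hd t ht
      have hd1 := one_lt_of_mem_discFamily hD₁.le hd
      obtain ⟨-, -, hdf⟩ := mem_discFamily.mp hd
      have hL : quadraticL d (((1 / 2 + ε : ℝ) : ℂ) + t * I) ≠ 0 := by
        refine hzero d hd _ (by rw [hsegre]; linarith) ?_
        rw [hsegim]
        linarith [abs_le.mpr ht]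
      exact (continuousAt_logDeriv_quadraticL hdf hd1 hL).neg.mul
        (continuousAt_cpow_div hX (by rw [hsegre]; linarith))
    · intro t _
      exact (continuousAt_LSeries_evenCoeff (by rw [hsegre]; linarith)).mul
        (continuousAt_cpow_div hX (by rw [hsegre]; linarith))
    · intro t _
      exact continuousAt_murmurationIntegrand hD₁.le hX (by rw [hsegre]; linarith)
        (by rw [hsegre]; linarith)
  -- the contribution of the even powers
  have H3 := norm_sum_evenCoeff_sub_verticalIntegral_le hε hε' hT hTX hXZ
  set S := ∑ q ∈ primePowerPairs X with Even q.2, Real.log q.1 / ((q.1 : ℝ) + 1) with hS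
  have hSle : S ≤ 13 * Real.log X ^ 3 := sum_even_log_div_le (by linarith)
  have hS0 : 0 ≤ S := by
    refine Finset.sum_nonneg fun q hq => ?_
    exact div_nonneg (Real.log_natCast_nonneg _) (by positivity)
  have hcoeff : ∑ n ∈ Finset.range ⌈X⌉₊, (evenCoeff n : ℂ) = (evenLogSum X : ℂ) - (S : ℂ) := by
    rw [← ofReal_sub, hS, ← sum_evenCoeff]
    push_cast
    rfl
  have hodd : (oddAverage D₁ D X : ℂ) = c * ∑ d ∈ F, (twistedPsi d X : ℂ) -
      (evenLogSum X : ℂ) + (evenTerm D₁ D X : ℂ) := by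
    rw [oddAverage_eq hD₁.le hne]
    push_cast
    rfl
  have hmur : 2 * Real.pi * I * murmurationTerm D₁ D X ε T =
      k * verticalIntegral (murmurationIntegrand D₁ D X) (1 / 2 + ε) T := by
    rw [murmurationTerm]
    have : (Real.pi : ℂ) ≠ 0 := by exact_mod_cast hpi.ne'
    have := I_ne_zero
    field_simp
    rw [hk]
    ring
  have hmain : 2 * Real.pi * I * ((oddAverage D₁ D X : ℂ) -
      (murmurationTerm D₁ D X ε T + (evenTerm D₁ D X : ℂ))) =
      (2 * Real.pi * I * (c * ∑ d ∈ F, (twistedPsi d X : ℂ)) -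
        c * ∑ d ∈ F, verticalIntegral (f d) (1 / 2 + ε) T) +
      (c * ∑ d ∈ F, verticalIntegral (f d) (1 / 2 + ε) T - verticalIntegral g (1 / 2 + ε) T -
        k * verticalIntegral (murmurationIntegrand D₁ D X) (1 / 2 + ε) T) +
      (verticalIntegral g (1 / 2 + ε) T -
        2 * Real.pi * I * ∑ n ∈ Finset.range ⌈X⌉₊, (evenCoeff n : ℂ)) -
      2 * Real.pi * I * (S : ℂ) := by
    rw [hcoeff, hodd]
    linear_combination -hmur
  have h2pi : ‖(2 * Real.pi * I : ℂ)‖ = 2 * Real.pi := by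
    simp [abs_of_pos hpi]
  rw [← h2pi, ← norm_mul, hmain]
  refine (norm_sub_le _ _).trans (add_le_add ((norm_add_le _ _).trans
    (add_le_add ((norm_add_le _ _).trans (add_le_add H1 H2)) H3)) ?_)
  rw [norm_mul, norm_real, Real.norm_of_nonneg hS0]
  gcongr

/-! ### Absorbing the error terms -/

lemma log_le_mul_rpow {x ε : ℝ} (hx : 0 ≤ x) (hε : 0 < ε) : Real.log x ≤ ε⁻¹ * x ^ ε := by
  have := Real.log_le_rpow_div hx hε
  rwa [div_eq_inv_mul] at this

lemma log_mul_le_mul_rpow {a x ε : ℝ} (ha : 1 ≤ a) (hx : 0 ≤ x) (hε : 0 < ε) (hε' : ε ≤ 1) :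
    Real.log (a * x) ≤ a / ε * x ^ ε := by
  refine (log_le_mul_rpow (by positivity) hε).trans ?_
  rw [Real.mul_rpow (by linarith) hx, div_eq_inv_mul, mul_assoc]
  gcongr
  calc a ^ ε ≤ a ^ (1 : ℝ) := Real.rpow_le_rpow_of_exponent_le ha hε'
    _ = a := Real.rpow_one a

/-- Using exponent `ε/3` for one logarithm leaves room for three factors. -/
lemma log_pow_le_mul_rpow {X ε : ℝ} (hX : 1 ≤ X) (hε : 0 < ε) {n : ℕ} (hn : n ≤ 3) :
    Real.log X ^ n ≤ (3 / ε) ^ n * X ^ ε := by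
  have h1 : Real.log X ≤ 3 / ε * X ^ (ε / 3) := by
    have := log_le_mul_rpow (x := X) (by linarith) (by linarith : 0 < ε / 3)
    rwa [inv_div] at this
  calc Real.log X ^ n ≤ (3 / ε * X ^ (ε / 3)) ^ n :=
        pow_le_pow_left₀ (Real.log_nonneg hX) h1 n
    _ = (3 / ε) ^ n * X ^ (ε / 3 * n) := by
        rw [mul_pow, ← Real.rpow_natCast (X ^ (ε / 3)), ← Real.rpow_mul (by linarith)]
    _ ≤ (3 / ε) ^ n * X ^ ε := by
        have h3 : (n : ℝ) ≤ 3 := by exact_mod_cast hn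
        gcongr
        nlinarith

/-- Powers of `log X` cost `X^ε`, `log(1 + 2T)` costs `T^ε`, and `log(16 D (T + 6))` costs `(TD)^ε`.
Terms without a factor `1/T` are absorbed using `1 ≤ X/T`. -/
theorem exists_errorTerm_bound {ε : ℝ} (hε : 0 < ε) (hε' : ε < 1 / 4) (S₁ S₂ : ℝ) (hS₁ : 0 ≤ S₁)
    (hS₂ : 0 ≤ S₂) :
    ∃ K : ℝ, ∀ X T D N B : ℝ, 2 < T → T < X → 1 < D → 0 ≤ N → 0 ≤ B →
      (8 * X ^ (1 + ε) / T * S₁ + 1360 * Real.log X ^ 2 * (X / T) +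
        X ^ (1 + ε) / T * (48 / ε ^ 2 * Real.log (16 * D * (T + 6)))) +
      4 * (N * (2 * B) * X ^ (1 / 2 + ε)) * Real.log (1 + 2 * T) +
      (8 * X ^ (1 / 2 + ε) / T * S₂ + 1360 * Real.log X ^ 2 * (X / T)) +
      2 * Real.pi * (13 * Real.log X ^ 3) ≤
      K * (X ^ (1 / 2 + ε) * T ^ ε * B * N + X ^ (1 + ε) * T ^ (-1 + ε) * D ^ ε) := by
  set K₁ := 8 * S₁ + 2 * (1360 * (3 / ε) ^ 2) + 48 / ε ^ 2 * (64 / ε) + 8 * S₂ +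
    2 * Real.pi * (13 * (3 / ε) ^ 3) with hK₁
  set K₂ := 8 * (3 / ε) with hK₂
  have hpi := Real.pi_pos
  refine ⟨K₁ + K₂, fun X T D N B hT hTX hD hN hB => ?_⟩
  have hX : 0 < X := by linarith
  have hT0 : 0 < T := by linarith
  set Z := X ^ (1 + ε) / T with hZ
  set Y := X ^ (1 + ε) * T ^ (-1 + ε) * D ^ ε with hY
  set W := X ^ (1 / 2 + ε) * T ^ ε * B * N with hW
  have hTε : 1 ≤ T ^ ε := Real.one_le_rpow (by linarith) hε.le
  have hDε : 1 ≤ D ^ ε := Real.one_le_rpow hD.le hε.le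
  have hYZ : Y = Z * (T ^ ε * D ^ ε) := by
    rw [hY, hZ, show (-1 + ε) = ε - 1 by ring, Real.rpow_sub hT0, Real.rpow_one]
    ring
  have hZ0 : 0 ≤ Z := by positivity
  have hTD : 1 ≤ T ^ ε * D ^ ε := one_le_mul_of_one_le_of_one_le hTε hDε
  have hZY : Z ≤ Y := by
    rw [hYZ]
    exact le_mul_of_one_le_right hZ0 hTD
  have hXT : 1 ≤ X / T := (one_le_div hT0).mpr hTX.le
  have hZX : X ^ ε * (X / T) = Z := by
    rw [hZ, Real.rpow_add hX, Real.rpow_one]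
    ring
  have b1 : 8 * X ^ (1 + ε) / T * S₁ ≤ 8 * S₁ * Y := by
    calc 8 * X ^ (1 + ε) / T * S₁ = 8 * S₁ * Z := by rw [hZ]; ring
      _ ≤ _ := by gcongr
  have b2 : 1360 * Real.log X ^ 2 * (X / T) ≤ 1360 * (3 / ε) ^ 2 * Y := by
    calc 1360 * Real.log X ^ 2 * (X / T) ≤ 1360 * ((3 / ε) ^ 2 * X ^ ε) * (X / T) := by
          gcongr
          exact log_pow_le_mul_rpow (by linarith) hε (by norm_num)
      _ = 1360 * (3 / ε) ^ 2 * (X ^ ε * (X / T)) := by ring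
      _ ≤ _ := by rw [hZX]; gcongr
  have b3 : X ^ (1 + ε) / T * (48 / ε ^ 2 * Real.log (16 * D * (T + 6))) ≤
      48 / ε ^ 2 * (64 / ε) * Y := by
    -- The constant `64` works because `T + 6 ≤ 4T` for `T ≥ 2`.
    have hl : Real.log (16 * D * (T + 6)) ≤ 64 / ε * (T ^ ε * D ^ ε) := by
      rw [← Real.mul_rpow hT0.le (by linarith)]
      refine le_trans (Real.log_le_log (by positivity) ?_)
        (log_mul_le_mul_rpow (by norm_num : (1 : ℝ) ≤ 64) (by positivity) hε (by linarith))
      nlinarith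
    calc _ ≤ Z * (48 / ε ^ 2 * (64 / ε * (T ^ ε * D ^ ε))) := by gcongr
      _ = 48 / ε ^ 2 * (64 / ε) * Y := by rw [hYZ]; ring
  have b4 : 4 * (N * (2 * B) * X ^ (1 / 2 + ε)) * Real.log (1 + 2 * T) ≤ K₂ * W := by
    have hl : Real.log (1 + 2 * T) ≤ 3 / ε * T ^ ε := by
      refine le_trans (Real.log_le_log (by positivity) ?_)
        (log_mul_le_mul_rpow (by norm_num : (1 : ℝ) ≤ 3) hT0.le hε (by linarith))
      linarith
    calc _ ≤ 4 * (N * (2 * B) * X ^ (1 / 2 + ε)) * (3 / ε * T ^ ε) := by gcongr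
      _ = K₂ * W := by rw [hK₂, hW]; ring
  have b5 : 8 * X ^ (1 / 2 + ε) / T * S₂ ≤ 8 * S₂ * Y := by
    calc 8 * X ^ (1 / 2 + ε) / T * S₂ ≤ 8 * X ^ (1 + ε) / T * S₂ := by
          gcongr
          · linarith
          · norm_num
      _ = 8 * S₂ * Z := by rw [hZ]; ring
      _ ≤ _ := by gcongr
  have b6 : 2 * Real.pi * (13 * Real.log X ^ 3) ≤ 2 * Real.pi * (13 * (3 / ε) ^ 3) * Y := by
    calc 2 * Real.pi * (13 * Real.log X ^ 3) ≤ 2 * Real.pi * (13 * ((3 / ε) ^ 3 * X ^ ε)) := by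
          gcongr
          exact log_pow_le_mul_rpow (by linarith) hε le_rfl
      _ = 2 * Real.pi * (13 * (3 / ε) ^ 3) * X ^ ε := by ring
      _ ≤ 2 * Real.pi * (13 * (3 / ε) ^ 3) * Y := by
          gcongr
          refine le_trans ?_ hZY
          rw [← hZX]
          exact le_mul_of_one_le_right (by positivity) hXT
  have hW0 : 0 ≤ W := by positivity
  have hY0 : 0 ≤ Y := hZ0.trans hZY
  have hK₁0 : 0 ≤ K₁ := by positivity
  have hK₂0 : 0 ≤ K₂ := by positivity
  have hsum : K₁ * Y + K₂ * W ≤ (K₁ + K₂) * (W + Y) := by nlinarith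
  refine le_trans ?_ hsum
  rw [hK₁]
  linarith

/-- The condition `T ≤ C D₁^{1-ε}` passes to every larger parameter. It therefore serves the
remainder at `D`, the remainder at `⌊D₁⌋ + 1`, and the zero-free region of each `d` in the family.
Monotonicity of `R` bounds both remainders by `R D`. -/
theorem explicitFormula_bound (hratios : RatiosConjecture) {ε : ℝ} (hε : 0 < ε)
    (hε' : ε < 1 / 4) {C : ℝ} (hC : 0 < C) :
    ∃ K : ℝ, ∀ R : ℝ → ℝ, MonotoneOn R (Set.Ioi 1) →
      (∀ D t : ℝ, 1 < D → |t| ≤ C * D ^ (1 - ε) →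
        ‖ratiosRemainder D ((ε : ℂ) + (t : ℂ) * I)‖ ≤ R D) →
      ∀ X T D₁ D : ℝ, 2 < T → T < X → (∀ n : ℤ, X ≠ n) → 1 < D₁ →
        (discFamily D₁ D).Nonempty → T ≤ C * D₁ ^ (1 - ε) →
        ‖(oddAverage D₁ D X : ℂ) - (murmurationTerm D₁ D X ε T + (evenTerm D₁ D X : ℂ))‖ ≤
          K * (X ^ (1 / 2 + ε) * T ^ ε * R D * ((discFamily D₁ D).card : ℝ)⁻¹ +
            X ^ (1 + ε) * T ^ (-1 + ε) * D ^ ε) := by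
  obtain ⟨K, hK⟩ := exists_errorTerm_bound hε hε' (mangoldtSum (1 + ε))
    (∑' n, ‖LSeries.term (fun n => (evenCoeff n : ℂ)) ((1 / 2 + ε : ℝ) : ℂ) n‖)
    (tsum_nonneg fun _ => norm_nonneg _) (tsum_nonneg fun _ => norm_nonneg _)
  refine ⟨K / (2 * Real.pi), fun R hmono hR X T D₁ D hT hTX hXZ hD₁ hne hTD => ?_⟩
  have hpi := Real.pi_pos
  have hD₁pow : 1 ≤ D₁ ^ (1 - ε) := Real.one_le_rpow hD₁.le (by linarith)
  obtain ⟨e, he⟩ := id hne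
  obtain ⟨he1, he2, -⟩ := mem_discFamily.mp he
  have hD : 1 < D := by linarith
  set D₂ : ℝ := (⌊D₁⌋₊ : ℝ) + 1 with hD₂
  have hD₁₂ : D₁ < D₂ := Nat.lt_floor_add_one D₁
  have hD₂D : D₂ ≤ D := by
    have h : ⌊D₁⌋₊ + 1 ≤ e := (Nat.floor_lt (by linarith)).mpr he1
    have : D₂ ≤ e := by rw [hD₂]; exact_mod_cast h
    linarith
  have hT_le : ∀ D' : ℝ, D₁ ≤ D' → T ≤ C * D' ^ (1 - ε) := by
    intro D' hD'
    refine hTD.trans ?_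
    gcongr
    linarith
  have hB : ∀ t ∈ Set.Icc (-T) T, ‖ratiosRemainder D (ε + t * I)‖ ≤ R D ∧
      ‖ratiosRemainder D₂ (ε + t * I)‖ ≤ R D := by
    intro t ht
    have ht' : |t| ≤ T := abs_le.mpr ht
    refine ⟨hR D t hD (ht'.trans (hT_le D (by linarith))), ?_⟩
    refine (hR D₂ t (by linarith) (ht'.trans (hT_le D₂ hD₁₂.le))).trans ?_
    exact hmono (Set.mem_Ioi.mpr (by linarith)) (Set.mem_Ioi.mpr hD) hD₂D
  have hzero : ∀ d ∈ discFamily D₁ D, ∀ z : ℂ, 1 / 2 + ε / 2 < z.re → |z.im| ≤ T + 2 →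
      quadraticL d z ≠ 0 := by
    intro d hd z hz1 hz2
    obtain ⟨hd1, -, hdf⟩ := mem_discFamily.mp hd
    -- Enlarging `C` to `C + 2` covers the height `T + 2`, since `d^{1-ε} ≥ 1`.
    refine quadraticL_ne_zero hratios hε (by linarith) (by linarith : 0 < ε / 2) (by linarith)
      (by linarith : 0 < C + 2) hdf (one_lt_of_mem_discFamily hD₁.le hd) hz1 ?_
    have h1 := hT_le d hd1.le
    have h2 : 1 ≤ (d : ℝ) ^ (1 - ε) := Real.one_le_rpow (by linarith) (by linarith)
    linarith
  have hR0 : 0 ≤ R D := (norm_nonneg _).trans (hB 0 ⟨by linarith, by linarith⟩).1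
  have h := (norm_oddAverage_sub_le hε hε' hT hTX hXZ hD₁ hne hzero hB).trans
    (hK X T D ((discFamily D₁ D).card : ℝ)⁻¹ (R D) hT hTX hD (by positivity) hR0)
  rw [div_mul_eq_mul_div, le_div_iff₀ (by positivity), mul_comm]
  exact h

end Murmuration
end

theorem mainTheorem4 (hratios : Murmuration.RatiosConjecture)
    (ε : ℝ) (hε : 0 < ε) (hε' : ε < 1 / 4) (C : ℝ) (hC : 0 < C) :
    (∀ η : ℝ, 0 < η → ∃ K : ℝ, ∀ D t : ℝ, 1 < D → |t| ≤ C * D ^ (1 - ε) →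
      ‖Murmuration.ratiosRemainder D ((ε : ℂ) + (t : ℂ) * Complex.I)‖ ≤
        K * D ^ (1 / 2 + η)) ∧
    (∃ K : ℝ, ∀ R : ℝ → ℝ, MonotoneOn R (Set.Ioi 1) →
      (∀ D t : ℝ, 1 < D → |t| ≤ C * D ^ (1 - ε) →
        ‖Murmuration.ratiosRemainder D ((ε : ℂ) + (t : ℂ) * Complex.I)‖ ≤ R D) →
      ∀ X T D₁ D : ℝ, 2 < T → T < X → (∀ n : ℤ, X ≠ n) → 1 / Real.log X < ε →
        1 < D₁ → D₁ < D → (Murmuration.discFamily D₁ D).Nonempty →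
        T ≤ C * X ^ (1 - ε) → T ≤ C * D₁ ^ (1 - ε) →
        ‖(Murmuration.oddAverage D₁ D X : ℂ) -
            (Murmuration.murmurationTerm D₁ D X ε T + (Murmuration.evenTerm D₁ D X : ℂ))‖ ≤
          K * (X ^ (1 / 2 + ε) * T ^ ε * R D * ((Murmuration.discFamily D₁ D).card : ℝ)⁻¹ +
            X ^ (1 + ε) * T ^ (-1 + ε) * D ^ ε)) := by
  refine ⟨fun η hη => Murmuration.ratiosRemainder_bound hratios hε hε' hC hη, ?_⟩
  obtain ⟨K, hK⟩ := Murmuration.explicitFormula_bound hratios hε hε' hC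
  exact ⟨K, fun R hmono hR X T D₁ D hT hTX hXZ _ hD₁ _ hne _ hTD =>
    hK R hmono hR X T D₁ D hT hTX hXZ hD₁ hne hTD⟩
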